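/- Let $\mathring{g}$ be the round metric on the unit sphere $\mathbb{S}^2$, and let $\mathring{H}^k$ be the $L^2$-based Sobolev norm of order $k$ for functions and tensors with respect to $\mathring{g}$. For a Riemannian metric $g$ on $\mathbb{S}^2$ let $\nabla$, $\mathrm{dVol}_g$ and $\epsilon^{AB}$ be its Levi-Civita connection, area measure and area form; for a vector field $b$ put $\mathrm{div}\,b=\nabla^Ab_A$, $\mathrm{curl}\,b=\epsilon^{AB}\nabla_Ab_B$ and $(\nabla\hat\otimes b)_{AB}=\nabla_Ab_B+\nabla_Bb_A-(\mathrm{div}\,b)\,g_{AB}$, where indices are raised and lowered and norms are taken with $g$. There is $M_0$ such that for every integer $M\ge M_0$ and every $K>0$ there are constants $\varepsilon_0>0$ and $C>0$ with the following property. Let $0<\varepsilon\le\varepsilon_0$, let $g$ be a Riemannian metric on $\mathbb{S}^2$ with $\|g-\mathring g\|_{\mathring H^M}\le K\varepsilon$, and let $\mathcal{O},W$ be functions on $\mathbb{S}^2$ with $$\int_{\mathbb{S}^2}\mathcal{O}\,\mathrm{dVol}_g=\int_{\mathbb{S}^2}W\,\mathrm{dVol}_g=0,\qquad \|(\mathcal{O},\mathring\nabla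 W)\|_{\mathring H^{M-1}}\le K\varepsilon .$$ ($g$, $\mathcal{O}$ and $W$ are identified with their continuous representatives.) Then there exist a vector field $b$ on $\mathbb{S}^2$ of class $C^2$ with $\|b\|_{\mathring H^M}\le C\varepsilon$ and a constant $a\in\mathbb{R}$ with $|a|\le C\varepsilon$ such that $\mathrm{curl}\,b=\mathcal{O}$ and such that $(g,b,\Omega\underline\omega)$ with $\Omega\underline\omega=W+a$ solves the seed constraint equation $$\mathcal{L}_b\,\mathrm{div}\,b-\mathrm{div}\,b+\tfrac12(\mathrm{div}\,b)^2-8\,\Omega\underline\omega+4\,\Omega\underline\omega\,\mathrm{div}\,b+\tfrac14\,|\nabla\hat\otimes b|^2=0\quad\text{on }\mathbb{S}^2 .$$ -/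

import Mathlib

open MeasureTheory
open scoped ENNReal ContDiff Matrix

namespace SphereSeed

noncomputable section

/-- Euclidean three-space, with standard orthonormal basis `e₀, e₁, e₂`. -/
abbrev E3 : Type := EuclideanSpace ℝ (Fin 3)

/-- The unit sphere in Euclidean three-space. The tangent space at `x` is the plane orthogonal to
`x`, and tensor fields on the sphere are given by their components with respect to the basis
`e₀, e₁, e₂`: a vector field is a map `b : S2 → E3` with `b x` orthogonal to `x`, and a symmetric
`(0,2)`-tensor is a field of symmetric `3 × 3` matrices that annihilate the normal `x`. -/
abbrev S2 : Type := Metric.sphere (0 : E3) 1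

/-- The area measure of the round unit sphere (total mass `4π`). -/
def area : Measure S2 := (volume : Measure E3).toSphere

/-! ### Classical derivatives on the sphere -/

/-- The radially constant extension `y ↦ f (y / ‖y‖)` of a function on the sphere. -/
def ext (f : S2 → ℝ) (y : E3) : ℝ :=
  if h : y = 0 then 0
  else f ⟨‖y‖⁻¹ • y, by
    simp [norm_smul, inv_mul_cancel₀ (norm_ne_zero_iff.mpr h)]⟩

/-- `f` is of class `C^n` on the sphere. -/
def IsCn (n : ℕ) (f : S2 → ℝ) : Prop :=
  ContDiffOn ℝ n (ext f) {0}ᶜ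

/-- The derivative of `f` at `x` in the direction of the tangential part `eₖ - xₖ x` of `eₖ`. By
linearity, the differential of `f` at `x` on a tangent vector `v` is `∑ k, v k * pd k f x`. -/
def pd (k : Fin 3) (f : S2 → ℝ) (x : S2) : ℝ :=
  fderiv ℝ (ext f) (x : E3) (EuclideanSpace.single k 1)

/-! ### Sobolev norms with respect to the round metric

They are built from the angular momentum operators `Z₀, Z₁, Z₂`, that is, from the derivatives along
the rotation fields `x ↦ eᵢ × x`, which are divergence free and span every tangent space. The
gradient of the round metric satisfies `|∇f|² = ∑ i, (Z_i f)²`. -/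

/-- The rotation field `x ↦ eᵢ × x`. -/
def rot (i : Fin 3) (x : E3) : E3 :=
  WithLp.toLp 2 (crossProduct (Pi.single i 1 : Fin 3 → ℝ) x.ofLp)

/-- `h` is the weak derivative `Z_i f`; both functions are in `L²`. The test functions are the
smooth functions on the sphere, written as restrictions of smooth functions on the whole space. -/
def IsWeakRot (i : Fin 3) (f h : S2 → ℝ) : Prop :=
  MemLp f 2 area ∧ MemLp h 2 area ∧
    ∀ φ : E3 → ℝ, ContDiff ℝ ∞ φ →
      ∫ x : S2, f x * fderiv ℝ φ (x : E3) (rot i x) ∂area = - ∫ x : S2, h x * φ x ∂area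

/-- The square of the `H^k` norm of a (measurable) function,
`∑_{j ≤ k} ∑_{i₁, …, i_j} ‖Z_{i_j} ⋯ Z_{i₁} f‖²_{L²}`; it is infinite if one of the weak derivatives
does not exist in `L²`. -/
def sobolevSq : ℕ → (S2 → ℝ) → ℝ≥0∞
  | 0, f => ∫⁻ x, ‖f x‖ₑ ^ 2 ∂area
  | k + 1, f => (∫⁻ x, ‖f x‖ₑ ^ 2 ∂area)
      + ∑ i : Fin 3, ⨅ (h : S2 → ℝ) (_ : IsWeakRot i f h), sobolevSq k h

/-- The square of the `H^k` norm of the gradient of `f`. -/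
def gradSobolevSq (k : ℕ) (f : S2 → ℝ) : ℝ≥0∞ :=
  ∑ i : Fin 3, ⨅ (h : S2 → ℝ) (_ : IsWeakRot i f h), sobolevSq k h

/-- The `H^k` norm of a vector field. -/
def vectorNorm (k : ℕ) (b : S2 → E3) : ℝ≥0∞ :=
  (∑ i : Fin 3, sobolevSq k (fun x => b x i)) ^ (1 / 2 : ℝ)

/-- The `H^k` norm of a `(0,2)`-tensor. -/
def tensorNorm (k : ℕ) (T : S2 → Matrix (Fin 3) (Fin 3) ℝ) : ℝ≥0∞ :=
  (∑ i : Fin 3, ∑ j : Fin 3, sobolevSq k (fun x => T x i j)) ^ (1 / 2 : ℝ)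

/-- The `H^k` norm of the pair `(O, ∇W)`, where `∇` is the gradient of the round metric. -/
def dataNorm (k : ℕ) (O W : S2 → ℝ) : ℝ≥0∞ :=
  (sobolevSq k O + gradSobolevSq k W) ^ (1 / 2 : ℝ)

/-! ### Riemannian metrics on the sphere -/

/-- The matrix `x xᵀ`, the orthogonal projection onto the normal line at `x`. -/
def normal (x : S2) : Matrix (Fin 3) (Fin 3) ℝ :=
  Matrix.vecMulVec (x : E3).ofLp (x : E3).ofLp

/-- The round metric: the Euclidean inner product on tangent vectors. -/
def round (x : S2) : Matrix (Fin 3) (Fin 3) ℝ := 1 - normal x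

/-- `g` is a continuous Riemannian metric on the sphere. -/
structure IsMetric (g : S2 → Matrix (Fin 3) (Fin 3) ℝ) : Prop where
  continuous : Continuous g
  symm : ∀ x, (g x).IsSymm
  tangential : ∀ x : S2, g x *ᵥ (x : E3).ofLp = 0
  pos : ∀ (x : S2) (v : Fin 3 → ℝ), v ⬝ᵥ (x : E3).ofLp = 0 → v ≠ 0 → 0 < v ⬝ᵥ g x *ᵥ v

/-- The inverse metric `g^{AB}`, as a tangential tensor: `g x + x xᵀ` is `g x` on the tangent plane
and the identity on the normal line. -/
def inverse (g : S2 → Matrix (Fin 3) (Fin 3) ℝ) (x : S2) : Matrix (Fin 3) (Fin 3) ℝ :=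
  (g x + normal x)⁻¹ - normal x

/-- The density of the area measure of `g` with respect to that of the round metric. -/
def density (g : S2 → Matrix (Fin 3) (Fin 3) ℝ) (x : S2) : ℝ :=
  Real.sqrt (g x + normal x).det

/-- The integral of `f` with respect to the area measure of `g`. -/
def integralVol (g : S2 → Matrix (Fin 3) (Fin 3) ℝ) (f : S2 → ℝ) : ℝ :=
  ∫ x, f x * density g x ∂area

/-- The covariant derivative `∇_A b_B` for the Levi-Civita connection of `g` (Koszul's formula): for
tangent vectors `u, w` at `x` one has `g (∇_u b) w = ∑ i, ∑ j, u i * w j * covD g b x i j`. Here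
`∇_u b` is the tangential part of the Euclidean derivative of `b` along `u`, which is its round
covariant derivative, plus the difference of the two Levi-Civita connections. Only the restriction
of this bilinear form to tangent vectors is meaningful and is used. -/
def covD (g : S2 → Matrix (Fin 3) (Fin 3) ℝ) (b : S2 → E3) (x : S2) (i j : Fin 3) : ℝ :=
  (∑ l : Fin 3, g x j l * pd i (fun y => b y l) x)
    + 1 / 2 * ∑ l : Fin 3, b x l *
      (pd i (fun y => g y l j) x + pd l (fun y => g y i j) x - pd j (fun y => g y i l) x)

/-- The divergence `g^{AB} ∇_A b_B`. -/
def div (g : S2 → Matrix (Fin 3) (Fin 3) ℝ) (b : S2 → E3) (x : S2) : ℝ :=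
  ∑ i : Fin 3, ∑ j : Fin 3, inverse g x i j * covD g b x i j

/-- The curl `ε^{AB} ∇_A b_B`, where `ε` is the area form of `g` for the orientation of the sphere by
its outer normal; `ε^{AB}` is the round `⟨x, eᵢ × eⱼ⟩` divided by the density of `g`. -/
def curl (g : S2 → Matrix (Fin 3) (Fin 3) ℝ) (b : S2 → E3) (x : S2) : ℝ :=
  (density g x)⁻¹ * ∑ i : Fin 3, ∑ j : Fin 3,
    ((x : E3).ofLp ⬝ᵥ crossProduct (Pi.single i 1 : Fin 3 → ℝ) (Pi.single j 1)) * covD g b x i j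

/-- The trace-free symmetrized derivative
`(∇ ⊗̂ b)_{AB} = ∇_A b_B + ∇_B b_A - (div b) g_{AB}`. -/
def hatD (g : S2 → Matrix (Fin 3) (Fin 3) ℝ) (b : S2 → E3) (x : S2) (i j : Fin 3) : ℝ :=
  covD g b x i j + covD g b x j i - div g b x * g x i j

/-- The square norm `|∇ ⊗̂ b|²` with respect to `g`. -/
def hatDNormSq (g : S2 → Matrix (Fin 3) (Fin 3) ℝ) (b : S2 → E3) (x : S2) : ℝ :=
  ∑ i : Fin 3, ∑ j : Fin 3, ∑ k : Fin 3, ∑ l : Fin 3,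
    inverse g x i k * inverse g x j l * hatD g b x i j * hatD g b x k l

/-- The Lie derivative of a function along `b`. -/
def lie (b : S2 → E3) (f : S2 → ℝ) (x : S2) : ℝ :=
  ∑ k : Fin 3, b x k * pd k f x

/-- The constraint equation for seed data `(g, b, w)`, where `w` stands for `Ω ω̲`. -/
def SeedConstraint (g : S2 → Matrix (Fin 3) (Fin 3) ℝ) (b : S2 → E3) (w : S2 → ℝ) : Prop :=
  ∀ x, lie b (div g b) x - div g b x + 1 / 2 * div g b x ^ 2 - 8 * w x
    + 4 * w x * div g b x + 1 / 4 * hatDNormSq g b x = 0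

end

end SphereSeed

open MeasureTheory
open scoped ENNReal ContDiff Matrix

namespace SphereSeed

noncomputable section

/-! Put `f = div b + 8a`. As `a` is constant, the constraint is the transport equation `f = L_b f -
8W + Q` with `Q = (1/2)(div b)² + 4(W + a) div b + (1/4)|∇ ⊗̂ b|²`, quadratic in small quantities.
Conversely, `f` and `O` determine `b` through a Hodge system of the round metric. With `h = g -
round`, `div_g b` is the round divergence plus the derivative of the logarithm of the density along
`b`, and the density times `curl_g b` is the round curl of `b` plus that of the covector `h b`. The
two Laplace equations for the potentials need right sides of mean zero: for the divergence this
fixes `a`, for the curl it is `∫ O dVol_g = 0`. The density enters polynomially, through an unknown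
`v` with `det (1 + h) (1 + v)² = 1`.

The system is solved by iteration. Transport gains no derivative, `Q` costs one and the Hodge system
regains it, so `b` in order `k + 1` and `f` in order `k` stay bounded (`exists_transport_estimate`,
`exists_sn_hodge_le`). Differences of iterates are only controlled in order `k - 2` and `k - 1`,
because a change of the velocity hits a derivative of `f` (`exists_transport_diff`). The data enter
linearly with size `η` and the state only quadratically, so one step maps the size `δ` to `C (η +
δ²)` while differences are halved (`exists_step_bound`, `exists_iteration`).

All iterates are polynomials on the sphere. The rotation derivations `Z i` are antisymmetric in
`L²`, preserve the degree, and hence commute with the orthogonal projections to polynomials of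
degree at most `N` and with the Laplacian. So the transport equation truncated at degree `N` is a
finite linear system with energy estimates uniform in `N`. Step `n` truncates the data and the
transport equation at degree `2 ^ (n + 1)`, and a lost derivative pays for the geometric decay of
the truncation error (`sn_sub_pr_le`).

The iterates converge in `C²`, the polynomial expressions converge to the geometric quantities of
`g` and `b` (`IsLimit`), and the top-order Sobolev bound passes to the limit by lower semicontinuity
(`Conv.sobolevSq_le`). Finally, only the gradient of `W` is controlled: the round mean `m` of `W` is
moved into `a`, and `∫ W dVol_g = 0` bounds `m`. -/

instance : IsFiniteMeasure area := inferInstanceAs (IsFiniteMeasure (volume : Measure E3).toSphere)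

instance : area.IsOpenPosMeasure :=
  inferInstanceAs (volume : Measure E3).toSphere.IsOpenPosMeasure

instance : NeZero area := ⟨Measure.toSphere_ne_zero _⟩

/-! ### Rotation invariance of the area measure -/

/-- The map of the sphere induced by a linear isometry. -/
def sphereMap (L : E3 ≃ₗᵢ[ℝ] E3) (x : S2) : S2 := ⟨L x, by simp⟩

lemma continuous_sphereMap (L : E3 ≃ₗᵢ[ℝ] E3) : Continuous (sphereMap L) := by
  unfold sphereMap; fun_prop

-- The sphere measure of `s` is a multiple of the volume of the cone over `s`; a linear isometry
-- maps cones to cones and preserves volume.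
open scoped Pointwise in
lemma measurePreserving_sphereMap (L : E3 ≃ₗᵢ[ℝ] E3) :
    MeasurePreserving (sphereMap L) area area := by
  refine ⟨(continuous_sphereMap L).measurable, ?_⟩
  ext s hs
  rw [Measure.map_apply (continuous_sphereMap L).measurable hs, area,
    Measure.toSphere_apply' _ hs,
    Measure.toSphere_apply' _ ((continuous_sphereMap L).measurable hs)]
  congr 1
  rw [← L.measurePreserving.measure_preimage_equiv (f := L.toMeasurableEquiv)
    (Set.Ioo (0 : ℝ) 1 • (Subtype.val '' s))]
  congr 1
  ext y
  simp only [Set.mem_smul, Set.mem_preimage, Set.mem_image, LinearIsometryEquiv.coe_toMeasurableEquiv]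
  constructor
  · rintro ⟨r, hr, _, ⟨x, hx, rfl⟩, rfl⟩
    exact ⟨r, hr, _, ⟨_, hx, rfl⟩, by simp [sphereMap]⟩
  · rintro ⟨r, hr, _, ⟨x, hx, rfl⟩, h⟩
    refine ⟨r, hr, _, ⟨sphereMap L.symm x, ?_, rfl⟩, ?_⟩
    · convert hx using 1
      ext1
      simp [sphereMap]
    · apply L.injective
      rw [← h]
      simp [sphereMap]

/-- The rotation about the axis `eᵢ` through the angle `t`. -/
def rotFlow (i : Fin 3) (t : ℝ) (x : E3) : E3 :=
  Real.cos t • x + Real.sin t • rot i x + ((1 - Real.cos t) * x i) • EuclideanSpace.single i 1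

lemma norm_rotFlow (i : Fin 3) (t : ℝ) (x : E3) : ‖rotFlow i t x‖ = ‖x‖ := by
  have h : ‖rotFlow i t x‖ ^ 2 = ‖x‖ ^ 2 := by
    rw [EuclideanSpace.real_norm_sq_eq, EuclideanSpace.real_norm_sq_eq]
    fin_cases i <;>
      simp [rotFlow, rot, Fin.sum_univ_three, crossProduct, PiLp.single_apply] <;>
      nlinarith [Real.sin_sq_add_cos_sq t, mul_nonneg (sq_nonneg (x 0)) (sq_nonneg (x 1))]
  exact (sq_eq_sq₀ (norm_nonneg _) (norm_nonneg _)).1 h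

/-- `rotFlow i t` as a linear isometry. -/
def rotIsom (i : Fin 3) (t : ℝ) : E3 ≃ₗᵢ[ℝ] E3 :=
  LinearIsometry.toLinearIsometryEquiv
    ⟨{ toFun := rotFlow i t
       map_add' := fun x y => by
        ext k
        by_cases h : k = i <;> simp [rotFlow, rot, h] <;> ring_nf
       map_smul' := fun c x => by
        ext k
        simp [rotFlow, rot]
        ring_nf }, norm_rotFlow i t⟩ rfl

@[simp] lemma rotIsom_apply (i : Fin 3) (t : ℝ) (x : E3) : rotIsom i t x = rotFlow i t x := rfl

lemma continuous_rot (i : Fin 3) : Continuous (rot i) := by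
  unfold rot
  have h : Continuous (crossProduct (Pi.single i 1 : Fin 3 → ℝ)) :=
    LinearMap.continuous_of_finiteDimensional _
  fun_prop

/-- The integral of the derivative of a function along a rotation field vanishes. -/
lemma integral_rot_eq_zero (i : Fin 3) (φ : E3 → ℝ) (hφ : ContDiff ℝ 1 φ) :
    ∫ x : S2, fderiv ℝ φ (x : E3) (rot i x) ∂area = 0 := by
  let F' : ℝ → S2 → ℝ := fun t x => fderiv ℝ φ (rotFlow i t x)
    (-Real.sin t • (x : E3) + Real.cos t • rot i x + (Real.sin t * (x : E3) i) •
      EuclideanSpace.single i 1)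
  have hcr := continuous_rot i
  have hcf : Continuous (fun p : ℝ × S2 => rotFlow i p.1 p.2) := by
    unfold rotFlow; fun_prop
  have hF'c : Continuous (fun p : ℝ × S2 => F' p.1 p.2) := by
    have := hφ.continuous_fderiv (by norm_num)
    exact (this.comp hcf).clm_apply (by fun_prop)
  obtain ⟨C, hC⟩ := (isCompact_Icc (a := (-1 : ℝ)) (b := 1)).prod (isCompact_univ (X := S2))
    |>.exists_bound_of_continuousOn hF'c.continuousOn
  have key := hasDerivAt_integral_of_dominated_loc_of_deriv_le (μ := area) (x₀ := (0 : ℝ))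
    (s := Set.Icc (-1) 1) (F := fun t x => φ (rotFlow i t x)) (F' := F') (bound := fun _ => C)
    (Icc_mem_nhds (by norm_num) (by norm_num))
    (Filter.Eventually.of_forall fun t => (hφ.continuous.comp
      (hcf.comp (by fun_prop : Continuous fun x : S2 => (t, x)))).aestronglyMeasurable)
    ((hφ.continuous.comp (hcf.comp (by fun_prop : Continuous fun x : S2 => ((0 : ℝ), x))))
      |>.integrable_of_hasCompactSupport (HasCompactSupport.of_compactSpace _))
    (hF'c.comp (by fun_prop : Continuous fun x : S2 => ((0 : ℝ), x))).aestronglyMeasurable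
    (Filter.Eventually.of_forall fun x t ht => hC (t, x) ⟨ht, trivial⟩)
    (integrable_const _)
    (Filter.Eventually.of_forall fun x t _ => by
      have h1 : HasDerivAt (fun t => rotFlow i t (x : E3))
          (-Real.sin t • (x : E3) + Real.cos t • rot i x + (Real.sin t * (x : E3) i) •
            EuclideanSpace.single i 1) t := by
        unfold rotFlow
        refine (((Real.hasDerivAt_cos t).smul_const _).add
          ((Real.hasDerivAt_sin t).smul_const _)).add ?_
        have := (((Real.hasDerivAt_cos t).const_sub 1).mul_const ((x : E3) i)).smul_const
          (EuclideanSpace.single i (1 : ℝ) : E3)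
        simpa using this
      exact ((hφ.differentiable (by norm_num)) _).hasFDerivAt.comp_hasDerivAt t h1)
  -- Rotations preserve the area, so this integral does not depend on `t`; its derivative at `0` is
  -- the integral in question.
  have hconst : (fun t => ∫ x : S2, φ (rotFlow i t x) ∂area) = fun _ => ∫ x : S2, φ x ∂area := by
    funext t
    exact (measurePreserving_sphereMap (rotIsom i t)).integral_comp' (f :=
      { toFun := sphereMap (rotIsom i t), invFun := sphereMap (rotIsom i t).symm,
        left_inv := fun x => by ext1; simp [sphereMap, -rotIsom_apply]
        right_inv := fun x => by ext1; simp [sphereMap, -rotIsom_apply]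
        measurable_toFun := (continuous_sphereMap _).measurable
        measurable_invFun := (continuous_sphereMap _).measurable }) (fun x : S2 => φ x)
  have h2 := key.2
  rw [hconst] at h2
  have h3 := h2.unique (hasDerivAt_const _ _)
  simpa [F', rotFlow] using h3

lemma integral_rot_mul (i : Fin 3) (φ ψ : E3 → ℝ) (hφ : ContDiff ℝ 1 φ) (hψ : ContDiff ℝ 1 ψ) :
    ∫ x : S2, φ x * fderiv ℝ ψ (x : E3) (rot i x) ∂area =
      - ∫ x : S2, fderiv ℝ φ (x : E3) (rot i x) * ψ x ∂area := by
  have h := integral_rot_eq_zero i (fun y => φ y * ψ y) (hφ.mul hψ)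
  have hcr := continuous_rot i
  have hφc := hφ.continuous
  have hψc := hψ.continuous
  have c1 := hφ.continuous_fderiv (by norm_num)
  have c2 := hψ.continuous_fderiv (by norm_num)
  have hc : ∀ f : S2 → ℝ, Continuous f → Integrable f area := fun f hf =>
    hf.integrable_of_hasCompactSupport (HasCompactSupport.of_compactSpace _)
  have e : ∀ x : S2, fderiv ℝ (fun y => φ y * ψ y) (x : E3) (rot i x) =
      φ x * fderiv ℝ ψ (x : E3) (rot i x) + fderiv ℝ φ (x : E3) (rot i x) * ψ x := by
    intro x
    rw [fderiv_fun_mul (hφ.differentiable (by norm_num) _) (hψ.differentiable (by norm_num) _)]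
    simp [mul_comm]
  simp_rw [e] at h
  rw [integral_add (hc _ (by fun_prop)) (hc _ (by fun_prop))] at h
  linarith

/-! ### The algebra of polynomial functions on the sphere -/

/-- The coordinate functions. -/
def coordC (k : Fin 3) : C(S2, ℝ) := ⟨fun x => (x : E3) k, by fun_prop⟩

/-- The restriction of polynomials to the sphere. -/
def polyEval : MvPolynomial (Fin 3) ℝ →ₐ[ℝ] C(S2, ℝ) := MvPolynomial.aeval coordC

/-- The algebra of polynomial functions on the sphere. -/
abbrev SPoly : Type := ↥polyEval.range

/-- The restriction of polynomials to the sphere, onto its image. -/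
def toSPoly : MvPolynomial (Fin 3) ℝ →ₐ[ℝ] SPoly := polyEval.rangeRestrict

lemma toSPoly_surjective : Function.Surjective toSPoly := polyEval.rangeRestrict_surjective

instance : CoeFun SPoly (fun _ => S2 → ℝ) := ⟨fun f => f.1⟩

lemma SPoly.ext_iff' {f g : SPoly} : f = g ↔ ∀ x, f x = g x := by
  rw [Subtype.ext_iff, ContinuousMap.ext_iff]

@[simp] lemma add_fun (f g : SPoly) (x : S2) : (f + g) x = f x + g x := rfl
@[simp] lemma sub_fun (f g : SPoly) (x : S2) : (f - g) x = f x - g x := rfl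
@[simp] lemma mul_fun (f g : SPoly) (x : S2) : (f * g) x = f x * g x := rfl
@[simp] lemma zero_fun (x : S2) : (0 : SPoly) x = 0 := rfl
@[simp] lemma one_fun (x : S2) : (1 : SPoly) x = 1 := rfl
@[simp] lemma smul_fun (c : ℝ) (f : SPoly) (x : S2) : (c • f) x = c * f x := rfl
@[simp] lemma algebraMap_fun (c : ℝ) (x : S2) : (algebraMap ℝ SPoly c) x = c := rfl

@[simp] lemma sum_fun {ι : Type*} (s : Finset ι) (f : ι → SPoly) (x : S2) :
    (∑ i ∈ s, f i) x = ∑ i ∈ s, f i x := by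
  classical
  induction s using Finset.induction_on with
  | empty => simp
  | insert a s ha ih => rw [Finset.sum_insert ha, Finset.sum_insert ha, add_fun, ih]

lemma SPoly.continuous (f : SPoly) : Continuous (fun x => f x) := f.1.continuous

/-- The coordinate functions. -/
def X (k : Fin 3) : SPoly := toSPoly (MvPolynomial.X k)

@[simp] lemma X_fun (k : Fin 3) (x : S2) : X k x = (x : E3) k := by
  change polyEval (MvPolynomial.X k) x = _
  simp [polyEval, coordC]

/-- The polynomial function on the whole space. -/
def polyFun (p : MvPolynomial (Fin 3) ℝ) (y : E3) : ℝ := MvPolynomial.eval y.ofLp p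

lemma toSPoly_fun (p : MvPolynomial (Fin 3) ℝ) (x : S2) : toSPoly p x = polyFun p x := by
  change polyEval p x = MvPolynomial.eval (x : E3).ofLp p
  induction p using MvPolynomial.induction_on with
  | C a => simp [polyEval]
  | add p q hp hq => simp [hp, hq]
  | mul_X p n hp => rw [map_mul, map_mul, ContinuousMap.mul_apply, hp]; simp [polyEval, coordC]

/-- Polynomial functions on the sphere satisfy the induction principle of polynomials. -/
lemma SPoly.induction {P : SPoly → Prop} (hC : ∀ c : ℝ, P (algebraMap ℝ SPoly c))
    (hadd : ∀ f g, P f → P g → P (f + g)) (hX : ∀ f k, P f → P (f * X k)) (f : SPoly) : P f := by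
  obtain ⟨p, rfl⟩ := toSPoly_surjective f
  induction p using MvPolynomial.induction_on with
  | C a => simpa [← MvPolynomial.algebraMap_eq] using! hC a
  | add p q hp hq => rw [map_add]; exact hadd _ _ hp hq
  | mul_X p n hp => rw [map_mul]; exact hX _ _ hp

/-- The rotation derivation on polynomials. -/
def rotDer (i : Fin 3) : Derivation ℝ (MvPolynomial (Fin 3) ℝ) (MvPolynomial (Fin 3) ℝ) :=
  MvPolynomial.mkDerivation ℝ (crossProduct (Pi.single i 1) MvPolynomial.X)

lemma contDiff_polyFun (p : MvPolynomial (Fin 3) ℝ) (n : ℕ∞ω) : ContDiff ℝ n (polyFun p) := by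
  induction p using MvPolynomial.induction_on with
  | C a =>
    have : polyFun (MvPolynomial.C a) = fun _ => a := by funext y; simp [polyFun]
    rw [this]
    exact contDiff_const
  | add p q hp hq =>
    have : polyFun (p + q) = fun y => polyFun p y + polyFun q y := by funext y; simp [polyFun]
    rw [this]
    exact hp.add hq
  | mul_X p k hp =>
    have : polyFun (p * MvPolynomial.X k) = fun y => polyFun p y * y k := by
      funext y; simp [polyFun]
    rw [this]
    exact hp.mul (by fun_prop)

/-- Both sides obey the Leibniz rule, so agreement on the coordinates suffices. -/
lemma fderiv_polyFun (i : Fin 3) (p : MvPolynomial (Fin 3) ℝ) (y : E3) :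
    fderiv ℝ (polyFun p) y (rot i y) = polyFun (rotDer i p) y := by
  have hd : ∀ p, DifferentiableAt ℝ (polyFun p) y := fun p =>
    (contDiff_polyFun p 1).differentiable (by norm_num) y
  induction p using MvPolynomial.induction_on with
  | C a =>
    have : polyFun (MvPolynomial.C a) = fun _ => a := by funext y; simp [polyFun]
    rw [this]
    simp [polyFun, rotDer]
  | add p q hp hq =>
    have : polyFun (p + q) = fun y => polyFun p y + polyFun q y := by funext y; simp [polyFun]
    rw [this, fderiv_fun_add (hd _) (hd _)]
    simp [hp, hq, polyFun]
  | mul_X p k hp =>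
    have : polyFun (p * MvPolynomial.X k) = fun y => polyFun p y * y k := by
      funext y; simp [polyFun]
    have hk : HasFDerivAt (fun y : E3 => y k) (EuclideanSpace.proj k : E3 →L[ℝ] ℝ) y :=
      (EuclideanSpace.proj k : E3 →L[ℝ] ℝ).hasFDerivAt
    rw [this, fderiv_fun_mul (hd _) hk.differentiableAt, hk.fderiv]
    simp only [_root_.add_apply, _root_.smul_apply, hp, smul_eq_mul,
      Derivation.leibniz, rotDer, MvPolynomial.mkDerivation_X]
    fin_cases i <;> fin_cases k <;> simp [polyFun, rot, crossProduct]

/-- The integral over the sphere. -/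
def sInt : SPoly →ₗ[ℝ] ℝ where
  toFun f := ∫ x, f x ∂area
  map_add' f g := integral_add (f.continuous.integrable_of_hasCompactSupport
    (HasCompactSupport.of_compactSpace _)) (g.continuous.integrable_of_hasCompactSupport
    (HasCompactSupport.of_compactSpace _))
  map_smul' _ _ := integral_const_mul _ _

lemma sInt_apply (f : SPoly) : sInt f = ∫ x, f x ∂area := rfl

lemma integrable_of_continuous {f : S2 → ℝ} (hf : Continuous f) : Integrable f area :=
  hf.integrable_of_hasCompactSupport (HasCompactSupport.of_compactSpace _)

lemma sInt_sq_nonneg (f : SPoly) : 0 ≤ sInt (f * f) :=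
  integral_nonneg fun _ => mul_self_nonneg _

lemma sInt_sq_eq_zero {f : SPoly} (h : sInt (f * f) = 0) : f = 0 := by
  rw [SPoly.ext_iff']
  intro x
  by_contra hx
  have h1 : 0 < ∫ y, f y * f y ∂area :=
    Continuous.integral_pos_of_hasCompactSupport_nonneg_nonzero (μ := area) (x := x)
    (f := fun x => f x * f x) (f.continuous.mul f.continuous)
    (HasCompactSupport.of_compactSpace _) (fun x => mul_self_nonneg _) (mul_self_ne_zero.2 hx)
  exact h1.ne' h

lemma sInt_rotDer (i : Fin 3) (p q : MvPolynomial (Fin 3) ℝ) :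
    sInt (toSPoly (rotDer i p) * toSPoly q) = -sInt (toSPoly p * toSPoly (rotDer i q)) := by
  have := integral_rot_mul i (polyFun p) (polyFun q) (contDiff_polyFun p 1) (contDiff_polyFun q 1)
  simp_rw [sInt_apply, mul_fun, toSPoly_fun, ← fderiv_polyFun]
  linarith

/-- By antisymmetry `∫ (rotDer p)² = -∫ p · rotDer (rotDer p)`, which vanishes if `p` does on the
sphere. Hence `rotDer` descends to functions on the sphere. -/
lemma toSPoly_rotDer_eq_zero (i : Fin 3) (p : MvPolynomial (Fin 3) ℝ) (hp : toSPoly p = 0) :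
    toSPoly (rotDer i p) = 0 := by
  apply sInt_sq_eq_zero
  rw [sInt_rotDer, hp, zero_mul, map_zero, neg_zero]

/-- The rotation derivations on polynomial functions on the sphere. -/
def Z (i : Fin 3) : Derivation ℝ SPoly SPoly :=
  Derivation.liftOfSurjective (f := toSPoly) toSPoly_surjective (d := rotDer i)
    (toSPoly_rotDer_eq_zero i)

lemma Z_toSPoly (i : Fin 3) (p : MvPolynomial (Fin 3) ℝ) :
    Z i (toSPoly p) = toSPoly (rotDer i p) :=
  Derivation.liftOfSurjective_apply toSPoly_surjective (toSPoly_rotDer_eq_zero i) p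

lemma Z_mul (i : Fin 3) (f g : SPoly) : Z i (f * g) = Z i f * g + f * Z i g := by
  rw [Derivation.leibniz]; simp only [smul_eq_mul]; ring

@[simp] lemma Z_algebraMap (i : Fin 3) (c : ℝ) : Z i (algebraMap ℝ SPoly c) = 0 :=
  Derivation.map_algebraMap _ _

lemma sInt_Z_mul (i : Fin 3) (f g : SPoly) : sInt (Z i f * g) = -sInt (f * Z i g) := by
  obtain ⟨p, rfl⟩ := toSPoly_surjective f
  obtain ⟨q, rfl⟩ := toSPoly_surjective g
  rw [Z_toSPoly, Z_toSPoly, sInt_rotDer]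

@[simp] lemma sInt_Z (i : Fin 3) (f : SPoly) : sInt (Z i f) = 0 := by
  have := sInt_Z_mul i f 1
  simpa using this

lemma Z_X (i k : Fin 3) : Z i (X k) = crossProduct (Pi.single i 1 : Fin 3 → SPoly) X k := by
  rw [X, Z_toSPoly, rotDer, MvPolynomial.mkDerivation_X]
  fin_cases i <;> fin_cases k <;> simp [crossProduct, X]

lemma sum_X_sq : ∑ k, X k * X k = 1 := by
  rw [SPoly.ext_iff']
  intro x
  have h : ‖(x : E3)‖ ^ 2 = 1 := by simp
  rw [EuclideanSpace.real_norm_sq_eq] at h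
  simpa [sq] using h

/-- The commutators of the rotation derivations. -/
lemma Z_comm (i j : Fin 3) (f : SPoly) :
    Z i (Z j f) = Z j (Z i f) - ∑ k, algebraMap ℝ SPoly
      (crossProduct (Pi.single i 1 : Fin 3 → ℝ) (Pi.single j 1) k) * Z k f := by
  induction f using SPoly.induction with
  | hC c => simp
  | hadd f g hf hg => simp only [map_add, hf, hg, mul_add, Finset.sum_add_distrib]; ring
  | hX f m hf =>
    simp only [Z_mul, map_add, hf]
    -- A commutator of derivations is a derivation, so the inductive step needs the identity only on
    -- `X m`.
    have : Z i (Z j (X m)) = Z j (Z i (X m)) - ∑ k, algebraMap ℝ SPoly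
      (crossProduct (Pi.single i 1 : Fin 3 → ℝ) (Pi.single j 1) k) * Z k (X m) := by
      simp only [Z_X]
      fin_cases i <;> fin_cases j <;> fin_cases m <;>
        simp [crossProduct, Z_X, Fin.sum_univ_three] <;> ring
    have e : ∀ c : Fin 3 → SPoly, ∑ k, c k * (Z k f * X m + f * Z k (X m)) =
        (∑ k, c k * Z k f) * X m + f * ∑ k, c k * Z k (X m) := fun c => by
      rw [Finset.sum_mul, Finset.mul_sum, ← Finset.sum_add_distrib]
      exact Finset.sum_congr rfl fun k _ => by ring
    rw [this, e]
    ring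

/-! ### The degree filtration -/

/-- The linear span of the coordinate functions. -/
def linForms : Submodule ℝ SPoly := Submodule.span ℝ (Set.range X)

/-- Polynomial functions of degree at most `n`. -/
def Pdeg (n : ℕ) : Submodule ℝ SPoly := (1 ⊔ linForms) ^ n

lemma Pdeg_zero : Pdeg 0 = 1 := pow_zero _

lemma Pdeg_succ (n : ℕ) : Pdeg (n + 1) = (1 ⊔ linForms) * Pdeg n := pow_succ' _ _

lemma Pdeg_mono : Monotone Pdeg := fun _ _ h => pow_le_pow_right' le_sup_left h

lemma X_mem (k : Fin 3) : X k ∈ linForms := Submodule.subset_span ⟨k, rfl⟩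

lemma algebraMap_mem_Pdeg (c : ℝ) (n : ℕ) : algebraMap ℝ SPoly c ∈ Pdeg n :=
  Pdeg_mono (Nat.zero_le n) (by rw [Pdeg_zero]; exact Submodule.mem_one.2 ⟨c, rfl⟩)

lemma mul_mem_Pdeg_succ {n : ℕ} {m f : SPoly} (hm : m ∈ 1 ⊔ linForms) (hf : f ∈ Pdeg n) :
    m * f ∈ Pdeg (n + 1) := by
  rw [Pdeg_succ]; exact Submodule.mul_mem_mul hm hf

lemma X_mul_mem {n : ℕ} (k : Fin 3) {f : SPoly} (hf : f ∈ Pdeg n) : X k * f ∈ Pdeg (n + 1) :=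
  mul_mem_Pdeg_succ (le_sup_right (a := (1 : Submodule ℝ SPoly)) (X_mem k)) hf

lemma exists_mem_Pdeg (f : SPoly) : ∃ n, f ∈ Pdeg n := by
  induction f using SPoly.induction with
  | hC c => exact ⟨0, algebraMap_mem_Pdeg c 0⟩
  | hadd f g hf hg =>
    obtain ⟨n, hn⟩ := hf
    obtain ⟨m, hm⟩ := hg
    exact ⟨max n m, add_mem (Pdeg_mono (le_max_left _ _) hn) (Pdeg_mono (le_max_right _ _) hm)⟩
  | hX f k hf =>
    obtain ⟨n, hn⟩ := hf
    exact ⟨n + 1, by rw [mul_comm]; exact X_mul_mem k hn⟩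

instance (n : ℕ) : FiniteDimensional ℝ (Pdeg n) := by
  apply Module.Finite.iff_fg.2
  apply Submodule.FG.pow
  refine Submodule.FG.sup ?_ (Submodule.fg_span (Set.finite_range X))
  rw [Submodule.one_eq_span]
  exact Submodule.fg_span (Set.finite_singleton 1)

lemma Z_linForms (i : Fin 3) {m : SPoly} (hm : m ∈ linForms) : Z i m ∈ linForms := by
  induction hm using Submodule.span_induction with
  | mem x hx =>
    obtain ⟨k, rfl⟩ := hx
    rw [Z_X]
    fin_cases i <;> fin_cases k <;>
      simp [crossProduct, X_mem]
  | zero => simp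
  | add x y _ _ hx hy => rw [map_add]; exact add_mem hx hy
  | smul c x _ hx => rw [Derivation.map_smul]; exact Submodule.smul_mem _ _ hx

lemma Z_mem_Pdeg (i : Fin 3) {n : ℕ} {f : SPoly} (hf : f ∈ Pdeg n) : Z i f ∈ Pdeg n := by
  refine Submodule.pow_induction_on_left' _ (C := fun n f _ => Z i f ∈ Pdeg n) ?_ ?_ ?_ hf
  · intro r; simp
  · intro x y n _ _ hx hy; rw [map_add]; exact add_mem hx hy
  · intro m hm n x hx h
    rw [Z_mul]
    refine add_mem (mul_mem_Pdeg_succ ?_ hx) (mul_mem_Pdeg_succ hm h)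
    obtain ⟨y, hy, z, hz, rfl⟩ := Submodule.mem_sup.1 hm
    obtain ⟨c, rfl⟩ := Submodule.mem_one.1 hy
    rw [map_add, Z_algebraMap, zero_add]
    exact le_sup_right (a := (1 : Submodule ℝ SPoly)) (Z_linForms i hz)

/-- The components of the rotation fields. -/
def rotX (i : Fin 3) : Fin 3 → SPoly := crossProduct (Pi.single i 1 : Fin 3 → SPoly) X

/-- The derivations along the tangential parts of the coordinate directions. -/
def D (k : Fin 3) : Derivation ℝ SPoly SPoly :=
  rotX 0 k • Z 0 + rotX 1 k • Z 1 + rotX 2 k • Z 2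

lemma D_apply (k : Fin 3) (f : SPoly) : D k f = ∑ i, rotX i k * Z i f := by
  simp [D, Fin.sum_univ_three]

lemma D_mul (i : Fin 3) (f g : SPoly) : D i (f * g) = D i f * g + f * D i g := by
  rw [Derivation.leibniz]; simp only [smul_eq_mul]; ring

lemma sum_X_sq' : X 0 * X 0 + X 1 * X 1 + X 2 * X 2 = 1 := by
  rw [← sum_X_sq, Fin.sum_univ_three]

lemma D_X (j k : Fin 3) : D j (X k) = (if j = k then 1 else 0) - X j * X k := by
  have h := sum_X_sq'
  rw [D_apply, Fin.sum_univ_three]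
  simp only [Z_X, rotX]
  fin_cases j <;> fin_cases k <;> simp [crossProduct] <;> first | ring1 | linear_combination h

/-- The Laplacian. -/
def Lap : SPoly →ₗ[ℝ] SPoly := ∑ i, (Z i : SPoly →ₗ[ℝ] SPoly) ∘ₗ (Z i : SPoly →ₗ[ℝ] SPoly)

lemma Lap_apply (f : SPoly) : Lap f = ∑ i, Z i (Z i f) := by simp [Lap]

@[simp] lemma Lap_algebraMap (c : ℝ) : Lap (algebraMap ℝ SPoly c) = 0 := by simp [Lap_apply]

lemma Lap_mem_Pdeg {n : ℕ} {f : SPoly} (hf : f ∈ Pdeg n) : Lap f ∈ Pdeg n := by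
  rw [Lap_apply]
  exact Submodule.sum_mem _ fun i _ => Z_mem_Pdeg i (Z_mem_Pdeg i hf)

lemma Lap_X (k : Fin 3) : Lap (X k) = -2 * X k := by
  rw [Lap_apply, Fin.sum_univ_three]
  simp only [Z_X]
  fin_cases k <;> simp [crossProduct, Z_X] <;> ring

/-- The cross term of the product rule is `2 ∑ Z_i x_k · Z_i f`, and `Z_i x_k` is the `k`-th
component of the `i`-th rotation field. -/
lemma Lap_X_mul (k : Fin 3) (f : SPoly) :
    Lap (X k * f) = -2 * X k * f + 2 * D k f + X k * Lap f := by
  have h := Lap_X k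
  rw [Lap_apply, Fin.sum_univ_three] at h ⊢
  rw [D_apply, Lap_apply, Fin.sum_univ_three, Fin.sum_univ_three]
  simp only [Z_mul, map_add, rotX]
  have e : ∀ i, crossProduct (Pi.single i 1 : Fin 3 → SPoly) X k = Z i (X k) :=
    fun i => (Z_X i k).symm
  simp only [e]
  linear_combination f * h

lemma linForms_pow_le (n : ℕ) : linForms ^ n ≤ Pdeg n := pow_le_pow_left' le_sup_right n

/-- `D j` is `∂_j` minus `x_j` times the radial derivative; the latter multiplies a form of degree
`n` by `n`, the former lowers the degree. For `n = 0` the truncated `n - 1` is again `0`, so exact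
vanishing is carried along for the step from `0` to `1`. -/
lemma D_homogeneous (j : Fin 3) {n : ℕ} {f : SPoly} (hf : f ∈ linForms ^ n) :
    (n = 0 → D j f = 0) ∧ D j f + (n : ℝ) • (X j * f) ∈ Pdeg (n - 1) := by
  refine Submodule.pow_induction_on_left' _ (C := fun n f _ =>
    (n = 0 → D j f = 0) ∧ D j f + (n : ℝ) • (X j * f) ∈ Pdeg (n - 1)) ?_ ?_ ?_ hf
  · intro r; simp [Derivation.map_algebraMap]
  · intro x y n _ _ hx hy
    refine ⟨fun hn => by rw [map_add, hx.1 hn, hy.1 hn, add_zero], ?_⟩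
    have := add_mem hx.2 hy.2
    convert this using 1
    rw [map_add, mul_add, smul_add]; ring
  · intro m hm n x hx h
    refine ⟨fun hn => absurd hn (Nat.succ_ne_zero n), ?_⟩
    have hxP : x ∈ Pdeg n := linForms_pow_le n hx
    change D j (m * x) + ((n + 1 : ℕ) : ℝ) • (X j * (m * x)) ∈ Pdeg n
    induction hm using Submodule.span_induction with
    | mem m hm =>
      obtain ⟨k, rfl⟩ := hm
      have e : D j (X k * x) + ((n + 1 : ℕ) : ℝ) • (X j * (X k * x)) =
          X k * (D j x + (n : ℝ) • (X j * x)) + (if j = k then 1 else 0) * x := by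
        rw [D_mul, D_X]
        simp only [Algebra.smul_def, Nat.cast_succ, map_add, map_one]
        ring
      rw [e]
      refine add_mem ?_ ?_
      · rcases Nat.eq_zero_or_pos n with rfl | hn
        · rw [h.1 rfl]; simp
        · have := X_mul_mem k h.2
          rwa [Nat.sub_add_cancel hn] at this
      · split_ifs
        · simpa using hxP
        · simp
    | zero => simp
    | add a b _ _ ha hb =>
      convert add_mem ha hb using 1
      rw [add_mul, map_add, mul_add, smul_add]; ring
    | smul c a _ ha =>
      convert Submodule.smul_mem _ c ha using 1
      rw [smul_mul_assoc, Derivation.map_smul, smul_add, mul_smul_comm, smul_comm]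

/-- Multiplication by a coordinate turns `n (n + 1)` into `n (n + 1) + 2 + 2 n = (n + 1)(n + 2)`, up
to lower degree. The spectrum is obtained this way without constructing spherical harmonics. -/
lemma Lap_homogeneous {n : ℕ} {f : SPoly} (hf : f ∈ linForms ^ n) :
    (n = 0 → Lap f = 0) ∧ Lap f + ((n : ℝ) * (n + 1)) • f ∈ Pdeg (n - 1) := by
  refine Submodule.pow_induction_on_left' _ (C := fun n f _ =>
    (n = 0 → Lap f = 0) ∧ Lap f + ((n : ℝ) * (n + 1)) • f ∈ Pdeg (n - 1)) ?_ ?_ ?_ hf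
  · intro r; simp
  · intro x y n _ _ hx hy
    refine ⟨fun hn => by rw [map_add, hx.1 hn, hy.1 hn, add_zero], ?_⟩
    have := add_mem hx.2 hy.2
    convert this using 1
    rw [map_add, smul_add]; ring
  · intro m hm n x hx h
    refine ⟨fun hn => absurd hn (Nat.succ_ne_zero n), ?_⟩
    change Lap (m * x) + ((((n + 1 : ℕ) : ℝ)) * (((n + 1 : ℕ) : ℝ) + 1)) • (m * x) ∈ Pdeg n
    induction hm using Submodule.span_induction with
    | mem m hm =>
      obtain ⟨k, rfl⟩ := hm
      have hD := D_homogeneous k hx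
      have e : Lap (X k * x) + ((((n + 1 : ℕ) : ℝ)) * (((n + 1 : ℕ) : ℝ) + 1)) • (X k * x) =
          X k * (Lap x + ((n : ℝ) * (n + 1)) • x) + (2 : ℝ) • (D k x + (n : ℝ) • (X k * x)) := by
        rw [Lap_X_mul]
        simp only [Algebra.smul_def, Nat.cast_succ, map_add, map_one, map_mul, map_ofNat]
        ring
      rw [e]
      refine add_mem ?_ (Submodule.smul_mem _ _ (Pdeg_mono (Nat.sub_le _ _) hD.2))
      rcases Nat.eq_zero_or_pos n with rfl | hn
      · rw [h.1 rfl]; simp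
      · have := X_mul_mem k h.2
        rwa [Nat.sub_add_cancel hn] at this
    | zero => simp
    | add a b _ _ ha hb =>
      convert add_mem ha hb using 1
      rw [add_mul, map_add, smul_add]; ring
    | smul c a _ ha =>
      convert Submodule.smul_mem _ c ha using 1
      rw [smul_mul_assoc, map_smul, smul_add, smul_comm c]

lemma exists_homogeneous_sub_mem {n : ℕ} {f : SPoly} (hf : f ∈ Pdeg (n + 1)) :
    ∃ g ∈ linForms ^ (n + 1), f - g ∈ Pdeg n := by
  induction n generalizing f with
  | zero =>
    rw [zero_add, Pdeg, pow_one] at hf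
    obtain ⟨y, hy, z, hz, rfl⟩ := Submodule.mem_sup.1 hf
    exact ⟨z, by simpa using hz, by simpa [Pdeg_zero] using hy⟩
  | succ n ih =>
    rw [Pdeg_succ] at hf
    induction hf using Submodule.mul_induction_on' with
    | mem_mul_mem m hm x hx =>
      obtain ⟨y, hy, z, hz, rfl⟩ := Submodule.mem_sup.1 hm
      obtain ⟨g, hg, hxg⟩ := ih hx
      refine ⟨z * g, by rw [pow_succ']; exact Submodule.mul_mem_mul hz hg, ?_⟩
      have e : (y + z) * x - z * g = y * x + z * (x - g) := by ring
      rw [e]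
      obtain ⟨c, rfl⟩ := Submodule.mem_one.1 hy
      refine add_mem ?_ (mul_mem_Pdeg_succ (le_sup_right (a := (1 : Submodule ℝ SPoly)) hz) hxg)
      rw [← Algebra.smul_def]
      exact Submodule.smul_mem _ _ hx
    | add a _ b _ ha hb =>
      obtain ⟨g, hg, hg'⟩ := ha
      obtain ⟨g', hg2, hg2'⟩ := hb
      refine ⟨g + g', add_mem hg hg2, ?_⟩
      convert add_mem hg' hg2' using 1
      ring

/-- Only the homogeneous top part matters modulo lower degree. Consequently the Laplacian is the
scalar `-(n + 1)(n + 2)` on the part of `Pdeg (n + 1)` orthogonal to `Pdeg n`. -/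
lemma Lap_add_smul_mem {n : ℕ} {f : SPoly} (hf : f ∈ Pdeg (n + 1)) :
    Lap f + (((n : ℝ) + 1) * (n + 2)) • f ∈ Pdeg n := by
  obtain ⟨g, hg, hfg⟩ := exists_homogeneous_sub_mem hf
  have h1 := (Lap_homogeneous hg).2
  rw [Nat.add_sub_cancel] at h1
  have h2 := add_mem (Lap_mem_Pdeg hfg) (Submodule.smul_mem _ (((n : ℝ) + 1) * (n + 2)) hfg)
  convert add_mem h1 h2 using 1
  rw [map_sub, smul_sub]
  push_cast
  rw [show (n : ℝ) + 1 + 1 = n + 2 by ring]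
  abel

/-! ### The `L²` structure and orthogonal projections -/

/-- The Hilbert space of square integrable functions on the sphere. -/
abbrev L2 : Type := Lp ℝ 2 area

/-- The class of a polynomial function in `L²`. -/
def toL2 : SPoly →ₗ[ℝ] L2 := (ContinuousMap.toLp 2 area ℝ).toLinearMap ∘ₗ polyEval.range.val.toLinearMap

lemma inner_toL2 (f g : SPoly) : inner ℝ (toL2 f) (toL2 g) = sInt (f * g) := by
  rw [mul_comm]
  exact MeasureTheory.ContinuousMap.inner_toLp area f.1 g.1

lemma norm_toL2_sq (f : SPoly) : ‖toL2 f‖ ^ 2 = sInt (f * f) := by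
  rw [← inner_toL2, real_inner_self_eq_norm_sq]

lemma toL2_injective : Function.Injective toL2 :=
  (ContinuousMap.toLp_injective (p := 2) (𝕜 := ℝ) area).comp Subtype.val_injective

/-- The image of the polynomials of degree at most `N` in `L²`. -/
def Kdeg (N : ℕ) : Submodule ℝ L2 := (Pdeg N).map toL2

instance (N : ℕ) : FiniteDimensional ℝ (Kdeg N) := inferInstanceAs
  (FiniteDimensional ℝ ((Pdeg N).map toL2))

/-- Polynomials of degree at most `N`, as a subspace of `L²`. -/
def equivKdeg (N : ℕ) : Pdeg N ≃ₗ[ℝ] Kdeg N := Submodule.equivMapOfInjective toL2 toL2_injective _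

lemma toL2_equivKdeg_symm (N : ℕ) (y : Kdeg N) : toL2 ((equivKdeg N).symm y : SPoly) = y := by
  conv_rhs => rw [← (equivKdeg N).apply_symm_apply y]
  rfl

/-- The orthogonal projection of `L²` to the polynomials of degree at most `N`. -/
def proj (N : ℕ) : L2 →ₗ[ℝ] SPoly :=
  (Pdeg N).subtype ∘ₗ (equivKdeg N).symm.toLinearMap ∘ₗ
    (Kdeg N).orthogonalProjectionOnto.toLinearMap

lemma proj_mem (N : ℕ) (F : L2) : proj N F ∈ Pdeg N := Subtype.property _

lemma toL2_proj (N : ℕ) (F : L2) : toL2 (proj N F) = (Kdeg N).starProjection F :=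
  toL2_equivKdeg_symm _ _

lemma inner_proj (N : ℕ) (F : L2) {q : SPoly} (hq : q ∈ Pdeg N) :
    sInt (proj N F * q) = inner ℝ F (toL2 q) := by
  rw [← inner_toL2, toL2_proj]
  have := Submodule.starProjection_inner_eq_zero (K := Kdeg N) F (toL2 q) ⟨q, hq, rfl⟩
  rw [inner_sub_left] at this
  linarith

lemma eq_of_sInt_mul_eq {N : ℕ} {p q : SPoly} (hp : p ∈ Pdeg N) (hq : q ∈ Pdeg N)
    (h : ∀ r ∈ Pdeg N, sInt (p * r) = sInt (q * r)) : p = q := by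
  rw [← sub_eq_zero]
  apply sInt_sq_eq_zero
  rw [sub_mul, map_sub, h _ (sub_mem hp hq), sub_self]

lemma proj_of_mem {N : ℕ} {p : SPoly} (hp : p ∈ Pdeg N) : proj N (toL2 p) = p :=
  eq_of_sInt_mul_eq (proj_mem N _) hp fun r hr => by rw [inner_proj N _ hr, inner_toL2]

lemma proj_proj {N M : ℕ} (h : N ≤ M) (F : L2) : proj N (toL2 (proj M F)) = proj N F :=
  eq_of_sInt_mul_eq (proj_mem N _) (proj_mem N _) fun r hr => by
    rw [inner_proj N _ hr, inner_proj N _ hr, inner_toL2, inner_proj M _ (Pdeg_mono h hr)]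

/-- `Z i` is antisymmetric and maps `Pdeg N` to itself, hence commutes with the orthogonal
projection, even for functions with only a weak derivative. -/
lemma proj_weakDeriv (i : Fin 3) (N : ℕ) (F G : L2)
    (h : ∀ q : SPoly, inner ℝ F (toL2 (Z i q)) = -inner ℝ G (toL2 q)) :
    proj N G = Z i (proj N F) :=
  eq_of_sInt_mul_eq (proj_mem N _) (Z_mem_Pdeg i (proj_mem N _)) fun r hr => by
    rw [inner_proj N _ hr, sInt_Z_mul, inner_proj N _ (Z_mem_Pdeg i hr), h, neg_neg]

lemma proj_Z (i : Fin 3) (N : ℕ) (f : SPoly) : proj N (toL2 (Z i f)) = Z i (proj N (toL2 f)) :=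
  proj_weakDeriv i N _ _ fun q => by
    rw [inner_toL2, inner_toL2, sInt_Z_mul, neg_neg]

lemma proj_Lap (N : ℕ) (f : SPoly) : proj N (toL2 (Lap f)) = Lap (proj N (toL2 f)) := by
  simp only [Lap_apply, map_sum, proj_Z]

lemma norm_proj_le (N : ℕ) (F : L2) : ‖toL2 (proj N F)‖ ≤ ‖F‖ := by
  rw [toL2_proj]; exact Submodule.norm_starProjection_apply_le _ _

lemma norm_sub_proj_le (N : ℕ) (F : L2) : ‖F - toL2 (proj N F)‖ ≤ ‖F‖ := by
  have h1 : inner ℝ (F - toL2 (proj N F)) (toL2 (proj N F)) = 0 := by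
    rw [inner_sub_left, inner_toL2, inner_proj N _ (proj_mem N _), sub_self]
  have h2 := norm_add_sq_real (F - toL2 (proj N F)) (toL2 (proj N F))
  rw [h1, sub_add_cancel] at h2
  refine le_of_sq_le_sq ?_ (norm_nonneg _)
  nlinarith [sq_nonneg ‖toL2 (proj N F)‖]

/-- The quadratic form of the Laplacian. -/
lemma sInt_Lap_mul (f g : SPoly) : sInt (Lap f * g) = -∑ i, sInt (Z i f * Z i g) := by
  rw [Lap_apply, Finset.sum_mul, map_sum, ← Finset.sum_neg_distrib]
  exact Finset.sum_congr rfl fun i _ => sInt_Z_mul i _ _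

lemma sInt_Lap_comm (f g : SPoly) : sInt (Lap f * g) = sInt (f * Lap g) := by
  rw [sInt_Lap_mul, mul_comm f, sInt_Lap_mul]
  simp only [mul_comm]

/-- The Poincaré inequality on the orthogonal complement of the polynomials of degree `N`. -/
lemma poincare {N : ℕ} {u : SPoly} (hu : ∀ q ∈ Pdeg N, sInt (u * q) = 0) :
    ((N : ℝ) + 1) * (N + 2) * sInt (u * u) ≤ ∑ i, sInt (Z i u * Z i u) := by
  obtain ⟨m, hm⟩ := exists_mem_Pdeg u
  -- Induction on the number of degrees above `N`, removing one layer at a time.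
  have h' : ∀ k : ℕ, ∀ u ∈ Pdeg (N + k), (∀ q ∈ Pdeg N, sInt (u * q) = 0) →
      ((N : ℝ) + 1) * (N + 2) * sInt (u * u) ≤ -sInt (Lap u * u) := by
    intro k
    induction k with
    | zero =>
      intro u hm hu
      have : u = 0 := sInt_sq_eq_zero (hu u hm)
      simp [this]
    | succ k ih =>
      intro u hm hu
      -- `u - v` is the top layer, where the quadratic form is `(N + k + 1)(N + k + 2)` times the
      -- square norm; the mixed terms with `v` vanish by orthogonality.
      obtain ⟨v, hv⟩ : ∃ v, v = proj (N + k) (toL2 u) := ⟨_, rfl⟩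
      have hvm : v ∈ Pdeg (N + k) := hv ▸ proj_mem _ _
      have he : ∀ q ∈ Pdeg (N + k), sInt ((u - v) * q) = 0 := fun q hq => by
        rw [sub_mul, map_sub, hv, inner_proj _ _ hq, inner_toL2, sub_self]
      have hem : u - v ∈ Pdeg (N + k + 1) := sub_mem hm (Pdeg_mono (Nat.le_succ _) hvm)
      have hvN : ∀ q ∈ Pdeg N, sInt (v * q) = 0 := fun q hq => by
        have := he q (Pdeg_mono (Nat.le_add_right _ _) hq)
        rw [sub_mul, map_sub, hu q hq] at this
        linarith
      have i1 := ih v hvm hvN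
      have hr := he _ (Lap_add_smul_mem hem)
      have hc := he _ (Lap_mem_Pdeg hvm)
      have hd := he _ hvm
      have e : u = v + (u - v) := by ring
      clear hv
      obtain ⟨e', he'⟩ : ∃ e', e' = u - v := ⟨_, rfl⟩
      rw [← he'] at he hem hr hc hd e
      clear he'
      subst e
      have h1 : sInt (e' * Lap e') = -(((N + k : ℕ) + 1 : ℝ) * ((N + k : ℕ) + 2)) * sInt (e' * e') := by
        rw [mul_add, map_add, mul_smul_comm, map_smul, smul_eq_mul] at hr
        linarith
      have h2 : sInt (Lap (v + e') * (v + e')) = sInt (Lap v * v) + sInt (e' * Lap e') := by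
        rw [map_add, show (Lap v + Lap e') * (v + e') = Lap v * v + Lap e' * v + e' * Lap v +
          e' * Lap e' by ring, map_add, map_add, map_add, sInt_Lap_comm e' v, hc]
        ring
      have h3 : sInt ((v + e') * (v + e')) = sInt (v * v) + sInt (e' * e') := by
        rw [show (v + e') * (v + e') = v * v + e' * v + e' * v + e' * e' by ring, map_add, map_add,
          map_add, hd]
        ring
      rw [h2, h3, h1]
      have hpos := sInt_sq_nonneg e'
      have : ((N : ℝ) + 1) * (N + 2) ≤ ((N + k : ℕ) + 1 : ℝ) * ((N + k : ℕ) + 2) := by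
        push_cast
        gcongr <;> linarith [(Nat.cast_nonneg k : (0 : ℝ) ≤ k)]
      nlinarith
  have := h' m u (Pdeg_mono (Nat.le_add_left _ _) hm) hu
  rwa [sInt_Lap_mul, neg_neg] at this

/-! ### Mean values -/

/-- The total area. -/
def totalArea : ℝ := area.real Set.univ

lemma totalArea_pos : 0 < totalArea := measureReal_univ_pos

@[simp] lemma sInt_algebraMap (c : ℝ) : sInt (algebraMap ℝ SPoly c) = c * totalArea := by
  simp [sInt_apply, totalArea, mul_comm]

/-- The mean value. -/
def mean (f : SPoly) : ℝ := sInt f / totalArea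

lemma sInt_sub_mean (f : SPoly) : sInt (f - algebraMap ℝ SPoly (mean f)) = 0 := by
  rw [map_sub, sInt_algebraMap, mean, div_mul_cancel₀ _ totalArea_pos.ne', sub_self]

lemma orthogonal_Pdeg_zero {u : SPoly} (h : sInt u = 0) : ∀ q ∈ Pdeg 0, sInt (u * q) = 0 := by
  intro q hq
  rw [Pdeg_zero] at hq
  obtain ⟨c, rfl⟩ := Submodule.mem_one.1 hq
  rw [mul_comm, ← Algebra.smul_def, map_smul, h, smul_zero]

lemma poincare_zero {u : SPoly} (h : sInt u = 0) :
    2 * sInt (u * u) ≤ ∑ i, sInt (Z i u * Z i u) := by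
  have := poincare (orthogonal_Pdeg_zero h)
  simpa using this

/-- The Poincaré inequality forces the mean-free part to have norm zero. -/
lemma eq_const_of_Z_eq_zero {f : SPoly} (h : ∀ i, Z i f = 0) :
    f = algebraMap ℝ SPoly (mean f) := by
  rw [← sub_eq_zero]
  apply sInt_sq_eq_zero
  have := poincare_zero (sInt_sub_mean f)
  simp only [map_sub, Z_algebraMap, h, sub_zero, mul_zero, map_zero, Finset.sum_const_zero] at this
  have h2 := sInt_sq_nonneg (f - algebraMap ℝ SPoly (mean f))
  linarith

/-! ### The sup norm of polynomials -/

lemma exists_orthonormal (n : ℕ) : ∃ v : Fin (Module.finrank ℝ (Pdeg n)) → SPoly,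
    (∀ a, v a ∈ Pdeg n) ∧ (∀ a b, sInt (v a * v b) = if a = b then 1 else 0) ∧
      ∀ f ∈ Pdeg n, f = ∑ a, sInt (v a * f) • v a := by
  rw [(equivKdeg n).finrank_eq]
  let b := stdOrthonormalBasis ℝ (Kdeg n)
  have hv : ∀ a, toL2 ((equivKdeg n).symm (b a) : SPoly) = b a := fun a => toL2_equivKdeg_symm _ _
  refine ⟨fun a => (equivKdeg n).symm (b a), fun a => Subtype.property _, fun a c => ?_,
    fun f hf => ?_⟩
  · rw [← inner_toL2, hv, hv, ← Submodule.coe_inner]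
    exact orthonormal_iff_ite.1 b.orthonormal a c
  · apply toL2_injective
    have := b.sum_repr' (equivKdeg n ⟨f, hf⟩)
    have h2 := congrArg (Subtype.val) this
    rw [map_sum]
    simp only [map_smul, ← inner_toL2, hv]
    rw [Submodule.coe_sum] at h2
    exact h2.symm

/-- The span of the monomials of degree at most `n` in each variable. -/
def monSpan (n : ℕ) : Submodule ℝ SPoly :=
  Submodule.span ℝ (Set.range fun a : Fin (n + 1) × Fin (n + 1) × Fin (n + 1) =>
    X 0 ^ (a.1 : ℕ) * X 1 ^ (a.2.1 : ℕ) * X 2 ^ (a.2.2 : ℕ))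

lemma mem_monSpan {n a b c : ℕ} (ha : a ≤ n) (hb : b ≤ n) (hc : c ≤ n) :
    X 0 ^ a * X 1 ^ b * X 2 ^ c ∈ monSpan n :=
  Submodule.subset_span ⟨(⟨a, by lia⟩, ⟨b, by lia⟩, ⟨c, by lia⟩), rfl⟩

lemma monSpan_succ {n : ℕ} {f : SPoly} (hf : f ∈ monSpan n) :
    f ∈ monSpan (n + 1) ∧ ∀ k, X k * f ∈ monSpan (n + 1) := by
  induction hf using Submodule.span_induction with
  | mem x hx =>
    obtain ⟨⟨⟨a, ha⟩, ⟨b, hb⟩, ⟨c, hc⟩⟩, rfl⟩ := hx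
    refine ⟨mem_monSpan (by lia) (by lia) (by lia), fun k => ?_⟩
    fin_cases k
    · convert mem_monSpan (n := n + 1) (a := a + 1) (b := b) (c := c) (by lia) (by lia) (by lia)
        using 1
      simp only [Fin.zero_eta]; ring
    · convert mem_monSpan (n := n + 1) (a := a) (b := b + 1) (c := c) (by lia) (by lia) (by lia)
        using 1
      simp only [Fin.mk_one]; ring
    · convert mem_monSpan (n := n + 1) (a := a) (b := b) (c := c + 1) (by lia) (by lia) (by lia)
        using 1
      simp only [Fin.reduceFinMk]; ring
  | zero => simp
  | add x y _ _ hx hy =>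
    exact ⟨add_mem hx.1 hy.1, fun k => by rw [mul_add]; exact add_mem (hx.2 k) (hy.2 k)⟩
  | smul c x _ hx =>
    exact ⟨Submodule.smul_mem _ _ hx.1, fun k => by
      rw [mul_smul_comm]; exact Submodule.smul_mem _ _ (hx.2 k)⟩

lemma Pdeg_le_monSpan (n : ℕ) : Pdeg n ≤ monSpan n := by
  induction n with
  | zero =>
    rw [Pdeg_zero]
    intro x hx
    obtain ⟨c, rfl⟩ := Submodule.mem_one.1 hx
    rw [Algebra.algebraMap_eq_smul_one]
    apply Submodule.smul_mem
    simpa using mem_monSpan (n := 0) (a := 0) (b := 0) (c := 0) le_rfl le_rfl le_rfl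
  | succ n ih =>
    rw [Pdeg_succ, Submodule.mul_le]
    intro m hm x hx
    have h := monSpan_succ (ih hx)
    obtain ⟨y, hy, z, hz, rfl⟩ := Submodule.mem_sup.1 hm
    obtain ⟨c, rfl⟩ := Submodule.mem_one.1 hy
    rw [add_mul, ← Algebra.smul_def]
    refine add_mem (Submodule.smul_mem _ _ h.1) ?_
    clear hm
    induction hz using Submodule.span_induction with
    | mem z hz => obtain ⟨k, rfl⟩ := hz; exact h.2 k
    | zero => simp
    | add a b _ _ ha hb =>
      rw [add_mul]
      exact add_mem ha hb
    | smul c a _ ha => rw [smul_mul_assoc]; exact Submodule.smul_mem _ _ ha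

/-- The true dimension is `(n + 1)²`, but any polynomial bound serves the Sobolev embedding, and
counting monomials gives the cube. -/
lemma finrank_Pdeg_le (n : ℕ) : Module.finrank ℝ (Pdeg n) ≤ (n + 1) ^ 3 := by
  have : FiniteDimensional ℝ (monSpan n) :=
    FiniteDimensional.span_of_finite ℝ (Set.finite_range _)
  refine (Submodule.finrank_mono (Pdeg_le_monSpan n)).trans ?_
  refine (finrank_range_le_card (R := ℝ) _).trans ?_
  simp [pow_succ, mul_assoc]

/-- The sum `∑ v_a²` over an orthonormal basis is rotation invariant, hence constant, hence the
dimension divided by the area. Cauchy–Schwarz in the expansion of `f x` does the rest. -/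
lemma sq_le_of_mem_Pdeg {n : ℕ} {f : SPoly} (hf : f ∈ Pdeg n) (x : S2) :
    (f x) ^ 2 ≤ ((n : ℝ) + 1) ^ 3 / totalArea * sInt (f * f) := by
  obtain ⟨v, hvm, hon, hexp⟩ := exists_orthonormal n
  set K : SPoly := ∑ a, v a * v a with hK
  have hZ : ∀ i, Z i K = 0 := by
    intro i
    have h1 : Z i K = (2 : ℝ) • ∑ a, ∑ b, sInt (v b * Z i (v a)) • (v b * v a) := by
      rw [hK, map_sum, Finset.smul_sum]
      refine Finset.sum_congr rfl fun a _ => ?_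
      have := hexp _ (Z_mem_Pdeg i (hvm a))
      rw [Z_mul, mul_comm (v a), ← two_smul ℝ (Z i (v a) * v a)]
      conv_lhs => rw [this, Finset.sum_mul]
      simp only [smul_mul_assoc]
    -- The coefficients are antisymmetric in `a, b` and the products `v b * v a` symmetric, so the
    -- double sum equals its negative.
    have h2 : ∑ a, ∑ b, sInt (v b * Z i (v a)) • (v b * v a) =
        -∑ a, ∑ b, sInt (v b * Z i (v a)) • (v b * v a) := by
      conv_lhs => rw [Finset.sum_comm]
      rw [← Finset.sum_neg_distrib]
      refine Finset.sum_congr rfl fun a _ => ?_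
      rw [← Finset.sum_neg_distrib]
      refine Finset.sum_congr rfl fun b _ => ?_
      rw [← neg_smul, mul_comm (v a) (v b), mul_comm (v b) (Z i (v a)), sInt_Z_mul, neg_neg]
    rw [h1, two_smul]
    nth_rewrite 1 [h2]
    exact neg_add_cancel _
  have hKc := eq_const_of_Z_eq_zero hZ
  have hm : mean K = (Module.finrank ℝ (Pdeg n) : ℝ) / totalArea := by
    rw [mean, hK, map_sum]
    simp [hon]
  have hKx : ∑ a, v a x ^ 2 = (Module.finrank ℝ (Pdeg n) : ℝ) / totalArea := by
    have : K x = mean K := by rw [hKc]; simp [mean, totalArea_pos.ne']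
    rw [← hm, ← this, hK]
    simp [sq]
  have hfx : f x = ∑ a, sInt (v a * f) * v a x := by
    conv_lhs => rw [hexp f hf]
    simp
  have hff : sInt (f * f) = ∑ a, sInt (v a * f) ^ 2 := by
    conv_lhs => rw [show f * f = (∑ a, sInt (v a * f) • v a) * f by rw [← hexp f hf]]
    rw [Finset.sum_mul, map_sum]
    refine Finset.sum_congr rfl fun a _ => ?_
    rw [smul_mul_assoc, map_smul, smul_eq_mul, sq]
  rw [hfx, hff]
  refine (Finset.sum_mul_sq_le_sq_mul_sq _ _ _).trans ?_
  rw [hKx, mul_comm]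
  have hd : (Module.finrank ℝ (Pdeg n) : ℝ) ≤ ((n : ℝ) + 1) ^ 3 := by
    exact_mod_cast finrank_Pdeg_le n
  have := totalArea_pos
  gcongr

lemma summable_inv_succ_sq : Summable fun l : ℕ => 1 / ((l : ℝ) + 1) ^ 2 := by
  have := (summable_nat_add_iff 1).2 (Real.summable_one_div_nat_pow.2 (one_lt_two))
  simpa using this

/-- The Sobolev embedding for polynomials. -/
lemma exists_abs_le : ∃ C : ℝ, 0 < C ∧ ∀ (f : SPoly) (x : S2),
    |f x| ≤ C * (‖toL2 f‖ + ‖toL2 (Lap (Lap f))‖) := by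
  set c : ℝ := Real.sqrt (1 / totalArea) with hc
  have hA := totalArea_pos
  have hc2 : c ^ 2 = 1 / totalArea := Real.sq_sqrt (by positivity)
  have hcpos : 0 < c := Real.sqrt_pos.2 (by positivity)
  set S : ℝ := ∑' l : ℕ, 1 / ((l : ℝ) + 1) ^ 2
  have hS : 0 ≤ S := tsum_nonneg fun l => by positivity
  refine ⟨c * (1 + S), by positivity, fun f x => ?_⟩
  have h0 : |proj 0 (toL2 f) x| ≤ c * ‖toL2 f‖ := by
    refine abs_le_of_sq_le_sq ?_ (by positivity)
    have := sq_le_of_mem_Pdeg (proj_mem 0 (toL2 f)) x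
    rw [← norm_toL2_sq] at this
    refine this.trans ?_
    rw [mul_pow, hc2]
    have := norm_proj_le 0 (toL2 f)
    simp only [CharP.cast_eq_zero, zero_add, one_pow]
    gcongr
  have hl : ∀ l : ℕ, |(proj (l + 1) (toL2 f) - proj l (toL2 f)) x| ≤
      c * ‖toL2 (Lap (Lap f))‖ * (1 / ((l : ℝ) + 1) ^ 2) := by
    intro l
    set e := proj (l + 1) (toL2 f) - proj l (toL2 f) with he
    have hem : e ∈ Pdeg (l + 1) :=
      sub_mem (proj_mem _ _) (Pdeg_mono (Nat.le_succ l) (proj_mem _ _))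
    have hort : ∀ q ∈ Pdeg l, sInt (e * q) = 0 := fun q hq => by
      rw [he, sub_mul, map_sub, inner_proj _ _ hq, inner_proj _ _ (Pdeg_mono (Nat.le_succ l) hq),
        sub_self]
    -- `Lap e + (l + 1)(l + 2) e` lies in `Pdeg l` and is orthogonal to `Pdeg l`, because `e` is and
    -- `Lap` is symmetric and preserves `Pdeg l`.
    have hLap : Lap e = -((((l : ℝ) + 1) * (l + 2)) • e) := by
      rw [eq_neg_iff_add_eq_zero]
      apply sInt_sq_eq_zero
      have hm := Lap_add_smul_mem hem
      conv_lhs => rw [add_mul, sInt.map_add, smul_mul_assoc, sInt.map_smul, hort _ hm]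
      rw [sInt_Lap_comm, hort _ (Lap_mem_Pdeg hm), smul_zero, add_zero]
    have hLL : Lap (Lap e) = ((((l : ℝ) + 1) * (l + 2)) ^ 2) • e := by
      rw [hLap, map_neg, map_smul, hLap, smul_neg, neg_neg, smul_smul, sq]
    have hLe : Lap (Lap e) = proj (l + 1) (toL2 (Lap (Lap f))) -
        proj l (toL2 (proj (l + 1) (toL2 (Lap (Lap f))))) := by
      rw [proj_proj (Nat.le_succ l), proj_Lap, proj_Lap, proj_Lap, proj_Lap, he, map_sub, map_sub]
    have hn : (((l : ℝ) + 1) * (l + 2)) ^ 2 * ‖toL2 e‖ ≤ ‖toL2 (Lap (Lap f))‖ := by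
      have h1 : ‖toL2 (Lap (Lap e))‖ ≤ ‖toL2 (Lap (Lap f))‖ := by
        rw [hLe, map_sub]
        exact (norm_sub_proj_le _ _).trans (norm_proj_le _ _)
      rw [hLL, map_smul, norm_smul, Real.norm_of_nonneg (by positivity)] at h1
      exact h1
    rw [mul_one_div, le_div_iff₀ (by positivity)]
    refine le_of_sq_le_sq ?_ (by positivity)
    have h2 := sq_le_of_mem_Pdeg hem x
    rw [← norm_toL2_sq] at h2
    have h3 : ((((l : ℝ) + 1) * (l + 2)) ^ 2 * ‖toL2 e‖) ^ 2 ≤ ‖toL2 (Lap (Lap f))‖ ^ 2 := by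
      gcongr
    rw [mul_pow, mul_pow, sq_abs, hc2]
    calc (e x) ^ 2 * (((l : ℝ) + 1) ^ 2) ^ 2
        ≤ (((l + 1 : ℕ) : ℝ) + 1) ^ 3 / totalArea * ‖toL2 e‖ ^ 2 * (((l : ℝ) + 1) ^ 2) ^ 2 := by
          gcongr
      _ = 1 / totalArea * (((l : ℝ) + 2) ^ 3 * ‖toL2 e‖ ^ 2 * ((l : ℝ) + 1) ^ 4) := by
          push_cast; ring
      -- Giving away one power of `l + 2` makes the expression a square and still leaves the
      -- summable factor `1 / (l + 1)²`.
      _ ≤ 1 / totalArea * (((l : ℝ) + 2) ^ 4 * ‖toL2 e‖ ^ 2 * ((l : ℝ) + 1) ^ 4) := by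
          gcongr
          · linarith [(Nat.cast_nonneg l : (0 : ℝ) ≤ l)]
          · norm_num
      _ = 1 / totalArea * ((((l : ℝ) + 1) * (l + 2)) ^ 2 * ‖toL2 e‖) ^ 2 := by ring
      _ ≤ _ := by gcongr
  obtain ⟨m, hm⟩ := exists_mem_Pdeg f
  have htel : f = proj 0 (toL2 f) +
      ∑ l ∈ Finset.range m, (proj (l + 1) (toL2 f) - proj l (toL2 f)) := by
    rw [Finset.sum_range_sub (fun l => proj l (toL2 f)), proj_of_mem hm]
    ring
  have hx : f x = proj 0 (toL2 f) x +
      ∑ l ∈ Finset.range m, (proj (l + 1) (toL2 f) - proj l (toL2 f)) x := by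
    conv_lhs => rw [htel]
    rw [add_fun, sum_fun]
  rw [hx]
  calc _ ≤ |proj 0 (toL2 f) x| +
        ∑ l ∈ Finset.range m, |(proj (l + 1) (toL2 f) - proj l (toL2 f)) x| :=
        (abs_add_le _ _).trans (add_le_add le_rfl (Finset.abs_sum_le_sum_abs _ _))
    _ ≤ c * ‖toL2 f‖ +
        ∑ l ∈ Finset.range m, c * ‖toL2 (Lap (Lap f))‖ * (1 / ((l : ℝ) + 1) ^ 2) :=
        add_le_add h0 (Finset.sum_le_sum fun l _ => hl l)
    _ ≤ c * ‖toL2 f‖ + c * ‖toL2 (Lap (Lap f))‖ * S := by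
        rw [← Finset.mul_sum]
        gcongr
        exact summable_inv_succ_sq.sum_le_tsum _ (fun l _ => by positivity)
    _ ≤ _ := by
        have h1 : 0 ≤ c * ‖toL2 f‖ * S := by positivity
        have h2 : 0 ≤ c * ‖toL2 (Lap (Lap f))‖ := by positivity
        nlinarith

/-! ### Density of polynomials -/

/-- Stone–Weierstrass gives uniform density in the continuous functions, which are dense in `L²`. -/
lemma denseRange_toL2 : DenseRange toL2 := by
  have h1 : DenseRange (ContinuousMap.toLp 2 area ℝ : C(S2, ℝ) → L2) :=
    ContinuousMap.toLp_denseRange ℝ area ℝ (by norm_num)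
  refine h1.comp ?_ (ContinuousMap.toLp 2 area ℝ).continuous
  have hs : polyEval.range.SeparatesPoints := by
    intro x y hxy
    have : ∃ k, (x : E3) k ≠ (y : E3) k := by
      by_contra! h
      exact hxy (Subtype.ext (by ext k; exact h k))
    obtain ⟨k, hk⟩ := this
    exact ⟨X k, ⟨_, (X k).2, rfl⟩, by simpa using hk⟩
  have h2 := ContinuousMap.subalgebra_topologicalClosure_eq_top_of_separatesPoints _ hs
  intro f
  have h3 : f ∈ polyEval.range.topologicalClosure := by rw [h2]; trivial
  rw [← SetLike.mem_coe, Subalgebra.topologicalClosure_coe] at h3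
  convert h3
  exact Subtype.range_coe

lemma tendsto_proj (F : L2) :
    Filter.Tendsto (fun N => toL2 (proj N F)) Filter.atTop (nhds F) := by
  rw [Metric.tendsto_atTop]
  intro ε hε
  obtain ⟨q, hq⟩ := denseRange_toL2.exists_dist_lt F hε
  obtain ⟨N, hN⟩ := exists_mem_Pdeg q
  refine ⟨N, fun n hn => ?_⟩
  rw [dist_comm, dist_eq_norm]
  rw [dist_eq_norm] at hq
  refine lt_of_le_of_lt ?_ hq
  have := norm_sub_proj_le n (F - toL2 q)
  rwa [map_sub, proj_of_mem (Pdeg_mono hn hN), map_sub, sub_sub_sub_cancel_right] at this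

/-! ### Sobolev norms of polynomials -/

/-- The sum of the `L²` norms of all rotation derivatives of order at most `k`. -/
def sn : ℕ → SPoly → ℝ
  | 0, f => ‖toL2 f‖
  | k + 1, f => ‖toL2 f‖ + ∑ i, sn k (Z i f)

lemma sn_succ (k : ℕ) (f : SPoly) : sn (k + 1) f = ‖toL2 f‖ + ∑ i, sn k (Z i f) := rfl

lemma sn_nonneg (k : ℕ) (f : SPoly) : 0 ≤ sn k f := by
  induction k generalizing f with
  | zero => exact norm_nonneg _
  | succ k ih => exact add_nonneg (norm_nonneg _) (Finset.sum_nonneg fun i _ => ih _)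

@[simp] lemma sn_zero (k : ℕ) : sn k 0 = 0 := by
  induction k with
  | zero => simp [sn]
  | succ k ih => simp [sn_succ, ih]

lemma sn_add_le (k : ℕ) (f g : SPoly) : sn k (f + g) ≤ sn k f + sn k g := by
  induction k generalizing f g with
  | zero => simpa [sn] using norm_add_le (toL2 f) (toL2 g)
  | succ k ih =>
    have h1 := norm_add_le (toL2 f) (toL2 g)
    have h2 : ∑ i, sn k (Z i (f + g)) ≤ ∑ i, (sn k (Z i f) + sn k (Z i g)) :=
      Finset.sum_le_sum fun i _ => by rw [map_add]; exact ih _ _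
    rw [Finset.sum_add_distrib] at h2
    rw [sn_succ, sn_succ, sn_succ, map_add]
    linarith

lemma sn_smul (k : ℕ) (c : ℝ) (f : SPoly) : sn k (c • f) = |c| * sn k f := by
  induction k generalizing f with
  | zero => simp [sn, norm_smul]
  | succ k ih =>
    rw [sn_succ, sn_succ, map_smul, norm_smul, mul_add, Finset.mul_sum, Real.norm_eq_abs]
    simp only [Derivation.map_smul, ih]

lemma sn_neg (k : ℕ) (f : SPoly) : sn k (-f) = sn k f := by
  have := sn_smul k (-1) f
  simpa using this

lemma sn_sub_le (k : ℕ) (f g : SPoly) : sn k (f - g) ≤ sn k f + sn k g := by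
  rw [sub_eq_add_neg, ← sn_neg k g]; exact sn_add_le _ _ _

lemma sn_sub_comm (k : ℕ) (f g : SPoly) : sn k (f - g) = sn k (g - f) := by
  rw [← sn_neg, neg_sub]

lemma sn_sum_le {ι : Type*} (k : ℕ) (s : Finset ι) (f : ι → SPoly) :
    sn k (∑ i ∈ s, f i) ≤ ∑ i ∈ s, sn k (f i) := by
  classical
  induction s using Finset.induction_on with
  | empty => simp
  | insert a s ha ih =>
    rw [Finset.sum_insert ha, Finset.sum_insert ha]
    exact (sn_add_le _ _ _).trans (add_le_add le_rfl ih)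

lemma norm_le_sn (k : ℕ) (f : SPoly) : ‖toL2 f‖ ≤ sn k f := by
  cases k with
  | zero => exact le_rfl
  | succ k => exact le_add_of_nonneg_right (Finset.sum_nonneg fun _ _ => sn_nonneg _ _)

lemma sn_le_succ (k : ℕ) (f : SPoly) : sn k f ≤ sn (k + 1) f := by
  induction k generalizing f with
  | zero => exact norm_le_sn 1 f
  | succ k ih => exact add_le_add le_rfl (Finset.sum_le_sum fun i _ => ih _)

lemma sn_mono {k l : ℕ} (h : k ≤ l) (f : SPoly) : sn k f ≤ sn l f :=
  monotone_nat_of_le_succ (f := fun k => sn k f) (fun k => sn_le_succ k f) h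

lemma sum_sn_Z_le (k : ℕ) (f : SPoly) : ∑ i, sn k (Z i f) ≤ sn (k + 1) f :=
  le_add_of_nonneg_left (norm_nonneg _)

lemma sn_Z_le (i : Fin 3) (k : ℕ) (f : SPoly) : sn k (Z i f) ≤ sn (k + 1) f :=
  (Finset.single_le_sum (f := fun i => sn k (Z i f)) (fun _ _ => sn_nonneg _ _)
    (Finset.mem_univ i)).trans (sum_sn_Z_le k f)

lemma sn_Lap_le (k : ℕ) (f : SPoly) : sn k (Lap f) ≤ sn (k + 2) f := by
  rw [Lap_apply]
  exact (sn_sum_le _ _ _).trans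
    ((Finset.sum_le_sum fun i _ => sn_Z_le i k (Z i f)).trans (sum_sn_Z_le (k + 1) f))

lemma exists_abs_le_sn : ∃ C : ℝ, 0 < C ∧ ∀ (f : SPoly) (x : S2), |f x| ≤ C * sn 4 f := by
  obtain ⟨C, hC, h⟩ := exists_abs_le
  refine ⟨2 * C, by positivity, fun f x => (h f x).trans ?_⟩
  have h1 := norm_le_sn 4 f
  have h2 : ‖toL2 (Lap (Lap f))‖ ≤ sn 4 f := (sn_Lap_le 0 (Lap f)).trans (sn_Lap_le 2 f)
  nlinarith

lemma norm_toL2_mul_le {f g : SPoly} {B : ℝ} (hB : 0 ≤ B) (h : ∀ x, |f x| ≤ B) :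
    ‖toL2 (f * g)‖ ≤ B * ‖toL2 g‖ := by
  refine le_of_sq_le_sq ?_ (by positivity)
  rw [mul_pow, norm_toL2_sq, norm_toL2_sq,
    show B ^ 2 * sInt (g * g) = sInt (B ^ 2 • (g * g)) by rw [map_smul, smul_eq_mul]]
  refine integral_mono (integrable_of_continuous (SPoly.continuous _))
    (integrable_of_continuous (SPoly.continuous _)) fun x => ?_
  simp only [mul_fun, smul_fun]
  have := sq_le_sq' (by linarith [abs_nonneg (f x), h x, neg_abs_le (f x)])
    (le_trans (le_abs_self _) (h x))
  nlinarith [mul_self_nonneg (g x)]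

/-- Multiplication in Sobolev spaces. -/
lemma exists_sn_mul_le (k : ℕ) : ∃ P : ℝ, 0 < P ∧ ∀ p q : ℕ, k ≤ p → k ≤ q → k + 8 ≤ p + q →
    ∀ f g : SPoly, sn k (f * g) ≤ P * sn p f * sn q g := by
  obtain ⟨C, hC, hsup⟩ := exists_abs_le_sn
  -- One of the two orders is at least `4`, so that factor is bounded in the sup norm and the other
  -- one in `L²`.
  have h0 : ∀ p q : ℕ, 8 ≤ p + q → ∀ f g : SPoly, ‖toL2 (f * g)‖ ≤ C * sn p f * sn q g := by
    have h1 : ∀ p q : ℕ, 4 ≤ p → ∀ f g : SPoly, ‖toL2 (f * g)‖ ≤ C * sn p f * sn q g := by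
      intro p q hp f g
      refine (norm_toL2_mul_le (mul_nonneg hC.le (sn_nonneg 4 f)) (hsup f)).trans ?_
      have := sn_nonneg 4 f
      have := sn_nonneg p f
      gcongr
      · exact sn_mono hp f
      · exact norm_le_sn q g
    intro p q hpq f g
    rcases le_or_gt 4 p with hp | hp
    · exact h1 p q hp f g
    · rw [mul_comm f g, mul_right_comm]
      exact h1 q p (by lia) g f
  induction k with
  | zero => exact ⟨C, hC, fun p q _ _ h f g => h0 p q (by lia) f g⟩
  | succ k ih =>
    obtain ⟨P, hP, hk⟩ := ih
    refine ⟨C + 2 * P, by positivity, fun p q hp hq hpq f g => ?_⟩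
    obtain ⟨p, rfl⟩ : ∃ p', p = p' + 1 := ⟨p - 1, by lia⟩
    obtain ⟨q, rfl⟩ : ∃ q', q = q' + 1 := ⟨q - 1, by lia⟩
    have hf := sn_nonneg (p + 1) f
    have hg := sn_nonneg (q + 1) g
    -- A derivative lowers the order of one factor by one, together with `k`, so `k + 8 ≤ p + q`
    -- persists.
    have hi : ∑ i, sn k (Z i (f * g)) ≤
        ∑ i, (P * sn p (Z i f) * sn (q + 1) g + P * sn (p + 1) f * sn q (Z i g)) := by
      refine Finset.sum_le_sum fun i _ => ?_
      rw [Z_mul]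
      exact (sn_add_le _ _ _).trans (add_le_add
        (hk p (q + 1) (by lia) (by lia) (by lia) _ _)
        (hk (p + 1) q (by lia) (by lia) (by lia) _ _))
    rw [Finset.sum_add_distrib, ← Finset.sum_mul, ← Finset.mul_sum, ← Finset.mul_sum] at hi
    have h1 : P * (∑ i, sn p (Z i f)) * sn (q + 1) g ≤ P * sn (p + 1) f * sn (q + 1) g := by
      gcongr; exact sum_sn_Z_le p f
    have h2 : P * sn (p + 1) f * (∑ i, sn q (Z i g)) ≤ P * sn (p + 1) f * sn (q + 1) g := by
      gcongr; exact sum_sn_Z_le q g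
    have h3 := h0 (p + 1) (q + 1) (by lia) f g
    rw [sn_succ]
    linarith

/-! ### Projections and Sobolev norms -/

/-- The orthogonal projection of polynomials to polynomials of degree at most `N`. -/
def pr (N : ℕ) : SPoly →ₗ[ℝ] SPoly := proj N ∘ₗ toL2

lemma pr_mem (N : ℕ) (f : SPoly) : pr N f ∈ Pdeg N := proj_mem _ _

lemma pr_of_mem {N : ℕ} {f : SPoly} (hf : f ∈ Pdeg N) : pr N f = f := proj_of_mem hf

lemma pr_Z (i : Fin 3) (N : ℕ) (f : SPoly) : pr N (Z i f) = Z i (pr N f) := proj_Z i N f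

lemma sInt_pr_mul {N : ℕ} (f : SPoly) {q : SPoly} (hq : q ∈ Pdeg N) :
    sInt (pr N f * q) = sInt (f * q) := by
  rw [pr, LinearMap.comp_apply, inner_proj _ _ hq, inner_toL2]

lemma sn_pr_le (N k : ℕ) (f : SPoly) : sn k (pr N f) ≤ sn k f := by
  induction k generalizing f with
  | zero => exact norm_proj_le _ _
  | succ k ih =>
    refine add_le_add (norm_proj_le _ _) (Finset.sum_le_sum fun i _ => ?_)
    rw [← pr_Z]; exact ih _

lemma norm_le_sum_Z {N : ℕ} {u : SPoly} (hu : ∀ q ∈ Pdeg N, sInt (u * q) = 0) :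
    ((N : ℝ) + 1) * ‖toL2 u‖ ≤ ∑ i, ‖toL2 (Z i u)‖ := by
  refine le_of_sq_le_sq ?_ (Finset.sum_nonneg fun i _ => norm_nonneg _)
  have h := poincare hu
  have h2 : ∑ i, sInt (Z i u * Z i u) ≤ (∑ i, ‖toL2 (Z i u)‖) ^ 2 := by
    simp only [← norm_toL2_sq]
    exact Finset.sum_sq_le_sq_sum_of_nonneg fun i _ => norm_nonneg _
  refine le_trans ?_ (h.trans h2)
  rw [mul_pow, norm_toL2_sq]
  have := sInt_sq_nonneg u
  have hN : (0 : ℝ) ≤ N := Nat.cast_nonneg N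
  gcongr
  nlinarith

/-- The Poincaré inequality off `Pdeg N` trades one derivative for the factor `1 / (N + 1)`, and
higher orders follow since `Z i` commutes with `pr N`. All truncation rates come from here. -/
lemma sn_sub_pr_le (N k : ℕ) (f : SPoly) :
    ((N : ℝ) + 1) * sn k (f - pr N f) ≤ ((k : ℝ) + 1) * sn (k + 1) f := by
  have h0 : ∀ f : SPoly, ((N : ℝ) + 1) * ‖toL2 (f - pr N f)‖ ≤ ∑ i, ‖toL2 (Z i f)‖ := by
    intro f
    refine (norm_le_sum_Z fun q hq => ?_).trans (Finset.sum_le_sum fun i _ => ?_)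
    · rw [sub_mul, map_sub, sInt_pr_mul _ hq, sub_self]
    · rw [map_sub, ← pr_Z, map_sub]
      exact norm_sub_proj_le N _
  induction k generalizing f with
  | zero =>
    simp only [CharP.cast_eq_zero, zero_add, one_mul]
    exact (h0 f).trans (sum_sn_Z_le 0 f)
  | succ k ih =>
    rw [sn_succ, mul_add]
    have h1 : ∑ i, ((N : ℝ) + 1) * sn k (Z i (f - pr N f)) ≤
        ∑ i, ((k : ℝ) + 1) * sn (k + 1) (Z i f) := by
      refine Finset.sum_le_sum fun i _ => ?_
      rw [map_sub, ← pr_Z]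
      exact ih _
    have h2 : ∑ i, ‖toL2 (Z i f)‖ ≤ ∑ i, sn (k + 1) (Z i f) :=
      Finset.sum_le_sum fun i _ => norm_le_sn _ _
    have h3 := sum_sn_Z_le (k + 1) f
    simp only [← Finset.mul_sum] at h1
    have h4 := h0 f
    push_cast
    have : 0 ≤ (k : ℝ) := Nat.cast_nonneg k
    have h5 : ((k : ℝ) + 1 + 1) * ∑ i, sn (k + 1) (Z i f) ≤ ((k : ℝ) + 1 + 1) * sn (k + 1 + 1) f := by
      gcongr
    linarith

/-! ### The Laplace equation -/

lemma Z_comm01 (f : SPoly) : Z 0 (Z 1 f) = Z 1 (Z 0 f) - Z 2 f := by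
  rw [Z_comm]; simp [crossProduct, Fin.sum_univ_three]

lemma Z_comm02 (f : SPoly) : Z 0 (Z 2 f) = Z 2 (Z 0 f) + Z 1 f := by
  rw [Z_comm]; simp [crossProduct, Fin.sum_univ_three]; ring

lemma Z_comm12 (f : SPoly) : Z 1 (Z 2 f) = Z 2 (Z 1 f) - Z 0 f := by
  rw [Z_comm]; simp [crossProduct, Fin.sum_univ_three]

/-- The Laplacian is the Casimir element of the rotation algebra: the commutators with the three
squares cancel. -/
lemma Lap_Z (i : Fin 3) (f : SPoly) : Lap (Z i f) = Z i (Lap f) := by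
  simp only [Lap_apply, Fin.sum_univ_three, map_add]
  fin_cases i
  · have h2 := congrArg (Z 1) (Z_comm01 f)
    have h4 := congrArg (Z 2) (Z_comm02 f)
    rw [map_sub] at h2
    rw [map_add] at h4
    simp only [Fin.zero_eta]
    linear_combination -(Z_comm01 (Z 1 f)) - h2 - Z_comm02 (Z 2 f) - h4
  · have h2 := congrArg (Z 0) (Z_comm01 f)
    have h4 := congrArg (Z 2) (Z_comm12 f)
    rw [map_sub] at h2 h4
    simp only [Fin.mk_one]
    linear_combination h2 + Z_comm01 (Z 0 f) - Z_comm12 (Z 2 f) - h4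
  · have h2 := congrArg (Z 0) (Z_comm02 f)
    have h4 := congrArg (Z 1) (Z_comm12 f)
    rw [map_add] at h2
    rw [map_sub] at h4
    simp only [Fin.reduceFinMk]
    linear_combination h2 + Z_comm02 (Z 0 f) + Z_comm12 (Z 1 f) + h4

lemma abs_sInt_mul_le (f g : SPoly) : |sInt (f * g)| ≤ ‖toL2 f‖ * ‖toL2 g‖ := by
  rw [← inner_toL2]; exact abs_real_inner_le_norm _ _

/-- Poincaré combined with `∑ ‖Z_i φ‖² = -∫ Lap φ · φ`. -/
lemma norm_le_norm_Lap {φ : SPoly} (h : sInt φ = 0) :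
    ‖toL2 φ‖ ≤ ‖toL2 (Lap φ)‖ ∧ (∀ i, ‖toL2 (Z i φ)‖ ≤ ‖toL2 (Lap φ)‖) := by
  have h1 := poincare_zero h
  have h2 := sInt_Lap_mul φ φ
  have h3 := abs_sInt_mul_le (Lap φ) φ
  have h4 : ∑ i, sInt (Z i φ * Z i φ) ≤ ‖toL2 (Lap φ)‖ * ‖toL2 φ‖ := by
    have := neg_abs_le (sInt (Lap φ * φ))
    linarith
  rw [← norm_toL2_sq] at h1
  have h5 : ‖toL2 φ‖ ≤ ‖toL2 (Lap φ)‖ := by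
    by_contra! hc
    have := norm_nonneg (toL2 (Lap φ))
    nlinarith
  refine ⟨h5, fun i => ?_⟩
  have h6 : ‖toL2 (Z i φ)‖ ^ 2 ≤ ∑ i, sInt (Z i φ * Z i φ) := by
    rw [norm_toL2_sq]
    exact Finset.single_le_sum (f := fun i => sInt (Z i φ * Z i φ))
      (fun i _ => sInt_sq_nonneg _) (Finset.mem_univ i)
  refine le_of_sq_le_sq ?_ (norm_nonneg _)
  nlinarith [norm_nonneg (toL2 (Lap φ))]

/-- Since the Laplacian commutes with `Z i`, integration by parts gives `∑ ‖Z_j Z_i φ‖² = ‖Lap φ‖²`.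
-/
lemma norm_Z_Z_le (i j : Fin 3) (φ : SPoly) : ‖toL2 (Z j (Z i φ))‖ ≤ ‖toL2 (Lap φ)‖ := by
  refine le_of_sq_le_sq ?_ (norm_nonneg _)
  have h : ∑ i, ∑ j, sInt (Z j (Z i φ) * Z j (Z i φ)) = ‖toL2 (Lap φ)‖ ^ 2 := by
    have h1 : ∀ i, ∑ j, sInt (Z j (Z i φ) * Z j (Z i φ)) = sInt (Lap φ * Z i (Z i φ)) := by
      intro i
      have := sInt_Lap_mul (Z i φ) (Z i φ)
      rw [Lap_Z, sInt_Z_mul] at this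
      linarith
    simp only [h1]
    rw [norm_toL2_sq, ← map_sum, ← Finset.mul_sum, ← Lap_apply]
  rw [← h, norm_toL2_sq]
  have h2 : sInt (Z j (Z i φ) * Z j (Z i φ)) ≤ ∑ j, sInt (Z j (Z i φ) * Z j (Z i φ)) :=
    Finset.single_le_sum (f := fun j => sInt (Z j (Z i φ) * Z j (Z i φ)))
      (fun j _ => sInt_sq_nonneg _) (Finset.mem_univ j)
  exact h2.trans (Finset.single_le_sum
    (f := fun i => ∑ j, sInt (Z j (Z i φ) * Z j (Z i φ)))
      (fun i _ => Finset.sum_nonneg fun j _ => sInt_sq_nonneg _) (Finset.mem_univ i))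

/-- Elliptic regularity for the Laplacian. -/
lemma sn_le_sn_Lap (k : ℕ) {φ : SPoly} (h : sInt φ = 0) : sn (k + 2) φ ≤ 13 * sn k (Lap φ) := by
  induction k generalizing φ with
  | zero =>
    have h1 := norm_le_norm_Lap h
    have h2 : ∀ i, sn 1 (Z i φ) ≤ 4 * ‖toL2 (Lap φ)‖ := fun i => by
      rw [sn_succ, Fin.sum_univ_three]
      simp only [sn]
      linarith [h1.2 i, norm_Z_Z_le i 0 φ, norm_Z_Z_le i 1 φ, norm_Z_Z_le i 2 φ]
    -- `‖φ‖` contributes `1` and each of three derivatives `4`, hence `13`. The constant persists at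
    -- higher order because `Z i φ` has mean zero.
    rw [sn_succ, Fin.sum_univ_three]
    simp only [sn] at h2 ⊢
    linarith [h1.1, h2 0, h2 1, h2 2]
  | succ k ih =>
    rw [sn_succ, sn_succ k (Lap φ), mul_add, Finset.mul_sum]
    refine add_le_add ?_ (Finset.sum_le_sum fun i _ => ?_)
    · linarith [(norm_le_norm_Lap h).1, norm_nonneg (toL2 (Lap φ))]
    · rw [← Lap_Z]
      exact ih (sInt_Z i φ)

/-- Injectivity implies surjectivity in finite dimension. Existence for the Laplace equation and for
the truncated transport equation is thereby reduced to uniqueness. -/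
lemma exists_mem_apply_eq {V : Type*} [AddCommGroup V] [Module ℝ V] {P : Submodule ℝ V}
    (hP : FiniteDimensional ℝ P) (T : V →ₗ[ℝ] V) (hT : ∀ f ∈ P, T f ∈ P)
    (hinj : ∀ f ∈ P, T f = 0 → f = 0) {F : V} (hF : F ∈ P) : ∃ f ∈ P, T f = F := by
  have hi : Function.Injective (T.restrict hT) := by
    refine (injective_iff_map_eq_zero _).2 fun f hf => Subtype.ext ?_
    exact hinj f f.2 (congrArg Subtype.val hf)
  obtain ⟨f, hf⟩ := LinearMap.injective_iff_surjective.1 hi ⟨F, hF⟩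
  exact ⟨f, f.2, congrArg Subtype.val hf⟩

lemma exists_Lap_eq {F : SPoly} (hF : sInt F = 0) : ∃ φ, sInt φ = 0 ∧ Lap φ = F := by
  obtain ⟨N, hN⟩ := exists_mem_Pdeg F
  -- Adding the integral removes the constants from the kernel of the Laplacian; for a right side of
  -- integral zero the added term turns out to vanish.
  let c : SPoly →ₗ[ℝ] SPoly := Algebra.linearMap ℝ SPoly ∘ₗ sInt
  have hc : ∀ f, c f = algebraMap ℝ SPoly (sInt f) := fun f => rfl
  have hint : ∀ f, sInt (Lap f + c f) = sInt f * totalArea := fun f => by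
    rw [map_add, Lap_apply, map_sum, hc, sInt_algebraMap]; simp
  obtain ⟨φ, hφ, h1⟩ := exists_mem_apply_eq (inferInstance : FiniteDimensional ℝ (Pdeg N))
    (Lap + c) (fun f hf => add_mem (Lap_mem_Pdeg hf) (algebraMap_mem_Pdeg _ _))
    (fun f hf h => by
      have h1 : Lap f + c f = 0 := h
      have h2 : sInt f = 0 := by
        have := hint f
        rw [h1, map_zero] at this
        exact (mul_eq_zero.1 this.symm).resolve_right totalArea_pos.ne'
      rw [hc, h2, map_zero, add_zero] at h1
      have h3 := (norm_le_norm_Lap h2).1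
      rw [h1, map_zero, norm_zero] at h3
      have h4 : toL2 f = toL2 0 := by rw [map_zero]; exact norm_le_zero_iff.1 h3
      exact toL2_injective h4) hN
  rw [LinearMap.add_apply] at h1
  have h2 : sInt φ = 0 := by
    have := hint φ
    rw [h1, hF] at this
    exact (mul_eq_zero.1 this.symm).resolve_right totalArea_pos.ne'
  refine ⟨φ, h2, ?_⟩
  rwa [hc, h2, map_zero, add_zero] at h1

/-! ### The Hodge system of the round sphere -/

/-- The rotation fields satisfy `∑ x_i (e_i × x) = x × x = 0`. -/
lemma X_Z_eq_zero (f : SPoly) : X 0 * Z 0 f + X 1 * Z 1 f + X 2 * Z 2 f = 0 := by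
  induction f using SPoly.induction with
  | hC c => simp
  | hadd f g hf hg => simp only [map_add]; linear_combination hf + hg
  | hX f m hf =>
    simp only [Z_mul]
    have : X 0 * Z 0 (X m) + X 1 * Z 1 (X m) + X 2 * Z 2 (X m) = 0 := by
      simp only [Z_X]
      fin_cases m <;> simp [crossProduct] <;> ring
    linear_combination X m * hf + f * this

lemma D_eq (f : SPoly) : D 0 f = X 2 * Z 1 f - X 1 * Z 2 f ∧ D 1 f = X 0 * Z 2 f - X 2 * Z 0 f ∧
    D 2 f = X 1 * Z 0 f - X 0 * Z 1 f := by
  refine ⟨?_, ?_, ?_⟩ <;> rw [D_apply, Fin.sum_univ_three] <;> simp [rotX, crossProduct] <;> ring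

lemma Z_eq (f : SPoly) : Z 0 f = X 1 * D 2 f - X 2 * D 1 f ∧ Z 1 f = X 2 * D 0 f - X 0 * D 2 f ∧
    Z 2 f = X 0 * D 1 f - X 1 * D 0 f := by
  obtain ⟨h0, h1, h2⟩ := D_eq f
  have hx := sum_X_sq'
  have hz := X_Z_eq_zero f
  rw [h0, h1, h2]
  refine ⟨?_, ?_, ?_⟩
  · linear_combination X 0 * hz - Z 0 f * hx
  · linear_combination X 1 * hz - Z 1 f * hx
  · linear_combination X 2 * hz - Z 2 f * hx

/-- The vector field `-x × (x × ∇φ) + x × ∇ψ` with divergence `Δφ` and curl `Δψ`. -/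
def hodge (φ ψ : SPoly) : Fin 3 → SPoly :=
  ![Z 0 ψ - (X 1 * Z 2 φ - X 2 * Z 1 φ), Z 1 ψ - (X 2 * Z 0 φ - X 0 * Z 2 φ),
    Z 2 ψ - (X 0 * Z 1 φ - X 1 * Z 0 φ)]

lemma sum_X_hodge (φ ψ : SPoly) : ∑ k, X k * hodge φ ψ k = 0 := by
  simp only [Fin.sum_univ_three, hodge, Matrix.cons_val]
  linear_combination X_Z_eq_zero ψ

/-- `∑ Z_k b_k = (x × ∇) · b` is the round curl; the gradient part drops out by the commutation
relations. -/
lemma sum_Z_hodge (φ ψ : SPoly) : ∑ k, Z k (hodge φ ψ k) = Lap ψ := by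
  simp only [Fin.sum_univ_three, hodge, Matrix.cons_val, Lap_apply, map_sub, Z_mul]
  have h := X_Z_eq_zero φ
  have h01 := Z_comm01 φ
  have h02 := Z_comm02 φ
  have h12 := Z_comm12 φ
  simp only [Z_X]
  simp [crossProduct]
  linear_combination h - X 1 * h02 + X 2 * h01 + X 0 * h12

/-- For a tangential field `∑ D_k b_k` is the round divergence; the rotated gradient of `ψ` is
divergence free by the commutation relations. -/
lemma sum_D_hodge (φ ψ : SPoly) : ∑ k, D k (hodge φ ψ k) = Lap φ := by
  simp only [Fin.sum_univ_three, hodge, Matrix.cons_val, Lap_apply, map_sub]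
  have h1 : D 0 (Z 0 ψ) + D 1 (Z 1 ψ) + D 2 (Z 2 ψ) = 0 := by
    rw [(D_eq (Z 0 ψ)).1, (D_eq (Z 1 ψ)).2.1, (D_eq (Z 2 ψ)).2.2]
    linear_combination X_Z_eq_zero ψ - X 2 * Z_comm01 ψ + X 1 * Z_comm02 ψ - X 0 * Z_comm12 ψ
  simp only [D_mul, D_X]
  rw [(Z_eq (Z 0 φ)).1, (Z_eq (Z 1 φ)).2.1, (Z_eq (Z 2 φ)).2.2]
  simp
  linear_combination h1

lemma sn_X_mul_le (k : ℕ) : ∃ P : ℝ, 0 < P ∧ ∀ (i : Fin 3) (f : SPoly),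
    sn k (X i * f) ≤ P * sn k f := by
  obtain ⟨P, hP, h⟩ := exists_sn_mul_le k
  refine ⟨P * (1 + ∑ i, sn (k + 8) (X i)), mul_pos hP (add_pos_of_pos_of_nonneg one_pos
    (Finset.sum_nonneg fun i _ => sn_nonneg _ _)), fun i f => ?_⟩
  refine (h (k + 8) k (by lia) le_rfl (by lia) _ _).trans ?_
  have h1 : sn (k + 8) (X i) ≤ ∑ i, sn (k + 8) (X i) :=
    Finset.single_le_sum (f := fun i => sn (k + 8) (X i)) (fun _ _ => sn_nonneg _ _)
      (Finset.mem_univ i)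
  have := sn_nonneg k f
  gcongr
  linarith

/-- The potentials gain two derivatives and the field uses one. The net gain of one compensates the
loss in the quadratic terms. -/
lemma exists_sn_hodge_le (k : ℕ) : ∃ P : ℝ, 0 < P ∧ ∀ φ ψ : SPoly, sInt φ = 0 → sInt ψ = 0 →
    ∀ i, sn (k + 1) (hodge φ ψ i) ≤ P * (sn k (Lap φ) + sn k (Lap ψ)) := by
  obtain ⟨P, hP, h⟩ := sn_X_mul_le (k + 1)
  refine ⟨13 + 26 * P, by positivity, fun φ ψ hφ hψ i => ?_⟩
  have hZ : ∀ f : SPoly, sInt f = 0 → ∀ i, sn (k + 1) (Z i f) ≤ 13 * sn k (Lap f) :=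
    fun f hf i => (sn_Z_le i (k + 1) f).trans (sn_le_sn_Lap k hf)
  have hX : ∀ i j, sn (k + 1) (X i * Z j φ) ≤ P * (13 * sn k (Lap φ)) := fun i j =>
    (h i _).trans (by gcongr; exact hZ φ hφ j)
  have hh : ∀ a b c d e, sn (k + 1) (Z a ψ - (X b * Z c φ - X d * Z e φ)) ≤
      (13 + 26 * P) * (sn k (Lap φ) + sn k (Lap ψ)) := by
    intro a b c d e
    have h1 := sn_sub_le (k + 1) (Z a ψ) (X b * Z c φ - X d * Z e φ)
    have h2 := sn_sub_le (k + 1) (X b * Z c φ) (X d * Z e φ)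
    have h3 := hX b c
    have h4 := hX d e
    have h5 := hZ ψ hψ a
    have h6 := sn_nonneg k (Lap φ)
    have h7 := mul_nonneg hP.le (sn_nonneg k (Lap ψ))
    linarith
  fin_cases i
  · exact hh 0 1 2 2 1
  · exact hh 1 2 0 0 2
  · exact hh 2 0 1 1 0

/-! ### The transport equation -/

/-- The derivative of `u` along the field with components `w` in the frame of rotations. -/
def adv (w : Fin 3 → SPoly) (u : SPoly) : SPoly := ∑ i, w i * Z i u

lemma adv_sub (w : Fin 3 → SPoly) (u v : SPoly) : adv w (u - v) = adv w u - adv w v := by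
  simp only [adv, map_sub, mul_sub, Finset.sum_sub_distrib]

/-- The symmetric part of `w_i Z_i` is multiplication by `-(1/2) Z_i w_i`, so no derivative falls on
`u`. -/
lemma sInt_mul_adv (w : Fin 3 → SPoly) (u : SPoly) :
    sInt (u * adv w u) = -(1 / 2) * sInt ((∑ i, Z i (w i)) * u * u) := by
  have h : ∀ i, sInt (u * (w i * Z i u)) = -(1 / 2) * sInt (Z i (w i) * u * u) := by
    intro i
    have h1 := sInt_Z_mul i u (w i * u)
    rw [Z_mul, mul_add, map_add] at h1
    have e1 : Z i u * (w i * u) = u * (w i * Z i u) := by ring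
    have e2 : u * (Z i (w i) * u) = Z i (w i) * u * u := by ring
    rw [e1, e2] at h1
    linarith
  rw [adv, Finset.mul_sum, map_sum, Finset.sum_mul, Finset.sum_mul, map_sum, Finset.mul_sum]
  exact Finset.sum_congr rfl fun i _ => h i

/-- Testing with `u ∈ Pdeg N` removes the projection. Smallness of `w` bounds `∑ Z_i w_i` by `1`, so
advection contributes at most half of `‖u‖²`; the resulting factor `2` does not depend on `N`. -/
lemma exists_energy_estimate : ∃ δ : ℝ, 0 < δ ∧ ∀ (N : ℕ) (w : Fin 3 → SPoly),
    ∑ i, sn 5 (w i) ≤ δ → ∀ u ∈ Pdeg N, ∀ F, u = pr N (adv w u + F) →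
      ‖toL2 u‖ ≤ 2 * ‖toL2 F‖ := by
  obtain ⟨C, hC, hsup⟩ := exists_abs_le_sn
  refine ⟨1 / C, by positivity, fun N w hw u hu F hF => ?_⟩
  have hdiv : ∀ x, |(∑ i, Z i (w i)) x| ≤ 1 := fun x => by
    refine (hsup _ x).trans ?_
    have : sn 4 (∑ i, Z i (w i)) ≤ 1 / C :=
      (sn_sum_le _ _ _).trans ((Finset.sum_le_sum fun i _ => sn_Z_le i 4 (w i)).trans hw)
    calc C * _ ≤ C * (1 / C) := by gcongr
      _ = 1 := by field_simp
  have h1 : ‖toL2 u‖ ^ 2 = sInt (u * adv w u) + sInt (F * u) := by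
    rw [norm_toL2_sq]
    have := sInt_pr_mul (adv w u + F) hu
    rwa [← hF, add_mul, map_add, mul_comm (adv w u)] at this
  rw [sInt_mul_adv] at h1
  have h2 := abs_sInt_mul_le ((∑ i, Z i (w i)) * u) u
  have h3 := norm_toL2_mul_le (g := u) zero_le_one hdiv
  have h4 := abs_sInt_mul_le F u
  rw [abs_le] at h2 h4
  have h5 := norm_nonneg (toL2 u)
  by_contra! hc
  have h6 : ‖toL2 ((∑ i, Z i (w i)) * u)‖ * ‖toL2 u‖ ≤ ‖toL2 u‖ ^ 2 := by nlinarith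
  have h7 : 0 < ‖toL2 u‖ := lt_of_le_of_lt (by positivity) hc
  nlinarith [norm_nonneg (toL2 F)]

/-- The energy estimate with `F = 0` makes `u ↦ u - pr N (adv w u)` injective on `Pdeg N`. -/
lemma exists_transport_solution : ∃ δ : ℝ, 0 < δ ∧ ∀ (N : ℕ) (w : Fin 3 → SPoly),
    ∑ i, sn 5 (w i) ≤ δ → ∀ F, ∃ u ∈ Pdeg N, u = pr N (adv w u + F) := by
  obtain ⟨δ, hδ, h⟩ := exists_energy_estimate
  refine ⟨δ, hδ, fun N w hw F => ?_⟩
  let A : SPoly →ₗ[ℝ] SPoly := ∑ i, LinearMap.mulLeft ℝ (w i) ∘ₗ (Z i : SPoly →ₗ[ℝ] SPoly)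
  have hA : ∀ u, A u = adv w u := fun u => by simp [A, adv]
  obtain ⟨u, hu, h1⟩ := exists_mem_apply_eq (inferInstance : FiniteDimensional ℝ (Pdeg N))
    (LinearMap.id - pr N ∘ₗ A) (fun f hf => sub_mem hf (pr_mem _ _))
    (fun u hu h1 => by
      have h2 : u - pr N (A u) = 0 := h1
      rw [hA, sub_eq_zero] at h2
      have h3 := h N w hw u hu 0 (by rwa [add_zero])
      rw [map_zero, norm_zero, mul_zero, norm_le_zero_iff] at h3
      exact toL2_injective (by rw [h3, map_zero])) (pr_mem N F)
  refine ⟨u, hu, ?_⟩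
  have h2 : u - pr N (A u) = pr N F := h1
  rw [map_add, ← h2, hA]
  ring

/-- The commutator of `Z i` with advection is of first order, with coefficients linear in `w` and
its first derivatives, hence small. -/
lemma Z_adv (i : Fin 3) (w : Fin 3 → SPoly) (u : SPoly) :
    Z i (adv w u) = adv w (Z i u) + ((∑ j, Z i (w j) * Z j u) - ∑ j, ∑ l, w j *
      (crossProduct (Pi.single i 1 : Fin 3 → ℝ) (Pi.single j 1) l • Z l u)) := by
  simp only [adv, map_sum]
  rw [← Finset.sum_sub_distrib, ← Finset.sum_add_distrib]
  refine Finset.sum_congr rfl fun j _ => ?_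
  rw [Z_mul, Z_comm i j, ← Finset.mul_sum]
  simp only [Algebra.smul_def]
  ring

lemma sum_abs_structure_le (i : Fin 3) (a : Fin 3 → ℝ) (ha : ∀ l, 0 ≤ a l) :
    ∑ j, ∑ l, |crossProduct (Pi.single i 1 : Fin 3 → ℝ) (Pi.single j 1) l| * a l ≤ ∑ l, a l := by
  have h0 := ha 0
  have h1 := ha 1
  have h2 := ha 2
  simp only [Fin.sum_univ_three]
  fin_cases i <;> simp [crossProduct] <;> linarith

/-- The estimate for the transport equation in Sobolev spaces. -/
lemma exists_transport_estimate (m : ℕ) (hm : 8 ≤ m) (k : ℕ) (hk : k ≤ m) :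
    ∃ δ : ℝ, 0 < δ ∧ ∃ C : ℝ, 0 < C ∧ ∀ (N : ℕ) (w : Fin 3 → SPoly),
      ∑ i, sn (m + 1) (w i) ≤ δ → ∀ u ∈ Pdeg N, ∀ F, u = pr N (adv w u + F) →
        sn k u ≤ C * sn k F := by
  obtain ⟨δ₀, hδ₀, h0⟩ := exists_energy_estimate
  have h0' : ∀ (N : ℕ) (w : Fin 3 → SPoly), ∑ i, sn (m + 1) (w i) ≤ δ₀ → ∀ u ∈ Pdeg N, ∀ F,
      u = pr N (adv w u + F) → ‖toL2 u‖ ≤ 2 * ‖toL2 F‖ := fun N w hw =>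
    h0 N w ((Finset.sum_le_sum fun i _ => sn_mono (by lia) _).trans hw)
  induction k with
  | zero => exact ⟨δ₀, hδ₀, 2, two_pos, h0'⟩
  | succ k ih =>
    obtain ⟨δ, hδ, C, hC, h⟩ := ih (by lia)
    obtain ⟨P, hP, hmul⟩ := exists_sn_mul_le k
    -- With `1 / (12 P C)` each of the two commutator sums is at most `Y / (12 C)`; after the factor
    -- `C` and the sum over three indices they amount to `Y / 2`, which is absorbed.
    refine ⟨min (min δ₀ δ) (1 / (12 * P * C)), by positivity, 2 + 2 * C, by positivity,
      fun N w hw u hu F hF => ?_⟩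
    have hw0 := hw.trans ((min_le_left _ _).trans (min_le_left _ _))
    have hw1 := hw.trans ((min_le_left _ _).trans (min_le_right _ _))
    have hw2 := hw.trans (min_le_right _ _)
    have hwj : ∀ j, sn (m + 1) (w j) ≤ 1 / (12 * P * C) := fun j =>
      (Finset.single_le_sum (f := fun j => sn (m + 1) (w j)) (fun j _ => sn_nonneg _ _)
        (Finset.mem_univ j)).trans hw2
    set Y := ∑ l, sn k (Z l u) with hY
    have hYnn : 0 ≤ Y := Finset.sum_nonneg fun l _ => sn_nonneg _ _
    have hYl : ∀ l, sn k (Z l u) ≤ Y := fun l =>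
      Finset.single_le_sum (f := fun l => sn k (Z l u)) (fun l _ => sn_nonneg _ _)
        (Finset.mem_univ l)
    have hprod : ∀ f : SPoly, sn m f ≤ 1 / (12 * P * C) → ∀ l,
        sn k (f * Z l u) ≤ 1 / (12 * C) * sn k (Z l u) := by
      intro f hf l
      refine (hmul m k (by lia) le_rfl (by lia) f _).trans ?_
      have := sn_nonneg k (Z l u)
      calc P * sn m f * sn k (Z l u) ≤ P * (1 / (12 * P * C)) * sn k (Z l u) := by gcongr
        _ = _ := by field_simp
    have hi : ∀ i, sn k (Z i u) ≤ C * (sn k (Z i F) + 1 / (6 * C) * Y) := by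
      intro i
      set R : SPoly := (∑ j, Z i (w j) * Z j u) - ∑ j, ∑ l, w j *
        (crossProduct (Pi.single i 1 : Fin 3 → ℝ) (Pi.single j 1) l • Z l u) with hR
      -- As `Z i` commutes with `pr N`, the derivative solves an equation of the same form with the
      -- commutator in the source, so the estimate of order `k` applies to it.
      have he : Z i u = pr N (adv w (Z i u) + (R + Z i F)) := by
        conv_lhs => rw [hF]
        rw [← pr_Z, map_add, Z_adv, add_assoc]
      refine (h N w hw1 _ (Z_mem_Pdeg i hu) _ he).trans ?_
      gcongr
      refine (sn_add_le _ _ _).trans ?_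
      rw [add_comm]
      gcongr
      have e1 : sn k (∑ j, Z i (w j) * Z j u) ≤ 1 / (12 * C) * Y := by
        rw [hY, Finset.mul_sum]
        exact (sn_sum_le _ _ _).trans (Finset.sum_le_sum fun j _ =>
          hprod _ ((sn_Z_le i m (w j)).trans (hwj j)) j)
      have e2 : sn k (∑ j, ∑ l, w j *
          (crossProduct (Pi.single i 1 : Fin 3 → ℝ) (Pi.single j 1) l • Z l u)) ≤
          1 / (12 * C) * Y := by
        have e3 : ∀ j l, sn k (w j *
          (crossProduct (Pi.single i 1 : Fin 3 → ℝ) (Pi.single j 1) l • Z l u)) ≤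
          |crossProduct (Pi.single i 1 : Fin 3 → ℝ) (Pi.single j 1) l| *
            (1 / (12 * C) * sn k (Z l u)) := fun j l => by
          rw [mul_smul_comm, sn_smul]
          gcongr
          exact hprod _ ((sn_le_succ m (w j)).trans (hwj j)) l
        refine (sn_sum_le _ _ _).trans ((Finset.sum_le_sum fun j _ => (sn_sum_le _ _ _).trans
          (Finset.sum_le_sum fun l _ => e3 j l)).trans ?_)
        rw [hY, Finset.mul_sum]
        exact sum_abs_structure_le i _ fun l => mul_nonneg (by positivity) (sn_nonneg _ _)
      refine (sn_sub_le _ _ _).trans ?_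
      calc _ ≤ 1 / (12 * C) * Y + 1 / (12 * C) * Y := add_le_add e1 e2
        _ = 1 / (6 * C) * Y := by field_simp; ring
    have hsum : Y ≤ C * (∑ i, sn k (Z i F)) + 1 / 2 * Y := by
      calc Y ≤ ∑ i, C * (sn k (Z i F) + 1 / (6 * C) * Y) := Finset.sum_le_sum fun i _ => hi i
        _ = C * (∑ i, sn k (Z i F)) + 1 / 2 * Y := by
          rw [← Finset.mul_sum, Finset.sum_add_distrib, Finset.sum_const, Finset.card_univ,
            Fintype.card_fin, nsmul_eq_mul]
          field_simp
          ring
    have h1 := h0' N w hw0 u hu F hF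
    have h2 : 0 ≤ ∑ i, sn k (Z i F) := Finset.sum_nonneg fun i _ => sn_nonneg _ _
    have h3 := mul_nonneg hC.le (norm_nonneg (toL2 F))
    rw [sn_succ, sn_succ]
    nlinarith

/-! ### Simultaneous bounds for pairs of families -/

/-- Two polynomials are bounded by `δ` in the norm of order `k`, and their difference is bounded by
`τ * δ` in the norm of order `k - 2`. -/
structure Bd (k : ℕ) (τ δ : ℝ) (p q : SPoly) : Prop where
  left : sn k p ≤ δ
  right : sn k q ≤ δ
  diff : sn (k - 2) (p - q) ≤ τ * δ

lemma Bd.mono {k : ℕ} {τ τ' δ δ' : ℝ} {p q : SPoly} (h : Bd k τ δ p q) (hδ : δ ≤ δ')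
    (h2 : τ * δ ≤ τ' * δ') : Bd k τ' δ' p q :=
  ⟨h.left.trans hδ, h.right.trans hδ, h.diff.trans h2⟩

lemma Bd.nonneg {k : ℕ} {τ δ : ℝ} {p q : SPoly} (h : Bd k τ δ p q) : 0 ≤ δ :=
  (sn_nonneg k p).trans h.left

lemma Bd.add {k : ℕ} {τ δ δ' : ℝ} {p q p' q' : SPoly} (h : Bd k τ δ p q) (h' : Bd k τ δ' p' q') :
    Bd k τ (δ + δ') (p + p') (q + q') :=
  ⟨(sn_add_le _ _ _).trans (add_le_add h.left h'.left),
    (sn_add_le _ _ _).trans (add_le_add h.right h'.right), by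
    rw [add_sub_add_comm, mul_add]
    exact (sn_add_le _ _ _).trans (add_le_add h.diff h'.diff)⟩

lemma Bd.smul {k : ℕ} {τ δ : ℝ} {p q : SPoly} (h : Bd k τ δ p q) (c : ℝ) :
    Bd k τ (|c| * δ) (c • p) (c • q) := by
  refine ⟨?_, ?_, ?_⟩
  · rw [sn_smul]; exact mul_le_mul_of_nonneg_left h.left (abs_nonneg c)
  · rw [sn_smul]; exact mul_le_mul_of_nonneg_left h.right (abs_nonneg c)
  · rw [← smul_sub, sn_smul, mul_left_comm]
    exact mul_le_mul_of_nonneg_left h.diff (abs_nonneg c)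

/-- Smallness parameters depending on an index. -/
structure Scales (ι : Type) where
  τ : ι → ℝ
  δ : ι → ℝ
  τ_nonneg : ∀ c, 0 ≤ τ c
  δ_nonneg : ∀ c, 0 ≤ δ c
  δ_le : ∀ c, δ c ≤ 1

/-- The families `p` and `q` are of order `δ ^ j`, with a constant independent of the index. -/
def IsO {ι : Type} (s : Scales ι) (k j : ℕ) (p q : ι → SPoly) : Prop :=
  ∃ C : ℝ, 0 ≤ C ∧ ∀ c, Bd k (s.τ c) (C * s.δ c ^ j) (p c) (q c)

namespace IsO

variable {ι : Type} {s : Scales ι} {k j j' : ℕ} {p q p' q' : ι → SPoly}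

lemma add (h : IsO s k j p q) (h' : IsO s k j p' q') :
    IsO s k j (fun c => p c + p' c) (fun c => q c + q' c) := by
  obtain ⟨C, hC, h⟩ := h
  obtain ⟨C', hC', h'⟩ := h'
  exact ⟨C + C', by positivity, fun c => by rw [add_mul]; exact (h c).add (h' c)⟩

lemma smul (a : ℝ) (h : IsO s k j p q) : IsO s k j (fun c => a • p c) (fun c => a • q c) := by
  obtain ⟨C, hC, h⟩ := h
  exact ⟨|a| * C, by positivity, fun c => by rw [mul_assoc]; exact (h c).smul a⟩

lemma neg (h : IsO s k j p q) : IsO s k j (fun c => -p c) (fun c => -q c) := by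
  simpa using h.smul (-1)

lemma sub (h : IsO s k j p q) (h' : IsO s k j p' q') :
    IsO s k j (fun c => p c - p' c) (fun c => q c - q' c) := by
  simpa only [sub_eq_add_neg] using h.add h'.neg

lemma weaken (h : IsO s k j p q) (hj : j' ≤ j) : IsO s k j' p q := by
  obtain ⟨C, hC, h⟩ := h
  refine ⟨C, hC, fun c => ?_⟩
  have h1 : C * s.δ c ^ j ≤ C * s.δ c ^ j' :=
    mul_le_mul_of_nonneg_left (pow_le_pow_of_le_one (s.δ_nonneg c) (s.δ_le c) hj) hC
  exact (h c).mono h1 (mul_le_mul_of_nonneg_left h1 (s.τ_nonneg c))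

lemma lower (h : IsO s (k + 1) j p q) : IsO s k j p q := by
  obtain ⟨C, hC, h⟩ := h
  exact ⟨C, hC, fun c => ⟨(sn_le_succ _ _).trans (h c).left, (sn_le_succ _ _).trans (h c).right,
    (sn_mono (by lia) _).trans (h c).diff⟩⟩

lemma zero : IsO s k j (fun _ => 0) (fun _ => 0) :=
  ⟨0, le_rfl, fun c => by constructor <;> simp⟩

lemma const (f : SPoly) : IsO s k 0 (fun _ => f) (fun _ => f) :=
  ⟨sn k f, sn_nonneg _ _, fun c => by
    refine ⟨by simp, by simp, ?_⟩
    rw [sub_self, sn_zero]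
    exact mul_nonneg (s.τ_nonneg c) (mul_nonneg (sn_nonneg _ _) (pow_nonneg (s.δ_nonneg c) _))⟩

lemma sum {α : Type} [Fintype α] {p q : ι → α → SPoly}
    (h : ∀ l, IsO s k j (fun c => p c l) (fun c => q c l)) :
    IsO s k j (fun c => ∑ l, p c l) (fun c => ∑ l, q c l) := by
  classical
  have : ∀ t : Finset α, IsO s k j (fun c => ∑ l ∈ t, p c l) (fun c => ∑ l ∈ t, q c l) := by
    intro t
    induction t using Finset.induction_on with
    | empty => simpa using zero
    | insert a t ha ih => simpa only [Finset.sum_insert ha] using (h a).add ih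
  exact this _

/-- Both order `k` and order `k - 2` must be closed under multiplication; `k - 2 ≥ 8` is the reason
for `10`. The difference of the products is split as `(p - q) p' + q (p' - q')`. -/
lemma mul (hk : 10 ≤ k) (h : IsO s k j p q) (h' : IsO s k j' p' q') :
    IsO s k (j + j') (fun c => p c * p' c) (fun c => q c * q' c) := by
  obtain ⟨C, hC, h⟩ := h
  obtain ⟨C', hC', h'⟩ := h'
  obtain ⟨P, hP, hmul⟩ := exists_sn_mul_le k
  obtain ⟨R, hR, hmul'⟩ := exists_sn_mul_le (k - 2)
  have hmul := hmul k k le_rfl le_rfl (by lia)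
  have hmul' := hmul' (k - 2) (k - 2) le_rfl le_rfl (by lia)
  refine ⟨(P + 2 * R) * C * C', by positivity, fun c => ?_⟩
  have e : (P + 2 * R) * C * C' * s.δ c ^ (j + j') =
      (P + 2 * R) * (C * s.δ c ^ j) * (C' * s.δ c ^ j') := by rw [pow_add]; ring
  rw [e]
  have h1 := h c
  have h2 := h' c
  have p1 := h1.nonneg
  have p2 := h2.nonneg
  have hτ := s.τ_nonneg c
  generalize C * s.δ c ^ j = A at *
  generalize C' * s.δ c ^ j' = A' at *
  have hle : P * A * A' ≤ (P + 2 * R) * A * A' := by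
    have : 0 ≤ R * A * A' := by positivity
    nlinarith
  have hlow : ∀ f, sn (k - 2) f ≤ sn k f := fun f => sn_mono (by lia) f
  refine ⟨le_trans ((hmul _ _).trans ?_) hle, le_trans ((hmul _ _).trans ?_) hle, ?_⟩
  · have := sn_nonneg k (p' c)
    gcongr
    · exact h1.left
    · exact h2.left
  · have := sn_nonneg k (q' c)
    gcongr
    · exact h1.right
    · exact h2.right
  · have e2 : p c * p' c - q c * q' c = (p c - q c) * p' c + q c * (p' c - q' c) := by ring
    rw [e2]
    have b1 : sn (k - 2) ((p c - q c) * p' c) ≤ R * (s.τ c * A) * A' := by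
      refine (hmul' _ _).trans ?_
      have := sn_nonneg (k - 2) (p' c)
      gcongr
      · exact h1.diff
      · exact (hlow _).trans h2.left
    have b2 : sn (k - 2) (q c * (p' c - q' c)) ≤ R * A * (s.τ c * A') := by
      refine (hmul' _ _).trans ?_
      have := sn_nonneg (k - 2) (p' c - q' c)
      gcongr
      · exact (hlow _).trans h1.right
      · exact h2.diff
    refine (sn_add_le _ _ _).trans ((add_le_add b1 b2).trans ?_)
    have : 0 ≤ s.τ c * (P * A * A') := by positivity
    nlinarith

lemma Z (hk : 2 ≤ k) (i : Fin 3) (h : IsO s (k + 1) j p q) :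
    IsO s k j (fun c => SphereSeed.Z i (p c)) (fun c => SphereSeed.Z i (q c)) := by
  obtain ⟨C, hC, h⟩ := h
  refine ⟨C, hC, fun c => ⟨(sn_Z_le _ _ _).trans (h c).left, (sn_Z_le _ _ _).trans (h c).right, ?_⟩⟩
  rw [← map_sub]
  refine (sn_Z_le _ _ _).trans ?_
  -- Here `2 ≤ k` is needed, the subtraction being truncated.
  rw [show k - 2 + 1 = k + 1 - 2 by lia]
  exact (h c).diff

lemma D (hk : 10 ≤ k) (i : Fin 3) (h : IsO s (k + 1) j p q) :
    IsO s k j (fun c => SphereSeed.D i (p c)) (fun c => SphereSeed.D i (q c)) := by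
  simp only [D_apply]
  refine sum fun l => ?_
  simpa using (const (rotX l i)).mul hk (h.Z (by lia) l)

end IsO

/-! ### The terms of the constraint equation for polynomial data -/

/-- `x × b`, the components of `b` in the frame of rotations. -/
def frame (b : Fin 3 → SPoly) : Fin 3 → SPoly :=
  ![X 1 * b 2 - X 2 * b 1, X 2 * b 0 - X 0 * b 2, X 0 * b 1 - X 1 * b 0]

/-- The metric with deviation `h` from the round metric. -/
def gE (h : Fin 3 → Fin 3 → SPoly) (i j : Fin 3) : SPoly :=
  (if i = j then 1 else 0) - X i * X j + h i j

/-- The determinant of `1 + h`, minus `1`. -/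
def uE (h : Fin 3 → Fin 3 → SPoly) : SPoly :=
  (h 0 0 + h 1 1 + h 2 2) + ((h 0 0 * h 1 1 - h 0 1 * h 1 0) + (h 0 0 * h 2 2 - h 0 2 * h 2 0) +
    (h 1 1 * h 2 2 - h 1 2 * h 2 1) + (h 0 0 * (h 1 1 * h 2 2 - h 1 2 * h 2 1) -
    h 0 1 * (h 1 0 * h 2 2 - h 1 2 * h 2 0) + h 0 2 * (h 1 0 * h 2 1 - h 1 1 * h 2 0)))

/-- The adjugate of a `3 × 3` matrix. -/
def adj3 {R : Type*} [CommRing R] (g : Fin 3 → Fin 3 → R) (i j : Fin 3) : R :=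
  g (j + 1) (i + 1) * g (j + 2) (i + 2) - g (j + 1) (i + 2) * g (j + 2) (i + 1)

/-- The inverse metric; `1 + v` stands for the inverse of the density. -/
def invE (h : Fin 3 → Fin 3 → SPoly) (v : SPoly) (i j : Fin 3) : SPoly :=
  adj3 (fun i j => (if i = j then 1 else 0) + h i j) i j * ((1 + v) * (1 + v)) - X i * X j

/-- The covariant derivative. -/
def covE (h : Fin 3 → Fin 3 → SPoly) (b : Fin 3 → SPoly) (i j : Fin 3) : SPoly :=
  (∑ l, gE h j l * D i (b l)) + (1 / 2 : ℝ) • ∑ l, b l *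
    (D i (gE h l j) + D l (gE h i j) - D j (gE h i l))

/-- The derivative of the logarithm of the density along `b`. -/
def logE (h : Fin 3 → Fin 3 → SPoly) (v : SPoly) (b : Fin 3 → SPoly) : SPoly :=
  (1 / 2 : ℝ) • (((1 + v) * (1 + v)) * adv (frame b) (uE h))

/-- The divergence. -/
def divE (h : Fin 3 → Fin 3 → SPoly) (v : SPoly) (b : Fin 3 → SPoly) : SPoly :=
  (∑ k, D k (b k)) + logE h v b

/-- The trace-free symmetrized covariant derivative. -/
def hatE (h : Fin 3 → Fin 3 → SPoly) (v : SPoly) (b : Fin 3 → SPoly) (i j : Fin 3) : SPoly :=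
  covE h b i j + covE h b j i - divE h v b * gE h i j

/-- The square norm of the trace-free symmetrized covariant derivative. -/
def hatSqE (h : Fin 3 → Fin 3 → SPoly) (v : SPoly) (b : Fin 3 → SPoly) : SPoly :=
  ∑ i, ∑ j, ∑ k, ∑ l, invE h v i k * invE h v j l * hatE h v b i j * hatE h v b k l

/-- The quadratic part of the source term of the transport equation. -/
def quadE (h : Fin 3 → Fin 3 → SPoly) (W v : SPoly) (b : Fin 3 → SPoly) (a : ℝ) : SPoly :=
  (1 / 2 : ℝ) • (divE h v b * divE h v b) + (4 : ℝ) • ((W + algebraMap ℝ SPoly a) * divE h v b) +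
    (1 / 4 : ℝ) • hatSqE h v b

/-- The lowered vector field of the deviation of the metric has curl `curlE h b`. -/
def curlE (h : Fin 3 → Fin 3 → SPoly) (b : Fin 3 → SPoly) : SPoly :=
  ∑ j, Z j (∑ l, h j l * b l)

section

variable {ι : Type} {s : Scales ι} {k : ℕ} {h h' : ι → Fin 3 → Fin 3 → SPoly} {v v' W W' : ι → SPoly}
  {b b' : ι → Fin 3 → SPoly} {a a' : ι → ℝ}

lemma isO_frame {k : ℕ} (hk : 10 ≤ k) (hb : ∀ i, IsO s k 1 (fun c => b c i) (fun c => b' c i))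
    (i : Fin 3) : IsO s k 1 (fun c => frame (b c) i) (fun c => frame (b' c) i) := by
  have key : ∀ i j l m, IsO s k 1 (fun c => X i * b c j - X l * b c m)
      (fun c => X i * b' c j - X l * b' c m) := fun i j l m => by
    simpa using ((IsO.const (X i)).mul hk (hb j)).sub ((IsO.const (X l)).mul hk (hb m))
  fin_cases i
  · exact key 1 2 2 1
  · exact key 2 0 0 2
  · exact key 0 1 1 0

lemma isO_gE (hh : ∀ i j, IsO s k 1 (fun c => h c i j) (fun c => h' c i j)) (i j : Fin 3) :
    IsO s k 0 (fun c => gE (h c) i j) (fun c => gE (h' c) i j) :=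
  (IsO.const _).add ((hh i j).weaken zero_le_one)

/-- The trace is linear in the metric deviation, of size `η`; only the remainder is quadratic. This
separation allows the bound `η + δ²` for the updated inverse density. -/
lemma isO_uE_sub (hk : 10 ≤ k) (hh : ∀ i j, IsO s k 1 (fun c => h c i j) (fun c => h' c i j)) :
    IsO s k 2 (fun c => uE (h c) - (h c 0 0 + h c 1 1 + h c 2 2))
      (fun c => uE (h' c) - (h' c 0 0 + h' c 1 1 + h' c 2 2)) := by
  simp only [uE, add_sub_cancel_left]
  have h2 : ∀ i j l m, IsO s k 2 (fun c => h c i j * h c l m) (fun c => h' c i j * h' c l m) :=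
    fun i j l m => (hh i j).mul hk (hh l m)
  have h3 : ∀ o n i j l m i' j' l' m', IsO s k 2
      (fun c => h c o n * (h c i j * h c l m - h c i' j' * h c l' m'))
      (fun c => h' c o n * (h' c i j * h' c l m - h' c i' j' * h' c l' m')) :=
    fun o n i j l m i' j' l' m' =>
      ((hh o n).mul hk ((h2 i j l m).sub (h2 i' j' l' m'))).weaken (by norm_num)
  exact (((h2 _ _ _ _).sub (h2 _ _ _ _)).add ((h2 _ _ _ _).sub (h2 _ _ _ _))).add
    ((h2 _ _ _ _).sub (h2 _ _ _ _)) |>.add (((h3 _ _ _ _ _ _ _ _ _ _).sub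
    (h3 _ _ _ _ _ _ _ _ _ _)).add (h3 _ _ _ _ _ _ _ _ _ _))

lemma isO_uE (hk : 10 ≤ k) (hh : ∀ i j, IsO s k 1 (fun c => h c i j) (fun c => h' c i j)) :
    IsO s k 1 (fun c => uE (h c)) (fun c => uE (h' c)) := by
  have := (((hh 0 0).add (hh 1 1)).add (hh 2 2)).add ((isO_uE_sub hk hh).weaken one_le_two)
  simpa using this

lemma isO_invE (hk : 10 ≤ k) (hh : ∀ i j, IsO s k 1 (fun c => h c i j) (fun c => h' c i j))
    (hv : IsO s k 1 v v') (i j : Fin 3) :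
    IsO s k 0 (fun c => invE (h c) (v c) i j) (fun c => invE (h' c) (v' c) i j) := by
  have hg : ∀ i j : Fin 3, IsO s k 0 (fun c => (if i = j then 1 else 0) + h c i j)
      (fun c => (if i = j then 1 else 0) + h' c i j) := fun i j =>
    (IsO.const _).add ((hh i j).weaken zero_le_one)
  have hv' : IsO s k 0 (fun c => 1 + v c) (fun c => 1 + v' c) :=
    (IsO.const 1).add (hv.weaken zero_le_one)
  unfold invE adj3
  exact ((((hg _ _).mul hk (hg _ _)).sub ((hg _ _).mul hk (hg _ _))).mul hk (hv'.mul hk hv')).sub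
    (IsO.const _)

lemma isO_covE (hk : 10 ≤ k) (hh : ∀ i j, IsO s (k + 1) 1 (fun c => h c i j) (fun c => h' c i j))
    (hb : ∀ i, IsO s (k + 1) 1 (fun c => b c i) (fun c => b' c i)) (i j : Fin 3) :
    IsO s k 1 (fun c => covE (h c) (b c) i j) (fun c => covE (h' c) (b' c) i j) := by
  have hg := isO_gE hh
  unfold covE
  refine (IsO.sum fun l => ?_).add ((IsO.sum fun l => ?_).smul _)
  · simpa using (hg j l).lower.mul hk ((hb l).D hk i)
  · simpa using (hb l).lower.mul hk ((((hg l j).D hk i).add ((hg i j).D hk l)).sub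
      ((hg i l).D hk j))

lemma isO_adv (hk : 10 ≤ k) {w w' : ι → Fin 3 → SPoly} {u u' : ι → SPoly} {j : ℕ}
    (hw : ∀ i, IsO s k 1 (fun c => w c i) (fun c => w' c i)) (hu : IsO s (k + 1) j u u') :
    IsO s k (1 + j) (fun c => adv (w c) (u c)) (fun c => adv (w' c) (u' c)) :=
  IsO.sum fun l => (hw l).mul hk (hu.Z (by lia) l)

/-- Quadratic because every term pairs a component of `b` with a derivative of `uE h`. -/
lemma isO_logE (hk : 10 ≤ k) (hh : ∀ i j, IsO s (k + 1) 1 (fun c => h c i j) (fun c => h' c i j))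
    (hv : IsO s k 1 v v') (hb : ∀ i, IsO s (k + 1) 1 (fun c => b c i) (fun c => b' c i)) :
    IsO s k 2 (fun c => logE (h c) (v c) (b c)) (fun c => logE (h' c) (v' c) (b' c)) := by
  have hv' : IsO s k 0 (fun c => 1 + v c) (fun c => 1 + v' c) :=
    (IsO.const 1).add (hv.weaken zero_le_one)
  unfold logE
  refine IsO.smul _ ?_
  simpa using (hv'.mul hk hv').mul hk (isO_adv hk (isO_frame hk fun i => (hb i).lower)
    (isO_uE (by lia) hh))

lemma isO_divE (hk : 10 ≤ k) (hh : ∀ i j, IsO s (k + 1) 1 (fun c => h c i j) (fun c => h' c i j))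
    (hv : IsO s k 1 v v') (hb : ∀ i, IsO s (k + 1) 1 (fun c => b c i) (fun c => b' c i)) :
    IsO s k 1 (fun c => divE (h c) (v c) (b c)) (fun c => divE (h' c) (v' c) (b' c)) :=
  (IsO.sum fun l => (hb l).D hk l).add ((isO_logE hk hh hv hb).weaken one_le_two)

lemma isO_hatE (hk : 10 ≤ k) (hh : ∀ i j, IsO s (k + 1) 1 (fun c => h c i j) (fun c => h' c i j))
    (hv : IsO s k 1 v v') (hb : ∀ i, IsO s (k + 1) 1 (fun c => b c i) (fun c => b' c i))
    (i j : Fin 3) :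
    IsO s k 1 (fun c => hatE (h c) (v c) (b c) i j) (fun c => hatE (h' c) (v' c) (b' c) i j) :=
  ((isO_covE hk hh hb i j).add (isO_covE hk hh hb j i)).sub
    ((isO_divE hk hh hv hb).mul hk (isO_gE hh i j).lower)

lemma isO_hatSqE (hk : 10 ≤ k) (hh : ∀ i j, IsO s (k + 1) 1 (fun c => h c i j) (fun c => h' c i j))
    (hv : IsO s k 1 v v') (hb : ∀ i, IsO s (k + 1) 1 (fun c => b c i) (fun c => b' c i)) :
    IsO s k 2 (fun c => hatSqE (h c) (v c) (b c)) (fun c => hatSqE (h' c) (v' c) (b' c)) := by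
  have hi := isO_invE hk (fun i j => (hh i j).lower) hv
  have hH := isO_hatE hk hh hv hb
  refine IsO.sum fun i => IsO.sum fun j => IsO.sum fun m => IsO.sum fun l => ?_
  exact ((((hi i m).mul hk (hi j l)).mul hk (hH i j)).mul hk (hH m l))

lemma isO_algebraMap {k : ℕ} (ha : ∀ c, |a c| ≤ s.δ c) (ha' : ∀ c, |a' c| ≤ s.δ c)
    (hd : ∀ c, |a c - a' c| ≤ s.τ c * s.δ c) :
    IsO s k 1 (fun c => algebraMap ℝ SPoly (a c)) (fun c => algebraMap ℝ SPoly (a' c)) := by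
  have e : ∀ (k : ℕ) (r : ℝ), sn k (algebraMap ℝ SPoly r) = sn k (1 : SPoly) * |r| := fun k r => by
    rw [Algebra.algebraMap_eq_smul_one, sn_smul, mul_comm]
  refine ⟨sn k (1 : SPoly), sn_nonneg _ _, fun c => ⟨?_, ?_, ?_⟩⟩
  · rw [e, pow_one]; exact mul_le_mul_of_nonneg_left (ha c) (sn_nonneg _ _)
  · rw [e, pow_one]; exact mul_le_mul_of_nonneg_left (ha' c) (sn_nonneg _ _)
  · rw [← map_sub, e, pow_one, mul_left_comm]
    have := sn_nonneg k (1 : SPoly)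
    have h1 := mul_nonneg (s.τ_nonneg c) (s.δ_nonneg c)
    exact mul_le_mul (sn_mono (by lia) _) (hd c) (abs_nonneg _) this

lemma isO_quadE (hk : 10 ≤ k) (hh : ∀ i j, IsO s (k + 1) 1 (fun c => h c i j) (fun c => h' c i j))
    (hW : IsO s k 1 W W')
    (hv : IsO s k 1 v v') (hb : ∀ i, IsO s (k + 1) 1 (fun c => b c i) (fun c => b' c i))
    (ha : IsO s k 1 (fun c => algebraMap ℝ SPoly (a c)) (fun c => algebraMap ℝ SPoly (a' c))) :
    IsO s k 2 (fun c => quadE (h c) (W c) (v c) (b c) (a c))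
      (fun c => quadE (h' c) (W' c) (v' c) (b' c) (a' c)) := by
  have hd := isO_divE hk hh hv hb
  exact (((hd.mul hk hd).smul _).add (((hW.add ha).mul hk hd).smul _)).add
    ((isO_hatSqE hk hh hv hb).smul _)

lemma isO_curlE (hk : 10 ≤ k) (hh : ∀ i j, IsO s (k + 1) 1 (fun c => h c i j) (fun c => h' c i j))
    (hb : ∀ i, IsO s (k + 1) 1 (fun c => b c i) (fun c => b' c i)) :
    IsO s k 2 (fun c => curlE (h c) (b c)) (fun c => curlE (h' c) (b' c)) :=
  IsO.sum fun j => (IsO.sum fun l => (hh j l).mul (by lia) (hb l)).Z (by lia) j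

end

/-! ### The iteration -/

/-- Polynomial data: the deviation of the metric, the curl and the inhomogeneity. -/
structure SData where
  h : Fin 3 → Fin 3 → SPoly
  O : SPoly
  W : SPoly

/-- Polynomial approximation of the solution: the vector field, the inverse density minus `1`,
and the constant. -/
structure SState where
  b : Fin 3 → SPoly
  v : SPoly
  a : ℝ

/-- The inhomogeneity of the transport equation. -/
def srcE (d : SData) (s : SState) : SPoly := (-8 : ℝ) • d.W + quadE d.h d.W s.v s.b s.a

/-- The prescribed curl with respect to the round metric. -/
def curlRhs (d : SData) (s : SState) : SPoly :=
  (1 + uE d.h) * (1 + s.v) * d.O - curlE d.h s.b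

/-- The prescribed divergence with respect to the round metric. -/
def divRhs (d : SData) (s : SState) (f : SPoly) : SPoly := f - logE d.h s.v s.b

/-- The update of the inverse density. -/
def vRhs (d : SData) (s : SState) : SPoly :=
  (-(1 / 2) : ℝ) • (uE d.h + ((2 : ℝ) • (uE d.h * s.v) + s.v * s.v + uE d.h * s.v * s.v))

/-- The part with vanishing mean. -/
def meanFree (f : SPoly) : SPoly := f - algebraMap ℝ SPoly (mean f)

/-- One step of the iteration, from `s` to `t`, where `f` solves the transport equation. -/
structure Step (N : ℕ) (d : SData) (s : SState) (f : SPoly) (t : SState) : Prop where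
  f_mem : f ∈ Pdeg N
  f_eq : f = pr N (adv (frame s.b) f + srcE d s)
  b_eq : ∃ φ ψ, sInt φ = 0 ∧ sInt ψ = 0 ∧ Lap φ = meanFree (divRhs d s f) ∧
    Lap ψ = meanFree (curlRhs d s) ∧ t.b = hodge φ ψ
  v_eq : t.v = vRhs d s
  a_eq : t.a = mean (divRhs d s f) / 8

/-! ### Bounds for means, mean-free parts and Hodge fields -/

lemma mean_sub (f g : SPoly) : mean (f - g) = mean f - mean g := by
  simp [mean, sub_div]

lemma exists_abs_mean_le : ∃ C : ℝ, 0 < C ∧ ∀ (k : ℕ) f, |mean f| ≤ C * sn k f := by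
  refine ⟨‖toL2 1‖ / totalArea + 1, add_pos_of_nonneg_of_pos
    (div_nonneg (norm_nonneg _) totalArea_pos.le) one_pos, fun k f => ?_⟩
  have hA := totalArea_pos
  have h := abs_sInt_mul_le 1 f
  rw [one_mul] at h
  have h2 := norm_le_sn k f
  rw [mean, abs_div, abs_of_pos hA]
  calc |sInt f| / totalArea ≤ ‖toL2 1‖ * sn k f / totalArea := by
        gcongr; exact h.trans (by gcongr)
    _ = ‖toL2 1‖ / totalArea * sn k f := by ring
    _ ≤ _ := by
        have := sn_nonneg k f
        gcongr
        linarith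

lemma exists_sn_meanFree_le (k : ℕ) : ∃ C : ℝ, 0 < C ∧ ∀ f, sn k (meanFree f) ≤ C * sn k f := by
  obtain ⟨C, hC, h⟩ := exists_abs_mean_le
  refine ⟨1 + sn k 1 * C, add_pos_of_pos_of_nonneg one_pos (mul_nonneg (sn_nonneg _ _) hC.le),
    fun f => (sn_sub_le _ _ _).trans ?_⟩
  rw [Algebra.algebraMap_eq_smul_one, sn_smul]
  have h1 := mul_le_mul_of_nonneg_right (h k f) (sn_nonneg k 1)
  linarith

lemma meanFree_sub (f g : SPoly) : meanFree (f - g) = meanFree f - meanFree g := by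
  simp only [meanFree, mean_sub, map_sub]; ring

lemma hodge_sub (φ ψ φ' ψ' : SPoly) (i : Fin 3) :
    hodge (φ - φ') (ψ - ψ') i = hodge φ ψ i - hodge φ' ψ' i := by
  fin_cases i <;> simp [hodge] <;> ring

lemma exists_bd_meanFree (k : ℕ) : ∃ C : ℝ, 0 < C ∧ ∀ τ δ p q, 0 ≤ τ → Bd k τ δ p q →
    Bd k τ (C * δ) (meanFree p) (meanFree q) := by
  obtain ⟨C, hC, h⟩ := exists_sn_meanFree_le k
  obtain ⟨C', hC', h'⟩ := exists_sn_meanFree_le (k - 2)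
  refine ⟨C + C', by positivity, fun τ δ p q hτ hb => ?_⟩
  have hδ := hb.nonneg
  have h1 : ∀ f, sn k f ≤ δ → sn k (meanFree f) ≤ (C + C') * δ := fun f hf =>
    (h f).trans (mul_le_mul (by linarith) hf (sn_nonneg _ _) (by positivity))
  refine ⟨h1 p hb.left, h1 q hb.right, ?_⟩
  rw [← meanFree_sub]
  refine (h' _).trans ?_
  have := mul_le_mul_of_nonneg_left hb.diff hC'.le
  have h2 : 0 ≤ C * (τ * δ) := by positivity
  linarith

lemma exists_bd_hodge (k : ℕ) (hk : 2 ≤ k) : ∃ C : ℝ, 0 < C ∧ ∀ τ δ φ ψ φ' ψ', 0 ≤ τ →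
    sInt φ = 0 → sInt ψ = 0 → sInt φ' = 0 → sInt ψ' = 0 → Bd k τ δ (Lap φ) (Lap φ') →
    Bd k τ δ (Lap ψ) (Lap ψ') → ∀ i, Bd (k + 1) τ (C * δ) (hodge φ ψ i) (hodge φ' ψ' i) := by
  obtain ⟨C, hC, h⟩ := exists_sn_hodge_le k
  obtain ⟨C', hC', h'⟩ := exists_sn_hodge_le (k - 2)
  refine ⟨2 * C + 2 * C', by positivity, fun τ δ φ ψ φ' ψ' hτ h1 h2 h3 h4 hb hb' i => ?_⟩
  have hδ := hb.nonneg
  have hCδ : 0 ≤ C * δ := by positivity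
  have hCδ' : 0 ≤ C' * δ := by positivity
  refine ⟨(h φ ψ h1 h2 i).trans ?_, (h φ' ψ' h3 h4 i).trans ?_, ?_⟩
  · have := mul_le_mul_of_nonneg_left (add_le_add hb.left hb'.left) hC.le
    linarith
  · have := mul_le_mul_of_nonneg_left (add_le_add hb.right hb'.right) hC.le
    linarith
  · rw [← hodge_sub, show k + 1 - 2 = k - 2 + 1 by lia]
    refine (h' _ _ (by rw [map_sub, h1, h3, sub_zero]) (by rw [map_sub, h2, h4, sub_zero]) i).trans
      ?_
    rw [map_sub, map_sub]
    have := mul_le_mul_of_nonneg_left (add_le_add hb.diff hb'.diff) hC'.le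
    have h5 : 0 ≤ τ * (C * δ) := by positivity
    nlinarith

/-- The input and output of two steps of the iteration. -/
structure Cfg where
  τ : ℝ
  η : ℝ
  δ : ℝ
  N : ℕ
  N' : ℕ
  d : SData
  d' : SData
  s : SState
  s' : SState
  t : SState
  t' : SState
  f : SPoly
  f' : SPoly

/-- Bounds for a pair of states. -/
structure SBd (k : ℕ) (τ δ : ℝ) (s s' : SState) : Prop where
  b : ∀ i, Bd (k + 1) τ δ (s.b i) (s'.b i)
  v : Bd k τ δ s.v s'.v
  a : |s.a| ≤ δ
  a' : |s'.a| ≤ δ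
  a_sub : |s.a - s'.a| ≤ τ * δ

/-- Bounds for a pair of data. -/
structure DBd (k : ℕ) (τ η : ℝ) (d d' : SData) : Prop where
  h : ∀ i j, Bd (k + 1) τ η (d.h i j) (d'.h i j)
  O : Bd k τ η d.O d'.O
  W : Bd k τ η d.W d'.W

/-- The hypotheses on the input of two steps of the iteration. -/
structure Cfg.Valid (k : ℕ) (c : Cfg) : Prop where
  τ_nonneg : 0 ≤ c.τ
  η_nonneg : 0 ≤ c.η
  η_le : c.η ≤ c.δ
  δ_le : c.δ ≤ 1
  d : DBd k c.τ c.η c.d c.d'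
  s : SBd k (2 * c.τ) c.δ c.s c.s'
  N_le : c.N ≤ c.N'
  N_inv : 1 / ((c.N : ℝ) + 1) ≤ c.τ
  step : Step c.N c.d c.s c.f c.t
  step' : Step c.N' c.d' c.s' c.f' c.t'

/-! ### Estimates for one step of the iteration -/

lemma Bd.half {k : ℕ} {τ δ : ℝ} {p q : SPoly} (h : Bd k (2 * τ) δ p q) :
    Bd k τ (2 * δ) p q :=
  h.mono (by linarith [h.nonneg]) (by linarith)

/-- Differences of the input are measured by `2 τ`, those of the output by `τ`; the spare factor `2`
moves into the constant of a quadratically small quantity. This halving makes the iteration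
converge. -/
lemma Bd.of_isO {k : ℕ} {τ δ : ℝ} {p q : SPoly} {C B : ℝ} (h : Bd k (2 * τ) (C * δ ^ 2) p q)
    (hτ : 0 ≤ τ) (hC : 0 ≤ C) (hB : δ ^ 2 ≤ B) : Bd k τ (2 * C * B) p q := by
  have h1 : C * δ ^ 2 ≤ C * B := mul_le_mul_of_nonneg_left hB hC
  have h2 := h.half
  exact h2.mono (by linarith) (mul_le_mul_of_nonneg_left (by linarith) hτ)

/-- The difference `f' - f` solves the equation of level `N'` with velocity `w'` and a source `R`
made of the change of velocity acting on `f`, the change of source, and the truncation defect `G -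
pr N G`. As `G` contains `Z f` it has order `k - 1`, and the factor `1 / (N + 1)` costs one more
derivative, whence the order `k - 2`. -/
theorem exists_transport_diff (k : ℕ) (hk : 10 ≤ k) : ∃ δ₀ C : ℝ, 0 < δ₀ ∧ 0 < C ∧
    ∀ (τ A B : ℝ) (N N' : ℕ) (w w' : Fin 3 → SPoly) (S S' f f' : SPoly), 0 ≤ τ → A ≤ δ₀ →
      (∀ i, Bd (k + 1) (2 * τ) A (w i) (w' i)) → Bd k τ B S S' → N ≤ N' →
      1 / ((N : ℝ) + 1) ≤ τ → f ∈ Pdeg N → f' ∈ Pdeg N' → f = pr N (adv w f + S) →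
      f' = pr N' (adv w' f' + S') → Bd k τ (C * B) f f' := by
  obtain ⟨δ₁, hδ₁, C₁, hC₁, h1⟩ := exists_transport_estimate k (by lia) k le_rfl
  obtain ⟨δ₂, hδ₂, C₂, hC₂, h2⟩ := exists_transport_estimate k (by lia) (k - 2) (by lia)
  obtain ⟨P₁, hP₁, hm1⟩ := exists_sn_mul_le (k - 1)
  obtain ⟨P₂, hP₂, hm2⟩ := exists_sn_mul_le (k - 2)
  have hm1 := hm1 (k - 1) (k - 1) le_rfl le_rfl (by lia)
  have hm2 := hm2 (k - 2) (k - 2) le_rfl le_rfl (by lia)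
  -- The summands bound the three parts of `R` in turn: velocity, source and truncation.
  set E : ℝ := 6 * P₂ * C₁ + 1 + k * (3 * P₁ * C₁ + 1) with hE
  have hEpos : 0 < E := by positivity
  refine ⟨min (min (δ₁ / 3) (δ₂ / 3)) 1, C₁ + C₂ * E, by positivity, by positivity, ?_⟩
  intro τ A B N N' w w' S S' f f' hτ hA hw hS hN hNτ hf hf' hfe hfe'
  have hB := hS.nonneg
  have hA0 := (hw 0).nonneg
  have hA1 : A ≤ 1 := hA.trans (min_le_right _ _)
  have hsum : ∀ w : Fin 3 → SPoly, (∀ i, sn (k + 1) (w i) ≤ A) →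
      ∑ i, sn (k + 1) (w i) ≤ 3 * A := fun w hw => by
    rw [Fin.sum_univ_three]; linarith [hw 0, hw 1, hw 2]
  have hA3 : 3 * A ≤ δ₁ := by
    have := hA.trans ((min_le_left _ _).trans (min_le_left _ _)); linarith
  have hA4 : 3 * A ≤ δ₂ := by
    have := hA.trans ((min_le_left _ _).trans (min_le_right _ _)); linarith
  have hfB : sn k f ≤ C₁ * B :=
    (h1 N w ((hsum w fun i => (hw i).left).trans hA3) f hf S hfe).trans (by gcongr; exact hS.left)
  have hfB' : sn k f' ≤ C₁ * B :=
    (h1 N' w' ((hsum w' fun i => (hw i).right).trans hA3) f' hf' S' hfe').trans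
      (by gcongr; exact hS.right)
  have hle : C₁ * B ≤ (C₁ + C₂ * E) * B := by gcongr; linarith [mul_pos hC₂ hEpos]
  refine ⟨hfB.trans hle, hfB'.trans hle, ?_⟩
  set G := adv w f + S with hG
  set R := (adv w' f - adv w f) + (S' - S) + (G - pr N G) with hR
  -- `f = pr N G` already lies in `Pdeg N'`, so `pr N'` fixes it.
  have hdf : f' - f = pr N' (adv w' (f' - f) + R) := by
    have e1 : adv w' (f' - f) + R = (adv w' f' + S') - pr N G := by
      rw [adv_sub, hR, hG]; ring
    rw [e1, map_sub, ← hfe', pr_of_mem (Pdeg_mono hN (pr_mem N G)), ← hfe]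
  have hdfm : f' - f ∈ Pdeg N' := sub_mem hf' (Pdeg_mono hN hf)
  have h3 := h2 N' w' ((hsum w' fun i => (hw i).right).trans hA4) _ hdfm R hdf
  have hZ : ∀ i, sn (k - 1) (Z i f) ≤ C₁ * B := fun i => by
    refine (sn_Z_le i (k - 1) f).trans ?_
    rwa [show k - 1 + 1 = k by lia]
  have r1 : sn (k - 2) (adv w' f - adv w f) ≤ 6 * P₂ * C₁ * (τ * B) := by
    have e : adv w' f - adv w f = ∑ i, (w' i - w i) * Z i f := by
      simp only [adv, ← Finset.sum_sub_distrib, sub_mul]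
    rw [e]
    refine (sn_sum_le _ _ _).trans ?_
    have hi : ∀ i, sn (k - 2) ((w' i - w i) * Z i f) ≤ P₂ * (2 * τ * 1) * (C₁ * B) := fun i => by
      refine (hm2 _ _).trans ?_
      have := sn_nonneg (k - 2) (Z i f)
      gcongr
      · rw [sn_sub_comm]
        exact (sn_mono (by lia) _).trans ((hw i).diff.trans (by gcongr))
      · exact (sn_mono (by lia) _).trans (hZ i)
    rw [Fin.sum_univ_three]
    linarith [hi 0, hi 1, hi 2]
  have r2 : sn (k - 2) (S' - S) ≤ τ * B := by rw [sn_sub_comm]; exact hS.diff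
  have r3 : sn (k - 2) (G - pr N G) ≤ k * (3 * P₁ * C₁ + 1) * (τ * B) := by
    have hGn : sn (k - 1) G ≤ (3 * P₁ * C₁ + 1) * B := by
      have g1 : sn (k - 1) (adv w f) ≤ 3 * P₁ * C₁ * B := by
        refine (sn_sum_le _ _ _).trans ?_
        have hi : ∀ i, sn (k - 1) (w i * Z i f) ≤ P₁ * 1 * (C₁ * B) := fun i => by
          refine (hm1 _ _).trans ?_
          have := sn_nonneg (k - 1) (Z i f)
          gcongr
          · exact (sn_mono (by lia) _).trans ((hw i).left.trans hA1)
          · exact hZ i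
        rw [Fin.sum_univ_three]
        linarith [hi 0, hi 1, hi 2]
      have g2 : sn (k - 1) S ≤ B := (sn_mono (by lia) _).trans hS.left
      have := sn_add_le (k - 1) (adv w f) S
      linarith
    have hp := sn_sub_pr_le N (k - 2) G
    rw [show k - 2 + 1 = k - 1 by lia] at hp
    have hk2 : (((k - 2 : ℕ) : ℝ) + 1) ≤ k := by
      have : ((k - 2 : ℕ) : ℝ) + 1 = ((k - 2 + 1 : ℕ) : ℝ) := by push_cast; ring
      rw [this]
      exact_mod_cast (by lia : k - 2 + 1 ≤ k)
    have hN0 : (0 : ℝ) < (N : ℝ) + 1 := by positivity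
    calc sn (k - 2) (G - pr N G) = 1 / ((N : ℝ) + 1) * (((N : ℝ) + 1) * sn (k - 2) (G - pr N G)) := by
          field_simp
      _ ≤ τ * (k * ((3 * P₁ * C₁ + 1) * B)) :=
          mul_le_mul hNτ (hp.trans (mul_le_mul hk2 hGn (sn_nonneg _ _) (Nat.cast_nonneg _)))
            (mul_nonneg hN0.le (sn_nonneg _ _)) hτ
      _ = _ := by ring
  have r4 : sn (k - 2) R ≤ E * (τ * B) := by
    have a1 := sn_add_le (k - 2) (adv w' f - adv w f + (S' - S)) (G - pr N G)
    have a2 := sn_add_le (k - 2) (adv w' f - adv w f) (S' - S)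
    rw [hE]
    linarith
  rw [sn_sub_comm]
  refine h3.trans ?_
  have h5 := mul_le_mul_of_nonneg_left r4 hC₂.le
  have h6 : 0 ≤ C₁ * (τ * B) := by positivity
  linarith

lemma Bd.self {k : ℕ} {τ δ : ℝ} {p : SPoly} (hτ : 0 ≤ τ) (h : sn k p ≤ δ) : Bd k τ δ p p :=
  ⟨h, h, by rw [sub_self, sn_zero]; exact mul_nonneg hτ ((sn_nonneg k p).trans h)⟩

lemma exists_bd_mean (k : ℕ) : ∃ C : ℝ, 0 < C ∧ ∀ τ δ p q, Bd k τ δ p q →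
    |mean p| ≤ C * δ ∧ |mean q| ≤ C * δ ∧ |mean p - mean q| ≤ C * (τ * δ) := by
  obtain ⟨C, hC, h⟩ := exists_abs_mean_le
  refine ⟨C, hC, fun τ δ p q hb => ⟨(h k p).trans (by gcongr; exact hb.left),
    (h k q).trans (by gcongr; exact hb.right), ?_⟩⟩
  rw [← mean_sub]
  exact (h (k - 2) _).trans (by gcongr; exact hb.diff)

/-- The constants may depend only on `k`. The calculus of `IsO` is therefore applied once, to the
family indexed by all valid configurations, where its constants are uniform in the index. -/
theorem exists_expr_bound (k : ℕ) (hk : 10 ≤ k) : ∃ Cw Cq Cl Cv Cc : ℝ, 0 ≤ Cw ∧ 0 ≤ Cq ∧ 0 ≤ Cl ∧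
    0 ≤ Cv ∧ 0 ≤ Cc ∧ ∀ c : Cfg, c.Valid k →
      (∀ i, Bd (k + 1) (2 * c.τ) (Cw * c.δ) (frame c.s.b i) (frame c.s'.b i)) ∧
      Bd k (2 * c.τ) (Cq * c.δ ^ 2) (quadE c.d.h c.d.W c.s.v c.s.b c.s.a)
        (quadE c.d'.h c.d'.W c.s'.v c.s'.b c.s'.a) ∧
      Bd k (2 * c.τ) (Cl * c.δ ^ 2) (logE c.d.h c.s.v c.s.b) (logE c.d'.h c.s'.v c.s'.b) ∧
      Bd k (2 * c.τ) (Cv * c.δ ^ 2)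
        (vRhs c.d c.s + (1 / 2 : ℝ) • (c.d.h 0 0 + c.d.h 1 1 + c.d.h 2 2))
        (vRhs c.d' c.s' + (1 / 2 : ℝ) • (c.d'.h 0 0 + c.d'.h 1 1 + c.d'.h 2 2)) ∧
      Bd k (2 * c.τ) (Cc * c.δ ^ 2) (curlRhs c.d c.s - c.d.O) (curlRhs c.d' c.s' - c.d'.O) := by
  let ι : Type := {c : Cfg // c.Valid k}
  let s : Scales ι := ⟨fun c => 2 * c.1.τ, fun c => c.1.δ,
    fun c => mul_nonneg zero_le_two c.2.τ_nonneg, fun c => c.2.η_nonneg.trans c.2.η_le,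
    fun c => c.2.δ_le⟩
  have hdata : ∀ (l : ℕ) (c : ι) (p q : SPoly), Bd l c.1.τ c.1.η p q →
      Bd l (s.τ c) (1 * s.δ c ^ 1) p q := by
    intro l c p q h
    have h1 := c.2.η_le
    have h2 := c.2.τ_nonneg
    have h3 := c.2.η_nonneg
    refine h.mono (by simpa [s] using h1) ?_
    simp only [s]
    nlinarith [mul_nonneg h2 h3, mul_le_mul_of_nonneg_left h1 h2]
  have hh : ∀ i j, IsO s (k + 1) 1 (fun c => c.1.d.h i j) (fun c => c.1.d'.h i j) :=
    fun i j => ⟨1, zero_le_one, fun c => hdata _ c _ _ (c.2.d.h i j)⟩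
  have hhk := fun i j => (hh i j).lower
  have hO : IsO s k 1 (fun c => c.1.d.O) (fun c => c.1.d'.O) :=
    ⟨1, zero_le_one, fun c => hdata _ c _ _ c.2.d.O⟩
  have hW : IsO s k 1 (fun c => c.1.d.W) (fun c => c.1.d'.W) :=
    ⟨1, zero_le_one, fun c => hdata _ c _ _ c.2.d.W⟩
  have hb : ∀ i, IsO s (k + 1) 1 (fun c => c.1.s.b i) (fun c => c.1.s'.b i) :=
    fun i => ⟨1, zero_le_one, fun c => by simpa [s] using c.2.s.b i⟩
  have hv : IsO s k 1 (fun c => c.1.s.v) (fun c => c.1.s'.v) :=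
    ⟨1, zero_le_one, fun c => by simpa [s] using c.2.s.v⟩
  have ha : IsO s k 1 (fun c => algebraMap ℝ SPoly c.1.s.a) (fun c => algebraMap ℝ SPoly c.1.s'.a) :=
    isO_algebraMap (fun c => c.2.s.a) (fun c => c.2.s.a') (fun c => c.2.s.a_sub)
  have hu : IsO s k 1 (fun c => uE c.1.d.h) (fun c => uE c.1.d'.h) := isO_uE hk hhk
  obtain ⟨Cw, hCw, hwb⟩ : ∃ C : ℝ, 0 ≤ C ∧ ∀ i, ∀ c : ι, Bd (k + 1) (s.τ c) (C * s.δ c)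
      (frame c.1.s.b i) (frame c.1.s'.b i) := by
    choose C hC h using fun i => isO_frame (by lia : 10 ≤ k + 1) hb i
    refine ⟨C 0 + C 1 + C 2, by linarith [hC 0, hC 1, hC 2], fun i c => ?_⟩
    have hle : C i * s.δ c ^ 1 ≤ (C 0 + C 1 + C 2) * s.δ c := by
      rw [pow_one]
      refine mul_le_mul_of_nonneg_right ?_ (s.δ_nonneg c)
      have := hC 0
      have := hC 1
      have := hC 2
      fin_cases i <;> simp <;> linarith
    exact (h i c).mono hle (mul_le_mul_of_nonneg_left hle (s.τ_nonneg c))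
  obtain ⟨Cq, hCq, hq⟩ := isO_quadE hk hh hW hv hb ha
  obtain ⟨Cl, hCl, hl⟩ := isO_logE hk hh hv hb
  obtain ⟨Cv, hCv, hvb⟩ : IsO s k 2
      (fun c => vRhs c.1.d c.1.s + (1 / 2 : ℝ) • (c.1.d.h 0 0 + c.1.d.h 1 1 + c.1.d.h 2 2))
      (fun c => vRhs c.1.d' c.1.s' + (1 / 2 : ℝ) • (c.1.d'.h 0 0 + c.1.d'.h 1 1 + c.1.d'.h 2 2)) := by
    have h2 := (((hu.mul hk hv).smul 2).add (hv.mul hk hv)).add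
      (((hu.mul hk hv).mul hk hv).weaken (by norm_num : 2 ≤ 1 + 1 + 1))
    have h1 := ((isO_uE_sub hk hhk).add h2).smul (-(1 / 2))
    refine cast ?_ h1
    congr 1 <;> funext c <;> simp only [vRhs, smul_add, smul_sub, neg_smul] <;> abel
  obtain ⟨Cc, hCc, hcb⟩ : IsO s k 2
      (fun c => curlRhs c.1.d c.1.s - c.1.d.O) (fun c => curlRhs c.1.d' c.1.s' - c.1.d'.O) := by
    have h1 := (hu.add hv).add ((hu.mul hk hv).weaken (by norm_num : 1 ≤ 1 + 1))
    have h2 := (h1.mul hk hO).sub (isO_curlE hk hh hb)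
    refine cast ?_ h2
    congr 1 <;> funext c <;> simp only [curlRhs] <;> ring
  exact ⟨Cw, Cq, Cl, Cv, Cc, hCw, hCq, hCl, hCv, hCc, fun c hc =>
    ⟨fun i => hwb i ⟨c, hc⟩, hq ⟨c, hc⟩, hl ⟨c, hc⟩, hvb ⟨c, hc⟩, hcb ⟨c, hc⟩⟩⟩

/-- The data enter linearly, at size `η`. The state enters through expressions quadratic in small
quantities, and as the small velocity of the transport equation, so its size and its differences
come back with the factor `δ²`. -/
theorem exists_step_bound (k : ℕ) (hk : 10 ≤ k) : ∃ δ₀ C : ℝ, 0 < δ₀ ∧ δ₀ ≤ 1 ∧ 0 < C ∧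
    ∀ c : Cfg, c.Valid k → c.δ ≤ δ₀ → SBd k c.τ (C * (c.η + c.δ ^ 2)) c.t c.t' ∧
      Bd k c.τ (C * (c.η + c.δ ^ 2)) c.f c.f' := by
  obtain ⟨Cw, Cq, Cl, Cv, Cc, hCw, hCq, hCl, hCv, hCc, hexpr⟩ := exists_expr_bound k hk
  obtain ⟨δT, CT, hδT, hCT, hT⟩ := exists_transport_diff k hk
  obtain ⟨Cm, hCm, hm⟩ := exists_bd_meanFree k
  obtain ⟨Ch, hCh, hhodge⟩ := exists_bd_hodge k (by lia)
  obtain ⟨Ca, hCa, hmean⟩ := exists_bd_mean k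
  set C1 : ℝ := CT * (8 + 2 * Cq) with hC1
  set C2 : ℝ := C1 + 2 * Cl with hC2
  set C3 : ℝ := 1 + 2 * Cc with hC3
  set C4 : ℝ := 3 / 2 + 2 * Cv with hC4
  have p1 : 0 ≤ C1 := by positivity
  have p2 : 0 ≤ C2 := by positivity
  have p3 : 0 ≤ C3 := by positivity
  have p4 : 0 ≤ C4 := by positivity
  set CC : ℝ := C1 + Ch * (Cm * C2 + Cm * C3) + C4 + Ca * C2 + 1 with hCC
  have q1 : 0 ≤ Ch * (Cm * C2 + Cm * C3) := by positivity
  have q2 : 0 ≤ Ca * C2 := by positivity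
  -- `Cw * δ` bounds the velocity and must stay below the threshold `δT` of the transport estimate.
  refine ⟨min (δT / (Cw + 1)) 1, CC, by positivity, min_le_right _ _, by positivity,
    fun c hc hδ => ?_⟩
  obtain ⟨hwb, hq, hl, hvb, hcb⟩ := hexpr c hc
  have hτ := hc.τ_nonneg
  have hη := hc.η_nonneg
  have hδ0 := hη.trans hc.η_le
  set B : ℝ := c.η + c.δ ^ 2 with hB
  have hBnn : 0 ≤ B := by positivity
  have hηB : c.η ≤ B := by rw [hB]; linarith [sq_nonneg c.δ]
  have hδB : c.δ ^ 2 ≤ B := by rw [hB]; linarith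
  have up : ∀ {l p q A A'}, Bd l c.τ (A * B) p q → A ≤ A' → Bd l c.τ (A' * B) p q :=
    fun h hA => h.mono (by gcongr) (by gcongr)
  have upη : ∀ {l p q}, Bd l c.τ c.η p q → Bd l c.τ (1 * B) p q :=
    fun h => h.mono (by linarith) (by rw [one_mul]; gcongr)
  have hsrc : Bd k c.τ ((8 + 2 * Cq) * B) (srcE c.d c.s) (srcE c.d' c.s') := by
    have h1 := (upη hc.d.W).smul (-8)
    have h2 := hq.of_isO hτ hCq hδB
    have h3 := h1.add h2
    rw [abs_neg, abs_of_pos (by norm_num : (0 : ℝ) < 8), one_mul, ← add_mul] at h3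
    exact h3
  have hf : Bd k c.τ (C1 * B) c.f c.f' := by
    have h1 : Cw * c.δ ≤ δT := by
      have h2 := hδ.trans (min_le_left _ _)
      rw [le_div_iff₀ (by positivity)] at h2
      nlinarith
    have := hT c.τ (Cw * c.δ) _ c.N c.N' _ _ _ _ c.f c.f' hτ h1 (fun i => hwb i) hsrc hc.N_le
      hc.N_inv hc.step.f_mem hc.step'.f_mem hc.step.f_eq hc.step'.f_eq
    rwa [← mul_assoc] at this
  have hdiv : Bd k c.τ (C2 * B) (divRhs c.d c.s c.f) (divRhs c.d' c.s' c.f') := by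
    have h2 := (hl.of_isO hτ hCl hδB).smul (-1)
    have h3 := hf.add h2
    rw [abs_neg, abs_one, one_mul, ← add_mul] at h3
    simpa [divRhs, sub_eq_add_neg] using h3
  have hcurl : Bd k c.τ (C3 * B) (curlRhs c.d c.s) (curlRhs c.d' c.s') := by
    have h3 := (upη hc.d.O).add (hcb.of_isO hτ hCc hδB)
    rw [← add_mul] at h3
    simpa using h3
  have hvv : Bd k c.τ (C4 * B) c.t.v c.t'.v := by
    have hl : ∀ i j, Bd k c.τ (1 * B) (c.d.h i j) (c.d'.h i j) := fun i j =>
      upη ⟨(sn_le_succ _ _).trans (hc.d.h i j).left, (sn_le_succ _ _).trans (hc.d.h i j).right,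
        (sn_mono (by lia) _).trans (hc.d.h i j).diff⟩
    have h3 := (((hl 0 0).add (hl 1 1)).add (hl 2 2)).smul (-(1 / 2)) |>.add
      (hvb.of_isO hτ hCv hδB)
    rw [hc.step.v_eq, hc.step'.v_eq]
    have e : |(-(1 / 2) : ℝ)| * (1 * B + 1 * B + 1 * B) + 2 * Cv * B = C4 * B := by
      rw [abs_neg, abs_of_pos (by norm_num : (0 : ℝ) < 1 / 2), hC4]; ring
    have e' : ∀ x p q r : SPoly, (-(1 / 2) : ℝ) • (p + q + r) + (x + (1 / 2 : ℝ) • (p + q + r)) = x :=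
      fun x p q r => by rw [neg_smul]; abel
    rwa [e, e', e'] at h3
  have hmm := hmean c.τ _ _ _ hdiv
  obtain ⟨φ, ψ, hφ, hψ, hLφ, hLψ, hbt⟩ := hc.step.b_eq
  obtain ⟨φ', ψ', hφ', hψ', hLφ', hLψ', hbt'⟩ := hc.step'.b_eq
  have e2 : Ca * (C2 * B) = Ca * C2 * B := by ring
  have hca : Ca * C2 * B / 8 ≤ CC * B := by
    have : Ca * C2 * B ≤ CC * B := by gcongr; linarith
    have : 0 ≤ Ca * C2 * B := by positivity
    linarith
  refine ⟨⟨fun i => ?_, up hvv (by linarith), ?_, ?_, ?_⟩, up hf (by linarith)⟩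
  · have m1 := up (A' := Cm * C2 + Cm * C3)
      (by rw [mul_assoc]; exact hm c.τ _ _ _ hτ hdiv) (by linarith [mul_nonneg hCm.le p3])
    have m2 := up (A' := Cm * C2 + Cm * C3)
      (by rw [mul_assoc]; exact hm c.τ _ _ _ hτ hcurl) (by linarith [mul_nonneg hCm.le p2])
    rw [← hLφ, ← hLφ'] at m1
    rw [← hLψ, ← hLψ'] at m2
    have := hhodge c.τ _ φ ψ φ' ψ' hτ hφ hψ hφ' hψ' m1 m2 i
    rw [← mul_assoc, ← hbt, ← hbt'] at this
    exact up this (by linarith)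
  · rw [hc.step.a_eq, abs_div, abs_of_pos (by norm_num : (0 : ℝ) < 8)]
    rw [e2] at hmm
    linarith [hmm.1]
  · rw [hc.step'.a_eq, abs_div, abs_of_pos (by norm_num : (0 : ℝ) < 8)]
    rw [e2] at hmm
    linarith [hmm.2.1]
  · rw [hc.step.a_eq, hc.step'.a_eq, ← sub_div, abs_div, abs_of_pos (by norm_num : (0 : ℝ) < 8)]
    have h1 : Ca * (c.τ * (C2 * B)) / 8 = c.τ * (Ca * C2 * B / 8) := by ring
    calc _ ≤ Ca * (c.τ * (C2 * B)) / 8 := by linarith [hmm.2.2]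
      _ = c.τ * (Ca * C2 * B / 8) := h1
      _ ≤ _ := by gcongr

/-! ### Existence of the steps and convergence of the iteration -/

lemma exists_step : ∃ δ : ℝ, 0 < δ ∧ ∀ (N : ℕ) (d : SData) (s : SState), (∀ i, sn 10 (s.b i) ≤ δ) →
    ∃ f t, Step N d s f t := by
  obtain ⟨δ, hδ, h⟩ := exists_transport_solution
  obtain ⟨P, hP, hX⟩ := sn_X_mul_le 5
  -- The three frame components are differences of two products each: six terms of size `δ / 6`.
  refine ⟨δ / (6 * P), by positivity, fun N d s hs => ?_⟩
  have hX' : ∀ i j, sn 5 (X i * s.b j) ≤ δ / 6 := fun i j => by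
    have h1 : sn 5 (s.b j) ≤ δ / (6 * P) := (sn_mono (by norm_num) _).trans (hs j)
    calc _ ≤ P * (δ / (6 * P)) := (hX i _).trans (by gcongr)
      _ = _ := by field_simp
  have hk : ∀ i j l m, sn 5 (X i * s.b j - X l * s.b m) ≤ δ / 3 := fun i j l m => by
    linarith [sn_sub_le 5 (X i * s.b j) (X l * s.b m), hX' i j, hX' l m]
  have hw : ∑ i, sn 5 (frame s.b i) ≤ δ := by
    have h1 := hk 1 2 2 1
    have h2 := hk 2 0 0 2
    have h3 := hk 0 1 1 0
    simp only [Fin.sum_univ_three, frame, Matrix.cons_val]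
    linarith
  obtain ⟨f, hf, hfe⟩ := h N (frame s.b) hw (srcE d s)
  obtain ⟨φ, hφ, hLφ⟩ := exists_Lap_eq (sInt_sub_mean (divRhs d s f))
  obtain ⟨ψ, hψ, hLψ⟩ := exists_Lap_eq (sInt_sub_mean (curlRhs d s))
  exact ⟨f, ⟨hodge φ ψ, vRhs d s, mean (divRhs d s f) / 8⟩, hf, hfe,
    ⟨φ, ψ, hφ, hψ, hLφ, hLψ, rfl⟩, rfl, rfl⟩

lemma one_div_two_pow_succ_le (n : ℕ) : 1 / (((2 ^ (n + 1) : ℕ) : ℝ) + 1) ≤ (1 / 2) ^ (n + 1) := by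
  push_cast
  rw [one_div_pow]
  exact one_div_le_one_div_of_le (by positivity) (by linarith)

/-- The iteration produces a sequence with uniform bounds that converges geometrically. -/
theorem exists_iteration (k : ℕ) (hk : 10 ≤ k) : ∃ η₀ C : ℝ, 0 < η₀ ∧ 0 < C ∧
    ∀ η : ℝ, 0 ≤ η → η ≤ η₀ → ∀ d : ℕ → SData,
      (∀ n, DBd k ((1 / 2) ^ (n + 1)) η (d n) (d (n + 1))) →
      ∃ (s : ℕ → SState) (f : ℕ → SPoly),
        (∀ n, Step (2 ^ (n + 1)) (d n) (s n) (f n) (s (n + 1))) ∧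
        (∀ n, SBd k ((1 / 2) ^ n) (C * η) (s n) (s (n + 1))) ∧
        (∀ n, Bd k ((1 / 2) ^ (n + 1)) (C * η) (f n) (f (n + 1))) := by
  obtain ⟨δ₁, C₀, hδ₁, hδ₁1, hC₀, hstep⟩ := exists_step_bound k hk
  obtain ⟨δ₂, hδ₂, hex⟩ := exists_step
  set C : ℝ := C₀ + 1 with hC
  have hCpos : 0 < C := by positivity
  have hC1 : 1 ≤ C := by linarith
  -- The first two bounds keep `δ = 2 C η` below both thresholds; the last gives `C δ² ≤ C η`, so
  -- the quadratic part does not exceed the linear one and the ball of radius `δ` is preserved.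
  refine ⟨min (min (δ₁ / (2 * C)) (δ₂ / (2 * C))) (1 / (4 * C ^ 2)), 2 * C, by positivity,
    by positivity, fun η hη hηle d hd => ?_⟩
  set δ : ℝ := 2 * C * η with hδ
  have hδnn : 0 ≤ δ := by positivity
  have hδ1 : δ ≤ δ₁ := by
    have := hηle.trans ((min_le_left _ _).trans (min_le_left _ _))
    rw [le_div_iff₀ (by positivity)] at this
    linarith
  have hδ2 : δ ≤ δ₂ := by
    have := hηle.trans ((min_le_left _ _).trans (min_le_right _ _))
    rw [le_div_iff₀ (by positivity)] at this
    linarith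
  have hbal : C₀ * (η + δ ^ 2) ≤ δ := by
    have h1 := hηle.trans (min_le_right _ _)
    rw [le_div_iff₀ (by positivity)] at h1
    have h2 : C₀ * (η + δ ^ 2) ≤ C * (η + δ ^ 2) := by gcongr; linarith
    have h3 : C * (η + δ ^ 2) = C * η + C * η * (η * (4 * C ^ 2)) := by rw [hδ]; ring
    have h4 : C * η * (η * (4 * C ^ 2)) ≤ C * η * 1 := by gcongr
    linarith
  have hηδ : η ≤ δ := by nlinarith
  classical
  -- For a large state a step need not exist and the state is kept; the bounds below exclude this
  -- case.
  let next : ℕ → SState → SState := fun n s =>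
    if h : ∃ f t, Step (2 ^ (n + 1)) (d n) s f t then h.choose_spec.choose else s
  let s : ℕ → SState := fun n => Nat.rec ⟨0, 0, 0⟩ next n
  have hs : ∀ n, s (n + 1) = next n (s n) := fun n => rfl
  have hstepn : ∀ n, (∀ i, sn (k + 1) ((s n).b i) ≤ δ) →
      ∃ f, Step (2 ^ (n + 1)) (d n) (s n) f (s (n + 1)) := by
    intro n hn
    have h : ∃ f t, Step (2 ^ (n + 1)) (d n) (s n) f t :=
      hex _ _ _ fun i => (sn_mono (by lia) _).trans ((hn i).trans hδ2)
    refine ⟨h.choose, ?_⟩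
    rw [hs]
    simp only [next]
    rw [dif_pos h]
    exact h.choose_spec.choose_spec
  have hSmono : ∀ {τ t t'}, 0 ≤ τ → SBd k τ (C₀ * (η + δ ^ 2)) t t' → SBd k τ δ t t' :=
    fun hτ h => ⟨fun i => (h.b i).mono hbal (mul_le_mul_of_nonneg_left hbal hτ),
      h.v.mono hbal (mul_le_mul_of_nonneg_left hbal hτ), h.a.trans hbal, h.a'.trans hbal,
      h.a_sub.trans (mul_le_mul_of_nonneg_left hbal hτ)⟩
  have hsucc : ∀ n, SBd k ((1 / 2) ^ n) δ (s n) (s (n + 1)) → ∀ f f',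
      Step (2 ^ (n + 1)) (d n) (s n) f (s (n + 1)) →
      Step (2 ^ (n + 2)) (d (n + 1)) (s (n + 1)) f' (s (n + 2)) →
        SBd k ((1 / 2) ^ (n + 1)) δ (s (n + 1)) (s (n + 2)) ∧
          Bd k ((1 / 2) ^ (n + 1)) δ f f' := by
    intro n hn f f' h1 h2
    have hτ : (0 : ℝ) ≤ (1 / 2) ^ (n + 1) := by positivity
    have := hstep ⟨(1 / 2) ^ (n + 1), η, δ, 2 ^ (n + 1), 2 ^ (n + 2), d n, d (n + 1), s n,
      s (n + 1), s (n + 1), s (n + 2), f, f'⟩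
      ⟨hτ, hη, hηδ, hδ1.trans hδ₁1, hd n, by
        have e : (2 : ℝ) * (1 / 2) ^ (n + 1) = (1 / 2) ^ n := by rw [pow_succ]; ring
        simpa only [e] using hn, pow_le_pow_right₀ (by norm_num) (by lia),
        one_div_two_pow_succ_le n, h1, h2⟩ hδ1
    exact ⟨hSmono hτ this.1, this.2.mono hbal (mul_le_mul_of_nonneg_left hbal hτ)⟩
  have main : ∀ n, SBd k ((1 / 2) ^ n) δ (s n) (s (n + 1)) := by
    intro n
    induction n with
    | zero =>
      -- Step `0` is compared with itself at `τ = 1`, which bounds `s 1`; as `s 0 = 0`, this also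
      -- bounds the difference of the two states.
      have hs0 : s 0 = ⟨0, 0, 0⟩ := rfl
      obtain ⟨f, hf⟩ := hstepn 0 (fun i => by rw [hs0]; simpa using hδnn)
      have hself : ∀ {l p q}, Bd l ((1 / 2) ^ (0 + 1)) η p q → Bd l 1 η p p := fun h =>
        Bd.self zero_le_one h.left
      have := hstep ⟨1, η, δ, 2 ^ (0 + 1), 2 ^ (0 + 1), d 0, d 0, s 0, s 0, s 1, s 1, f, f⟩
        ⟨zero_le_one, hη, hηδ, hδ1.trans hδ₁1,
          ⟨fun i j => hself ((hd 0).h i j), hself (hd 0).O, hself (hd 0).W⟩, by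
          rw [hs0]
          have h0 : ∀ l, Bd l (2 * 1) δ (0 : SPoly) 0 := fun l =>
            Bd.self (by norm_num) (by simpa using hδnn)
          exact ⟨fun i => h0 _, h0 _, by simpa using hδnn, by simpa using hδnn,
            by simpa using hδnn⟩, le_rfl,
          (one_div_two_pow_succ_le 0).trans (by norm_num), hf, hf⟩ hδ1
      have h1 := hSmono zero_le_one this.1
      rw [hs0, pow_zero]
      have hz : ∀ {l : ℕ} {p : SPoly}, Bd l 1 δ p p → Bd l 1 δ 0 p := fun {l p} h =>
        ⟨by simpa using hδnn, h.left, by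
          rw [zero_sub, sn_neg, one_mul]; exact (sn_mono (by lia) _).trans h.left⟩
      exact ⟨fun i => hz (h1.b i), hz h1.v, by simpa using hδnn, h1.a, by simpa using h1.a⟩
    | succ n ih =>
      obtain ⟨f, hf⟩ := hstepn n fun i => (ih.b i).left
      obtain ⟨f', hf'⟩ := hstepn (n + 1) fun i => (ih.b i).right
      exact (hsucc n ih f f' hf hf').1
  choose f hf using fun n => hstepn n fun i => ((main n).b i).left
  exact ⟨s, f, hf, main, fun n => (hsucc n (main n) _ _ (hf n) (hf (n + 1))).2⟩

/-! ### Limits of polynomials -/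

open Filter Topology

/-- The functions `p n` converge geometrically in the Sobolev norm of order `j + 4`, and `F` is the
limit. -/
structure Conv (j : ℕ) (p : ℕ → SPoly) (F : S2 → ℝ) : Prop where
  bound : ∃ c : ℝ, ∀ n, sn (j + 4) (p n - p (n + 1)) ≤ c * (1 / 2) ^ n
  tendsto : ∀ x, Tendsto (fun n => p n x) atTop (𝓝 (F x))

lemma exists_dist_le {p : ℕ → SPoly} (h : ∃ c : ℝ, ∀ n, sn 4 (p n - p (n + 1)) ≤ c * (1 / 2) ^ n) :
    ∃ c : ℝ, ∀ n x, dist (p n x) (p (n + 1) x) ≤ c * (1 / 2) ^ n := by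
  obtain ⟨c, hc⟩ := h
  obtain ⟨C, hC, hs⟩ := exists_abs_le_sn
  refine ⟨C * c, fun n x => ?_⟩
  rw [Real.dist_eq, ← sub_fun, mul_assoc]
  exact (hs _ x).trans (by gcongr; exact hc n)

lemma exists_conv {j : ℕ} {p : ℕ → SPoly}
    (h : ∃ c : ℝ, ∀ n, sn (j + 4) (p n - p (n + 1)) ≤ c * (1 / 2) ^ n) : ∃ F, Conv j p F := by
  obtain ⟨c, hc⟩ := exists_dist_le (p := p)
    (h.imp fun c hc n => (sn_mono (by lia) _).trans (hc n))
  choose F hF using fun x => cauchySeq_tendsto_of_complete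
    (cauchySeq_of_le_geometric (1 / 2) c (by norm_num) fun n => hc n x)
  exact ⟨F, h, hF⟩

lemma Conv.mono {i j : ℕ} {p : ℕ → SPoly} {F : S2 → ℝ} (h : Conv j p F) (hij : i ≤ j) :
    Conv i p F :=
  ⟨h.bound.imp fun _ hc n => (sn_mono (by lia) _).trans (hc n), h.tendsto⟩

lemma Conv.deriv {j : ℕ} {p : ℕ → SPoly} {F : S2 → ℝ} (h : Conv (j + 1) p F) (i : Fin 3) :
    ∃ G, Conv j (fun n => Z i (p n)) G :=
  exists_conv (h.bound.imp fun _ hc n => by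
    rw [← map_sub]; refine (sn_Z_le i _ _).trans ?_; rw [show j + 4 + 1 = j + 1 + 4 by lia]; exact hc n)

lemma Conv.exists_dist_le {j : ℕ} {p : ℕ → SPoly} {F : S2 → ℝ} (h : Conv j p F) :
    ∃ c : ℝ, ∀ n x, dist (p n x) (F x) ≤ c * (1 / 2) ^ n := by
  obtain ⟨c, hc⟩ := SphereSeed.exists_dist_le (h.mono (Nat.zero_le j)).bound
  refine ⟨c * 2, fun n x => ?_⟩
  have := dist_le_of_le_geometric_of_tendsto (1 / 2) c (by norm_num) (fun n => hc n x)
    (h.tendsto x) n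
  convert this using 1
  ring

lemma Conv.tendstoUniformly {j : ℕ} {p : ℕ → SPoly} {F : S2 → ℝ} (h : Conv j p F) :
    TendstoUniformly (fun n x => p n x) F atTop := by
  obtain ⟨c, hc⟩ := h.exists_dist_le
  have h0 : Tendsto (fun n : ℕ => c * (1 / 2 : ℝ) ^ n) atTop (𝓝 0) := by
    simpa using (tendsto_pow_atTop_nhds_zero_of_lt_one (by norm_num : (0 : ℝ) ≤ 1 / 2)
      (by norm_num)).const_mul c
  rw [Metric.tendstoUniformly_iff]
  intro ε hε
  filter_upwards [h0.eventually (gt_mem_nhds hε)] with n hn x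
  rw [dist_comm]
  exact (hc n x).trans_lt hn

lemma Conv.continuous {j : ℕ} {p : ℕ → SPoly} {F : S2 → ℝ} (h : Conv j p F) : Continuous F :=
  h.tendstoUniformly.continuous (Eventually.of_forall fun n => (p n).continuous).frequently

lemma Conv.add_const_seq {j : ℕ} {p : ℕ → SPoly} {F : S2 → ℝ} (h : Conv j p F) (q : SPoly) :
    Conv j (fun n => p n + q) (fun x => F x + q x) :=
  ⟨h.bound.imp fun _ hc n => by rw [add_sub_add_right_eq_sub]; exact hc n,
    fun x => (h.tendsto x).add_const (q x)⟩

/-! ### Derivatives of radially constant extensions -/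

lemma ext_of_ne {f : S2 → ℝ} {y : E3} (hy : y ≠ 0) (hm : ‖y‖⁻¹ • y ∈ Metric.sphere (0 : E3) 1) :
    ext f y = f ⟨‖y‖⁻¹ • y, hm⟩ := by
  rw [ext, dif_neg hy]

lemma normalize_mem {y : E3} (hy : y ≠ 0) : ‖y‖⁻¹ • y ∈ Metric.sphere (0 : E3) 1 := by
  simp [norm_smul, inv_mul_cancel₀ (norm_ne_zero_iff.mpr hy)]

lemma ext_coe (f : S2 → ℝ) (x : S2) : ext f x = f x := by
  have hx : ‖(x : E3)‖ = 1 := by simp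
  have h0 : (x : E3) ≠ 0 := fun h => by simp [h] at hx
  rw [ext_of_ne h0 (normalize_mem h0)]
  congr 1
  ext1
  simp [hx]

lemma continuousOn_ext {f : S2 → ℝ} (hf : Continuous f) : ContinuousOn (ext f) {0}ᶜ := by
  rw [continuousOn_iff_continuous_domRestrict]
  have : ({0}ᶜ : Set E3).domRestrict (ext f) =
      fun y : ({0}ᶜ : Set E3) => f ⟨‖(y : E3)‖⁻¹ • (y : E3), normalize_mem y.2⟩ := by
    funext y
    exact ext_of_ne y.2 _
  rw [this]
  refine hf.comp (Continuous.subtype_mk ?_ _)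
  exact (continuous_subtype_val.norm.inv₀ fun y => norm_ne_zero_iff.mpr y.2).smul
    continuous_subtype_val

/-- The derivative of the extension in terms of the derivatives along the rotation fields. -/
def extDeriv (G : Fin 3 → S2 → ℝ) (y : E3) : E3 →L[ℝ] ℝ :=
  ∑ i, (ext (G i) y * (‖y‖ ^ 2)⁻¹) • innerSL ℝ (rot i y)

lemma rot_coord (i : Fin 3) (y : E3) (k : Fin 3) :
    rot i y k = crossProduct (Pi.single i 1 : Fin 3 → ℝ) y.ofLp k := rfl

lemma contDiff_rot (i : Fin 3) {n : WithTop ℕ∞} : ContDiff ℝ n (rot i) := by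
  rw [contDiff_euclidean]
  intro k
  fin_cases i <;> fin_cases k <;> simp [rot_coord, crossProduct] <;> fun_prop

lemma norm_rot_le (i : Fin 3) (y : E3) : ‖rot i y‖ ≤ ‖y‖ := by
  rw [EuclideanSpace.norm_eq, EuclideanSpace.norm_eq]
  refine Real.sqrt_le_sqrt ?_
  simp only [Fin.sum_univ_three, Real.norm_eq_abs, sq_abs, rot_coord]
  fin_cases i <;> simp [crossProduct]
  · linarith [sq_nonneg (y.ofLp 0)]
  · linarith [sq_nonneg (y.ofLp 1)]
  · linarith [sq_nonneg (y.ofLp 2)]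

lemma hasFDerivAt_ext_X (k : Fin 3) {y : E3} (hy : y ≠ 0) :
    HasFDerivAt (ext (X k)) (extDeriv (fun i => Z i (X k)) y) y := by
  have hn : ‖y‖ ≠ 0 := norm_ne_zero_iff.mpr hy
  have hev : ext (X k) =ᶠ[𝓝 y] fun z => z k * ‖z‖⁻¹ := by
    filter_upwards [isOpen_ne.mem_nhds hy] with z hz
    rw [ext_of_ne hz (normalize_mem hz), X_fun]
    simp [mul_comm]
  have h1 : HasFDerivAt (fun z : E3 => z k) (EuclideanSpace.proj k : E3 →L[ℝ] ℝ) y :=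
    (EuclideanSpace.proj k : E3 →L[ℝ] ℝ).hasFDerivAt
  have h2 : HasFDerivAt (fun z : E3 => ‖z‖⁻¹) (-(‖y‖ ^ 3)⁻¹ • innerSL ℝ y) y := by
    have h3 : HasFDerivAt (fun z : E3 => ‖z‖ ^ 2) (2 • innerSL ℝ y) y :=
      (hasStrictFDerivAt_norm_sq y).hasFDerivAt
    have h4 := (h3.sqrt (pow_ne_zero 2 hn))
    have h5 := (hasDerivAt_inv (x := √(‖y‖ ^ 2))
      (by rw [Real.sqrt_sq (norm_nonneg y)]; exact hn)).comp_hasFDerivAt y h4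
    simp only [Real.sqrt_sq (norm_nonneg _), Function.comp_def] at h5
    refine h5.congr_fderiv ?_
    ext v
    simp
    field_simp
  refine ((h1.mul h2).congr_of_eventuallyEq hev).congr_fderiv ?_
  ext v
  have hr : ∀ i, ext (Z i (X k)) y = rot i y k * ‖y‖⁻¹ := fun i => by
    rw [ext_of_ne hy (normalize_mem hy), Z_X]
    fin_cases i <;> fin_cases k <;> simp [crossProduct, rot_coord, mul_comm]
  -- The rotation fields resolve the tangential projection: `∑ rot_i rot_iᵀ = ‖y‖² - y yᵀ`.
  have hL : ∑ i, rot i y k * inner ℝ (rot i y) v = v k * ‖y‖ ^ 2 - y k * inner ℝ y v := by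
    rw [EuclideanSpace.real_norm_sq_eq]
    simp only [PiLp.inner_apply, Fin.sum_univ_three, rot_coord]
    fin_cases k <;> simp [crossProduct] <;> ring
  have e : ∀ i, ext (Z i (X k)) y * (‖y‖ ^ 2)⁻¹ * inner ℝ (rot i y) v =
      (‖y‖ ^ 3)⁻¹ * (rot i y k * inner ℝ (rot i y) v) := fun i => by
    rw [hr]; field_simp
  simp only [extDeriv, sum_apply, smul_apply,
    innerSL_apply_apply, smul_eq_mul, e, ← Finset.mul_sum, hL, add_apply]
  change y k * (-(‖y‖ ^ 3)⁻¹ * inner ℝ y v) + ‖y‖⁻¹ * v k = _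
  field_simp
  ring

lemma ext_add (f g : S2 → ℝ) (y : E3) : ext (fun x => f x + g x) y = ext f y + ext g y := by
  unfold ext; split_ifs <;> simp

lemma ext_mul (f g : S2 → ℝ) (y : E3) : ext (fun x => f x * g x) y = ext f y * ext g y := by
  unfold ext; split_ifs <;> simp

/-- Both sides behave as derivations in `f` and agree on constants and coordinates. -/
lemma hasFDerivAt_ext (f : SPoly) {y : E3} (hy : y ≠ 0) :
    HasFDerivAt (ext f) (extDeriv (fun i => Z i f) y) y := by
  induction f using SPoly.induction with
  | hC c =>
    have hev : ext (algebraMap ℝ SPoly c) =ᶠ[𝓝 y] fun _ => c := by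
      filter_upwards [isOpen_ne.mem_nhds hy] with z hz
      rw [ext_of_ne hz (normalize_mem hz), algebraMap_fun]
    refine ((hasFDerivAt_const c y).congr_of_eventuallyEq hev).congr_fderiv ?_
    have h0 : ext (0 : SPoly) y = 0 := by
      rw [ext_of_ne hy (normalize_mem hy), zero_fun]
    simp only [extDeriv, Z_algebraMap, h0, zero_mul, zero_smul, Finset.sum_const_zero]
  | hadd f g hf hg =>
    have e : ext (f + g : SPoly) = fun z => ext f z + ext g z := by
      funext z; rw [← ext_add]; congr 1
    rw [e]
    refine (hf.add hg).congr_fderiv ?_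
    have e' : ∀ i, ext (Z i (f + g)) y = ext (Z i f) y + ext (Z i g) y := fun i => by
      rw [← ext_add, map_add]; congr 1
    simp only [extDeriv, e', add_mul, add_smul, Finset.sum_add_distrib]
  | hX f k hf =>
    have e : ext (f * X k : SPoly) = fun z => ext f z * ext (X k) z := by
      funext z; rw [← ext_mul]; congr 1
    rw [e]
    refine (hf.mul (hasFDerivAt_ext_X k hy)).congr_fderiv ?_
    have e' : ∀ i, ext (Z i (f * X k)) y =
        ext (Z i f) y * ext (X k) y + ext f y * ext (Z i (X k)) y := fun i => by
      rw [← ext_mul, ← ext_mul, ← ext_add, Z_mul]; congr 1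
    simp only [extDeriv, e', Finset.smul_sum, smul_smul, ← Finset.sum_add_distrib, ← add_smul]
    refine Finset.sum_congr rfl fun i _ => ?_
    congr 1
    ring

lemma exists_norm_extDeriv_sub_le {j : ℕ} {p : Fin 3 → ℕ → SPoly} {G : Fin 3 → S2 → ℝ}
    (h : ∀ i, Conv j (p i) (G i)) : ∃ c : ℝ, ∀ n (y : E3), y ≠ 0 →
      ‖extDeriv (fun i => p i n) y - extDeriv G y‖ ≤ c * (1 / 2) ^ n * ‖y‖⁻¹ := by
  choose c hc using fun i => (h i).exists_dist_le
  refine ⟨∑ i, c i, fun n y hy => ?_⟩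
  have hn : ‖y‖ ≠ 0 := norm_ne_zero_iff.mpr hy
  simp only [extDeriv, ← Finset.sum_sub_distrib, Finset.sum_mul]
  refine norm_sum_le_of_le _ fun i _ => ?_
  have e : ∀ (a b r : ℝ) (L : E3 →L[ℝ] ℝ), (a * r) • L - (b * r) • L = ((a - b) * r) • L :=
    fun a b r L => by ext v; simp [sub_mul]
  rw [e, norm_smul, innerSL_apply_norm, norm_mul, norm_inv, norm_pow, norm_norm]
  have h1 : ‖ext (p i n) y - ext (G i) y‖ ≤ c i * (1 / 2) ^ n := by
    rw [ext_of_ne hy (normalize_mem hy), ext_of_ne hy (normalize_mem hy), ← dist_eq_norm]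
    exact hc i n _
  have h2 := norm_rot_le i y
  calc _ ≤ c i * (1 / 2) ^ n * (‖y‖ ^ 2)⁻¹ * ‖y‖ := by
        have := (norm_nonneg _).trans h1
        gcongr
    _ = _ := by field_simp

/-- The derivatives of the extensions converge uniformly where `‖z‖ > ‖y‖ / 2`, since the factor
`‖z‖⁻¹` in their distance is bounded there. -/
theorem Conv.hasFDerivAt {j : ℕ} {p : ℕ → SPoly} {F : S2 → ℝ} {G : Fin 3 → S2 → ℝ}
    (hp : Conv j p F) (h : ∀ i, Conv 0 (fun n => Z i (p n)) (G i)) {y : E3} (hy : y ≠ 0) :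
    HasFDerivAt (ext F) (extDeriv G y) y := by
  have hn : 0 < ‖y‖ := norm_pos_iff.mpr hy
  set s : Set E3 := {z | ‖y‖ / 2 < ‖z‖} with hs
  have hso : IsOpen s := isOpen_lt continuous_const continuous_norm
  have hz : ∀ z ∈ s, z ≠ 0 := fun z hz h0 => by
    rw [h0, hs, Set.mem_ofPred_eq, norm_zero] at hz; linarith
  obtain ⟨c, hc⟩ := exists_norm_extDeriv_sub_le h
  have h0 : Tendsto (fun n : ℕ => c * (1 / 2 : ℝ) ^ n * (‖y‖ / 2)⁻¹) atTop (𝓝 0) := by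
    simpa using ((tendsto_pow_atTop_nhds_zero_of_lt_one (by norm_num : (0 : ℝ) ≤ 1 / 2)
      (by norm_num)).const_mul c).mul_const (‖y‖ / 2)⁻¹
  refine hasFDerivAt_of_tendstoUniformlyOn (l := atTop) (f := fun n => ext (p n))
    (f' := fun n => extDeriv fun i => Z i (p n)) hso ?_
    (fun n z h => hasFDerivAt_ext (p n) (hz z h)) (fun z h => ?_) (half_lt_self hn)
  · rw [Metric.tendstoUniformlyOn_iff]
    intro ε hε
    filter_upwards [h0.eventually (gt_mem_nhds hε)] with n hn z hzs
    rw [dist_comm, dist_eq_norm]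
    refine ((hc n z (hz z hzs)).trans ?_).trans_lt hn
    have hc0 : 0 ≤ c * (1 / 2) ^ n := by
      have := (norm_nonneg _).trans (hc n z (hz z hzs))
      exact nonneg_of_mul_nonneg_left this (inv_pos.mpr (norm_pos_iff.mpr (hz z hzs)))
    exact mul_le_mul_of_nonneg_left (inv_anti₀ (by positivity) (le_of_lt hzs)) hc0
  · simp only [ext_of_ne (hz z h) (normalize_mem (hz z h))]
    exact hp.tendsto _

/-- Away from the origin the differential of the limit is a smooth combination of the limits of the
rotation derivatives, to which induction applies. -/
theorem Conv.isCn {j : ℕ} {p : ℕ → SPoly} {F : S2 → ℝ} (h : Conv j p F) : IsCn j F := by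
  induction j generalizing p F with
  | zero =>
    rw [IsCn, Nat.cast_zero, contDiffOn_zero]
    exact continuousOn_ext h.continuous
  | succ j ih =>
    choose G hG using fun i => h.deriv i
    have hd : ∀ y : E3, y ≠ 0 → HasFDerivAt (ext F) (extDeriv G y) y := fun y hy =>
      h.hasFDerivAt (fun i => (hG i).mono (Nat.zero_le _)) hy
    have ho : IsOpen ({0}ᶜ : Set E3) := isOpen_compl_singleton
    rw [IsCn, Nat.cast_succ, contDiffOn_succ_iff_fderiv_of_isOpen ho]
    refine ⟨fun y hy => (hd y hy).differentiableAt.differentiableWithinAt, by simp, ?_⟩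
    refine ContDiffOn.congr (f := extDeriv G) ?_ fun y hy => (hd y hy).fderiv
    refine ContDiffOn.sum fun i _ => ?_
    refine ContDiffOn.smul (ContDiffOn.mul (ih (hG i)) ?_) ?_
    · exact (contDiff_norm_sq ℝ).contDiffOn.inv fun y hy =>
        pow_ne_zero 2 (norm_ne_zero_iff.mpr hy)
    · exact ((innerSL ℝ).contDiff.comp (contDiff_rot i)).contDiffOn

theorem Conv.tendsto_pd {j : ℕ} {p : ℕ → SPoly} {F : S2 → ℝ} (h : Conv (j + 1) p F) (k : Fin 3)
    (x : S2) : Tendsto (fun n => D k (p n) x) atTop (𝓝 (pd k F x)) := by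
  choose G hG using fun i => h.deriv i
  have hx : ‖(x : E3)‖ = 1 := by simp
  have h0 : (x : E3) ≠ 0 := fun h => by simp [h] at hx
  rw [pd, (h.hasFDerivAt (fun i => (hG i).mono (Nat.zero_le _)) h0).fderiv]
  have e : extDeriv G x (EuclideanSpace.single k 1) = ∑ i, rotX i k x * G i x := by
    simp only [extDeriv, sum_apply, smul_apply,
      innerSL_apply_apply, ext_coe, hx, smul_eq_mul]
    refine Finset.sum_congr rfl fun i _ => ?_
    have : rotX i k x = inner ℝ (rot i x) (EuclideanSpace.single k 1) := by
      rw [EuclideanSpace.inner_single_right]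
      fin_cases i <;> fin_cases k <;> simp [rotX, crossProduct, rot_coord]
    rw [this]; ring
  rw [e]
  simp only [D_apply, sum_fun, mul_fun]
  exact tendsto_finsetSum _ fun i _ => ((hG i).tendsto x).const_mul _

/-! ### Comparison with Sobolev norms -/

lemma memLp_of_continuous {f : S2 → ℝ} (hf : Continuous f) : MemLp f 2 area :=
  (ContinuousMap.toLp (E := ℝ) 2 area ℝ ⟨f, hf⟩ |> Lp.memLp).ae_eq
    (ContinuousMap.coeFn_toLp (E := ℝ) (p := 2) (𝕜 := ℝ) area ⟨f, hf⟩)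

lemma toL2_eq (f : SPoly) : toL2 f = (memLp_of_continuous f.continuous).toLp f := by
  refine Lp.ext ((ContinuousMap.coeFn_toLp (E := ℝ) (p := 2) (𝕜 := ℝ) area f.1).trans
    (MemLp.coeFn_toLp _).symm)

lemma lintegral_sq_eq {f : S2 → ℝ} (hf : MemLp f 2 area) :
    ∫⁻ x, ‖f x‖ₑ ^ 2 ∂area = ENNReal.ofReal (‖hf.toLp f‖ ^ 2) := by
  rw [Lp.norm_toLp, ← ENNReal.toReal_pow, ENNReal.ofReal_toReal (ENNReal.pow_ne_top hf.2.ne),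
    eLpNorm_eq_lintegral_rpow_enorm_toReal (by norm_num) (by norm_num), ← ENNReal.rpow_natCast,
    ← ENNReal.rpow_mul]
  simp

lemma inner_toLp {f g : S2 → ℝ} (hf : MemLp f 2 area) (hg : MemLp g 2 area) :
    inner ℝ (hf.toLp f) (hg.toLp g) = ∫ x, f x * g x ∂area := by
  rw [L2.inner_def]
  refine integral_congr_ae ?_
  filter_upwards [hf.coeFn_toLp, hg.coeFn_toLp] with x h1 h2
  rw [h1, h2]
  simp [mul_comm]

lemma IsWeakRot.proj_eq {i : Fin 3} {f h : S2 → ℝ} (H : IsWeakRot i f h) (N : ℕ) :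
    proj N (H.2.1.toLp h) = Z i (proj N (H.1.toLp f)) := by
  refine proj_weakDeriv i N _ _ fun q => ?_
  obtain ⟨p, rfl⟩ := toSPoly_surjective q
  rw [Z_toSPoly, toL2_eq, toL2_eq, inner_toLp, inner_toLp]
  simp only [toSPoly_fun, ← fderiv_polyFun]
  exact H.2.2 _ (contDiff_polyFun p _)

lemma sobolevSq_succ (k : ℕ) (f : S2 → ℝ) :
    sobolevSq (k + 1) f = (∫⁻ x, ‖f x‖ₑ ^ 2 ∂area) + gradSobolevSq k f := rfl

lemma norm_toLp_le {f : S2 → ℝ} (hf : MemLp f 2 area) {k : ℕ} {A : ℝ} (hA : 0 ≤ A)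
    (h : sobolevSq k f < ENNReal.ofReal (A ^ 2)) : ‖hf.toLp f‖ ≤ A := by
  have h1 : ∫⁻ x, ‖f x‖ₑ ^ 2 ∂area < ENNReal.ofReal (A ^ 2) := by
    cases k with
    | zero => exact h
    | succ k => exact lt_of_le_of_lt le_self_add h
  rw [lintegral_sq_eq hf, ENNReal.ofReal_lt_ofReal_iff_of_nonneg (by positivity)] at h1
  exact (lt_of_pow_lt_pow_left₀ 2 hA h1).le

/-- Bounds for the projections of a function in terms of its Sobolev norm. -/
theorem sn_proj_le {k : ℕ} {f : S2 → ℝ} (hf : MemLp f 2 area) {A : ℝ} (hA : 0 ≤ A)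
    (h : sobolevSq k f < ENNReal.ofReal (A ^ 2)) (N : ℕ) :
    sn k (proj N (hf.toLp f)) ≤ 4 ^ k * A := by
  have h0 := (norm_proj_le N (hf.toLp f)).trans (norm_toLp_le hf hA h)
  induction k generalizing f with
  | zero => simpa [sn] using h0
  | succ k ih =>
    rw [sn_succ, Fin.sum_univ_three]
    have hi : ∀ i, sn k (Z i (proj N (hf.toLp f))) ≤ 4 ^ k * A := fun i => by
      have h1 : ⨅ (g : S2 → ℝ) (_ : IsWeakRot i f g), sobolevSq k g < ENNReal.ofReal (A ^ 2) :=
        lt_of_le_of_lt ((Finset.single_le_sum (f := fun i => ⨅ (g : S2 → ℝ) (_ : IsWeakRot i f g),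
          sobolevSq k g) (fun _ _ => zero_le) (Finset.mem_univ i)).trans le_add_self) h
      -- A strict bound on the infimum yields an actual weak derivative; hence the strict
      -- hypothesis.
      simp only [iInf_lt_iff] at h1
      obtain ⟨g, hg, hlt⟩ := h1
      rw [← hg.proj_eq N]
      exact ih hg.2.1 hlt ((norm_proj_le N _).trans (norm_toLp_le hg.2.1 hA hlt))
    have h4 : A ≤ 4 ^ k * A := le_mul_of_one_le_left hA (one_le_pow₀ (by norm_num))
    rw [pow_succ]
    linarith [hi 0, hi 1, hi 2]

theorem sn_Z_proj_le {k : ℕ} {f : S2 → ℝ} (hf : MemLp f 2 area) {A : ℝ} (hA : 0 ≤ A)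
    (h : gradSobolevSq k f < ENNReal.ofReal (A ^ 2)) (N : ℕ) (i : Fin 3) :
    sn k (Z i (proj N (hf.toLp f))) ≤ 4 ^ k * A := by
  have h1 : ⨅ (g : S2 → ℝ) (_ : IsWeakRot i f g), sobolevSq k g < ENNReal.ofReal (A ^ 2) :=
    lt_of_le_of_lt (Finset.single_le_sum (f := fun i => ⨅ (g : S2 → ℝ) (_ : IsWeakRot i f g),
      sobolevSq k g) (fun _ _ => zero_le) (Finset.mem_univ i)) h
  simp only [iInf_lt_iff] at h1
  obtain ⟨g, hg, hlt⟩ := h1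
  rw [← hg.proj_eq N]
  exact sn_proj_le hg.2.1 hA hlt N

/-- The derivatives of the projections are nested projections of one another, so Pythagoras makes
their norms increase and controls their differences. Bounded norms then give a Cauchy sequence,
whose limit is the weak derivative. -/
lemma exists_derivative_limit (i : Fin 3) (F : L2) {A : ℝ}
    (h : ∀ N, ‖toL2 (Z i (proj N F))‖ ≤ A) : ∃ G : L2, ∀ N, proj N G = Z i (proj N F) := by
  set u : ℕ → L2 := fun N => toL2 (Z i (proj N F)) with hu
  have hpr : ∀ N M, N ≤ M → proj N (u M) = Z i (proj N F) := fun N M hNM => by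
    rw [hu, proj_Z, proj_proj hNM]
  have hsq : ∀ N M, N ≤ M → ‖u M - u N‖ ^ 2 = ‖u M‖ ^ 2 - ‖u N‖ ^ 2 := fun N M hNM => by
    have hin : inner ℝ (u M) (u N) = ‖u N‖ ^ 2 := by
      have hm : Z i (proj N F) ∈ Pdeg N := Z_mem_Pdeg i (proj_mem N F)
      rw [hu, ← inner_proj N _ hm, ← hu, hpr N M hNM, norm_toL2_sq]
    rw [norm_sub_sq_real, hin]
    ring
  have hmono : Monotone fun N => ‖u N‖ ^ 2 := fun N M hNM => by
    have := hsq N M hNM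
    have := sq_nonneg ‖u M - u N‖
    show ‖u N‖ ^ 2 ≤ ‖u M‖ ^ 2
    linarith
  have hbdd : BddAbove (Set.range fun N => ‖u N‖ ^ 2) :=
    ⟨A ^ 2, by rintro _ ⟨N, rfl⟩; exact pow_le_pow_left₀ (norm_nonneg _) (h N) 2⟩
  have hlim := tendsto_atTop_ciSup hmono hbdd
  set L := ⨆ N, ‖u N‖ ^ 2 with hL
  have hle : ∀ N M, N ≤ M → ‖u M - u N‖ ≤ √(L - ‖u N‖ ^ 2) := fun N M hNM => by
    refine Real.le_sqrt_of_sq_le ?_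
    rw [hsq N M hNM]
    exact sub_le_sub_right (le_ciSup hbdd M) _
  have h0 : Tendsto (fun N => √(L - ‖u N‖ ^ 2)) atTop (𝓝 0) := by
    have := (tendsto_const_nhds (x := L)).sub hlim
    rw [sub_self] at this
    simpa using this.sqrt
  have hc : CauchySeq u := by
    rw [Metric.cauchySeq_iff']
    intro ε hε
    obtain ⟨N, hN⟩ := (h0.eventually (gt_mem_nhds hε)).exists
    exact ⟨N, fun M hM => by rw [dist_eq_norm]; exact (hle N M hM).trans_lt hN⟩
  obtain ⟨G, hG⟩ := cauchySeq_tendsto_of_complete hc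
  refine ⟨G, fun N => toL2_injective ?_⟩
  have h1 : Tendsto (fun M => toL2 (proj N (u M))) atTop (𝓝 (toL2 (proj N G))) := by
    simp only [toL2_proj]
    exact ((Kdeg N).starProjection.continuous.tendsto G).comp hG
  have h2 : Tendsto (fun M => toL2 (proj N (u M))) atTop (𝓝 (toL2 (Z i (proj N F)))) :=
    tendsto_const_nhds.congr' (by
      filter_upwards [eventually_ge_atTop N] with M hM
      rw [hpr N M hM])
  exact tendsto_nhds_unique h1 h2

/-- Integration by parts holds for each projection, and both sides pass to the `L²` limit. -/
lemma isWeakRot_of_proj {i : Fin 3} {f : S2 → ℝ} (hf : MemLp f 2 area) {G : L2}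
    (h : ∀ N, proj N G = Z i (proj N (hf.toLp f))) : IsWeakRot i f G := by
  refine ⟨hf, Lp.memLp G, fun φ hφ => ?_⟩
  have hφ1 : ContDiff ℝ 1 φ := hφ.of_le (by exact_mod_cast le_top)
  have c1 : Continuous fun x : S2 => φ x := hφ.continuous.comp continuous_subtype_val
  have c2 : Continuous fun x : S2 => fderiv ℝ φ (x : E3) (rot i x) :=
    ((hφ1.continuous_fderiv one_ne_zero).clm_apply (continuous_rot i)).comp continuous_subtype_val
  have m1 := memLp_of_continuous c1
  have m2 := memLp_of_continuous c2
  have e1 := inner_toLp hf m2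
  have e2 := inner_toLp (Lp.memLp G) m1
  rw [Lp.toLp_coeFn] at e2
  rw [← e1, ← e2]
  have t1 := (tendsto_proj (hf.toLp f)).inner (𝕜 := ℝ) (tendsto_const_nhds (x := m2.toLp _))
  have t2 := ((tendsto_proj G).inner (𝕜 := ℝ) (tendsto_const_nhds (x := m1.toLp _))).neg
  refine tendsto_nhds_unique t1 (t2.congr fun N => ?_)
  rw [h N]
  obtain ⟨p, hp⟩ := toSPoly_surjective (proj N (hf.toLp f))
  rw [← hp, Z_toSPoly, toL2_eq, toL2_eq, inner_toLp, inner_toLp]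
  simp only [toSPoly_fun, ← fderiv_polyFun]
  rw [integral_rot_mul i _ _ (contDiff_polyFun p _) hφ1]

/-- Bounds for the Sobolev norm of a function in terms of its projections. -/
theorem sobolevSq_le {k : ℕ} {f : S2 → ℝ} (hf : MemLp f 2 area) {A : ℝ}
    (h : ∀ N, sn k (proj N (hf.toLp f)) ≤ A) : sobolevSq k f ≤ ENNReal.ofReal (4 ^ k * A ^ 2) := by
  have h0 : ∫⁻ x, ‖f x‖ₑ ^ 2 ∂area ≤ ENNReal.ofReal (A ^ 2) := by
    rw [lintegral_sq_eq hf]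
    refine ENNReal.ofReal_le_ofReal (pow_le_pow_left₀ (norm_nonneg _) ?_ 2)
    exact le_of_tendsto' (tendsto_proj (hf.toLp f)).norm fun N => (norm_le_sn k _).trans (h N)
  induction k generalizing f with
  | zero => simpa [sobolevSq] using h0
  | succ k ih =>
    have hZ : ∀ N i, sn k (Z i (proj N (hf.toLp f))) ≤ A := fun N i => (sn_Z_le i k _).trans (h N)
    have hi : ∀ i, ⨅ (g : S2 → ℝ) (_ : IsWeakRot i f g), sobolevSq k g ≤
        ENNReal.ofReal (4 ^ k * A ^ 2) := fun i => by
      obtain ⟨G, hG⟩ := exists_derivative_limit i (hf.toLp f)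
        fun N => (norm_le_sn k _).trans (hZ N i)
      have hw := isWeakRot_of_proj hf hG
      have hGN : ∀ N, sn k (proj N (hw.2.1.toLp G)) ≤ A := fun N => by
        rw [hw.proj_eq]; exact hZ N i
      refine (iInf₂_le _ hw).trans (ih hw.2.1 hGN ?_)
      rw [lintegral_sq_eq hw.2.1]
      refine ENNReal.ofReal_le_ofReal (pow_le_pow_left₀ (norm_nonneg _) ?_ 2)
      exact le_of_tendsto' (tendsto_proj _).norm fun N => (norm_le_sn k _).trans (hGN N)
    have hs : gradSobolevSq k f ≤ 3 * ENNReal.ofReal (4 ^ k * A ^ 2) := by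
      rw [gradSobolevSq]
      refine (Finset.sum_le_sum fun i _ => hi i).trans ?_
      simp
    rw [sobolevSq_succ]
    refine (add_le_add h0 hs).trans ?_
    rw [show (3 : ℝ≥0∞) = ENNReal.ofReal 3 by simp, ← ENNReal.ofReal_mul (by norm_num),
      ← ENNReal.ofReal_add (by positivity) (by positivity)]
    refine ENNReal.ofReal_le_ofReal ?_
    have h4 : A ^ 2 ≤ 4 ^ k * A ^ 2 :=
      le_mul_of_one_le_left (sq_nonneg A) (one_le_pow₀ (by norm_num))
    rw [pow_succ 4 k]
    linarith

/-- Lower semicontinuity of the Sobolev norm. -/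
lemma sn_le_of_tendsto {k : ℕ} {A : ℝ} {u : ℕ → SPoly} {v : SPoly} (h : ∀ n, sn k (u n) ≤ A)
    (hv : ∀ q, Tendsto (fun n => sInt (u n * q)) atTop (𝓝 (sInt (v * q)))) : sn k v ≤ 4 ^ k * A := by
  have hA : 0 ≤ A := (sn_nonneg _ _).trans (h 0)
  have h0 : ‖toL2 v‖ ≤ A := by
    have h1 : ‖toL2 v‖ ^ 2 ≤ A * ‖toL2 v‖ := by
      rw [norm_toL2_sq]
      exact le_of_tendsto' (hv v) fun n => (le_abs_self _).trans
        ((abs_sInt_mul_le _ _).trans (by gcongr; exact (norm_le_sn k _).trans (h n)))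
    by_contra hlt
    nlinarith [norm_nonneg (toL2 v)]
  induction k generalizing u v with
  | zero => simpa [sn] using h0
  | succ k ih =>
    have hi : ∀ i, sn k (Z i v) ≤ 4 ^ k * A := fun i => by
      have hu' : ∀ n, sn k (Z i (u n)) ≤ A := fun n => (sn_Z_le i k _).trans (h n)
      have hv' : ∀ q, Tendsto (fun n => sInt (Z i (u n) * q)) atTop (𝓝 (sInt (Z i v * q))) :=
        fun q => by simpa only [sInt_Z_mul] using (hv (Z i q)).neg
      refine ih hu' hv' ?_
      have h1 : ‖toL2 (Z i v)‖ ^ 2 ≤ A * ‖toL2 (Z i v)‖ := by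
        rw [norm_toL2_sq]
        exact le_of_tendsto' (hv' (Z i v)) fun n => (le_abs_self _).trans
          ((abs_sInt_mul_le _ _).trans (by gcongr; exact (norm_le_sn k _).trans (hu' n)))
      by_contra hlt
      nlinarith [norm_nonneg (toL2 (Z i v))]
    rw [sn_succ, Fin.sum_univ_three, pow_succ]
    have h4 : A ≤ 4 ^ k * A := le_mul_of_one_le_left hA (one_le_pow₀ (by norm_num))
    linarith [hi 0, hi 1, hi 2]

lemma Conv.tendsto_integral {j : ℕ} {p : ℕ → SPoly} {F : S2 → ℝ} (h : Conv j p F) {q : S2 → ℝ}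
    (hq : Continuous q) :
    Tendsto (fun n => ∫ x, p n x * q x ∂area) atTop (𝓝 (∫ x, F x * q x ∂area)) := by
  obtain ⟨c, hc⟩ := h.exists_dist_le
  have hF := h.continuous
  refine tendsto_integral_of_dominated_convergence (fun x => (|F x| + |c|) * |q x|)
    (fun n => ((p n).continuous.mul hq).aestronglyMeasurable)
    (integrable_of_continuous (by fun_prop)) (fun n => ae_of_all _ fun x => ?_)
    (ae_of_all _ fun x => (h.tendsto x).mul_const _)
  rw [norm_mul, Real.norm_eq_abs, Real.norm_eq_abs]
  gcongr
  have h1 := hc n x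
  rw [Real.dist_eq] at h1
  have h2 : c * (1 / 2) ^ n ≤ |c| * 1 :=
    mul_le_mul (le_abs_self c) (pow_le_one₀ (by norm_num) (by norm_num)) (by positivity)
      (abs_nonneg c)
  have h3 := abs_sub_abs_le_abs_sub (p n x) (F x)
  linarith

/-- Convergence is only known in order `j + 4`, which may be below `k`. The bound of order `k`
passes to each projection of the limit by lower semicontinuity, at the cost of the inner `4 ^ k`;
the outer one comes from returning to the Sobolev norm. -/
theorem Conv.sobolevSq_le {j k : ℕ} {p : ℕ → SPoly} {F : S2 → ℝ} (h : Conv j p F) {A : ℝ}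
    (hA : ∀ n, sn k (p n) ≤ A) : sobolevSq k F ≤ ENNReal.ofReal (4 ^ k * (4 ^ k * A) ^ 2) := by
  have hA0 : 0 ≤ A := (sn_nonneg _ _).trans (hA 0)
  have hm := memLp_of_continuous h.continuous
  refine SphereSeed.sobolevSq_le hm fun N => ?_
  refine sn_le_of_tendsto (u := fun n => pr N (p n)) (fun n => (sn_pr_le N k _).trans (hA n))
    fun q => ?_
  have e : ∀ u v, sInt (pr N u * v) = sInt (u * pr N v) := fun u v => by
    rw [← sInt_pr_mul u (pr_mem N v), mul_comm, ← sInt_pr_mul v (pr_mem N u), mul_comm]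
  have e1 : sInt (proj N (hm.toLp F) * q) = ∫ x, F x * pr N q x ∂area := by
    rw [mul_comm, ← sInt_pr_mul q (proj_mem N _), mul_comm, inner_proj N _ (pr_mem N q), toL2_eq,
      inner_toLp]
  rw [e1]
  simp only [e, sInt_apply, mul_fun]
  exact h.tendsto_integral (pr N q).continuous

/-- The coarser truncation is the projection of the finer one, so their difference is a truncation
error at degree `2 ^ (n + 1)`. -/
lemma bd_proj {k : ℕ} (hk : 2 ≤ k) {F : L2} {A : ℝ} (h : ∀ N, sn k (proj N F) ≤ A) (n : ℕ) :
    Bd k ((1 / 2) ^ (n + 1)) ((k + 1) * A) (proj (2 ^ (n + 1)) F) (proj (2 ^ (n + 2)) F) := by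
  have hA : 0 ≤ A := (sn_nonneg _ _).trans (h 0)
  have hle : A ≤ (k + 1) * A := le_mul_of_one_le_left hA (by simp)
  refine ⟨(h _).trans hle, (h _).trans hle, ?_⟩
  have h1 := sn_sub_pr_le (2 ^ (n + 1)) (k - 2) (proj (2 ^ (n + 2)) F)
  have e : pr (2 ^ (n + 1)) (proj (2 ^ (n + 2)) F) = proj (2 ^ (n + 1)) F :=
    proj_proj (Nat.pow_le_pow_right (by norm_num) (by lia)) F
  rw [e, sn_sub_comm, show k - 2 + 1 = k - 1 by lia] at h1
  have hN : (0 : ℝ) < ((2 ^ (n + 1) : ℕ) : ℝ) + 1 := by positivity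
  have h2 : (((k - 2 : ℕ) : ℝ) + 1) * sn (k - 1) (proj (2 ^ (n + 2)) F) ≤ (k + 1) * A := by
    have : ((k - 2 : ℕ) : ℝ) ≤ k := by exact_mod_cast Nat.sub_le k 2
    exact mul_le_mul (by linarith) ((sn_mono (by lia) _).trans (h _)) (sn_nonneg _ _)
      (by positivity)
  calc _ = 1 / (((2 ^ (n + 1) : ℕ) : ℝ) + 1) * ((((2 ^ (n + 1) : ℕ) : ℝ) + 1) *
        sn (k - 2) (proj (2 ^ (n + 1)) F - proj (2 ^ (n + 2)) F)) := by field_simp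
    _ ≤ _ := mul_le_mul (one_div_two_pow_succ_le n) (h1.trans h2)
        (mul_nonneg hN.le (sn_nonneg _ _)) (by positivity)

theorem Bd.exists_conv {j : ℕ} {δ τ : ℝ} {p : ℕ → SPoly}
    (h : ∀ n, Bd (j + 6) ((1 / 2) ^ n * τ) δ (p n) (p (n + 1))) : ∃ F, Conv j p F :=
  SphereSeed.exists_conv ⟨τ * δ, fun n => by
    have := (h n).diff
    rw [show j + 6 - 2 = j + 4 by lia] at this
    linarith⟩

/-- The limit of the truncations has the same inner products with polynomials as `f`, hence equals
`f` almost everywhere by density, and everywhere by continuity. -/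
theorem conv_proj {j : ℕ} {f : S2 → ℝ} (hf : Continuous f) {A : ℝ}
    (h : ∀ N, sn (j + 6) (proj N ((memLp_of_continuous hf).toLp f)) ≤ A) :
    Conv j (fun n => proj (2 ^ (n + 1)) ((memLp_of_continuous hf).toLp f)) f := by
  set F := (memLp_of_continuous hf).toLp f with hF
  obtain ⟨G, hG⟩ := Bd.exists_conv (τ := 1 / 2) (p := fun n => proj (2 ^ (n + 1)) F)
    fun n => by simpa only [← pow_succ] using bd_proj (k := j + 6) (by lia) h n
  suffices G = f by rwa [← this]
  have hm := memLp_of_continuous hG.continuous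
  have hinner : ∀ q : SPoly, inner ℝ (hm.toLp G - F) (toL2 q) = 0 := fun q => by
    have t1 := hG.tendsto_integral q.continuous
    have hp : Tendsto (fun n : ℕ => 2 ^ (n + 1)) atTop atTop :=
      (tendsto_pow_atTop_atTop_of_one_lt (by norm_num)).comp (tendsto_add_atTop_nat 1)
    have t2 := ((tendsto_proj F).comp hp).inner (𝕜 := ℝ) (tendsto_const_nhds (x := toL2 q))
    have t3 := tendsto_nhds_unique (t1.congr fun n => by
      rw [Function.comp_apply, inner_toL2, sInt_apply]; rfl) t2
    rw [inner_sub_left, ← t3, toL2_eq, inner_toLp, sub_self]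
  have h0 : hm.toLp G - F = 0 := by
    have : inner ℝ (hm.toLp G - F) (hm.toLp G - F) = (0 : ℝ) :=
      tendsto_nhds_unique ((tendsto_const_nhds (x := hm.toLp G - F)).inner (𝕜 := ℝ)
        (tendsto_proj (hm.toLp G - F))) (by simp only [hinner]; exact tendsto_const_nhds)
    exact inner_self_eq_zero.mp this
  have h1 : G =ᵐ[area] f := by
    rw [← MemLp.toLp_eq_toLp_iff hm (memLp_of_continuous hf)]
    exact sub_eq_zero.mp h0
  exact (Continuous.ae_eq_iff_eq area hG.continuous hf).mp h1

/-! ### Identities at a point -/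

lemma sum_X_D (f : SPoly) : ∑ k, X k * D k f = 0 := by
  obtain ⟨h0, h1, h2⟩ := D_eq f
  rw [Fin.sum_univ_three, h0, h1, h2]
  ring

/-- In `(x × b) · (x × ∇f) = b · ∇f - (x · b)(x · ∇f)` the last term vanishes for the tangential
gradient. -/
lemma adv_frame (b : Fin 3 → SPoly) (f : SPoly) : adv (frame b) f = ∑ k, b k * D k f := by
  obtain ⟨h0, h1, h2⟩ := D_eq f
  simp only [adv, frame, Fin.sum_univ_three, Matrix.cons_val, h0, h1, h2]
  ring

/-- Jacobi's formula for the determinant of `1 + h`. -/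
lemma D_uE (h : Fin 3 → Fin 3 → SPoly) (l : Fin 3) : D l (uE h) =
    ∑ i, ∑ j, adj3 (fun i j => (if i = j then 1 else 0) + h i j) j i * D l (h i j) := by
  simp [uE, adj3, Fin.sum_univ_three]
  ring

lemma D_gE (h : Fin 3 → Fin 3 → SPoly) (i l j : Fin 3) : D i (gE h l j) =
    D i (h l j) - (((if i = l then 1 else 0) - X i * X l) * X j +
      X l * ((if i = j then 1 else 0) - X i * X j)) := by
  have h0 : D i (if l = j then (1 : SPoly) else 0) = 0 := by split_ifs <;> simp
  rw [gE, map_add, map_sub, h0, D_mul, D_X, D_X]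
  ring

/-- The contraction of the covariant derivative with the area form. -/
lemma curl_identity (x b : Fin 3 → ℝ) (B h : Fin 3 → Fin 3 → ℝ) (H : Fin 3 → Fin 3 → Fin 3 → ℝ)
    (hH : ∀ i j l, H i j l = H i l j) (e P : Fin 3 → Fin 3 → ℝ) (dg : Fin 3 → Fin 3 → Fin 3 → ℝ)
    (he : ∀ i j, e i j = x ⬝ᵥ crossProduct (Pi.single i 1 : Fin 3 → ℝ) (Pi.single j 1))
    (hP : ∀ i j, P i j = (if i = j then 1 else 0) - x i * x j)
    (hdg : ∀ i l j, dg i l j = H i l j - (P i l * x j + x l * P i j)) :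
    ∑ i, ∑ j, e i j * ((∑ l, (P j l + h j l) * B i l) + 1 / 2 * ∑ l, b l *
      (dg i l j + dg l i j - dg j i l)) =
    ∑ i, ∑ j, e i j * (B i j + ∑ l, (H i j l * b l + h j l * B i l)) := by
  have e00 : ∀ i, e i i = 0 := fun i => by rw [he, cross_self, dotProduct_zero]
  have e01 : e 0 1 = x 2 ∧ e 1 0 = -x 2 ∧ e 1 2 = x 0 ∧ e 2 1 = -x 0 ∧ e 2 0 = x 1 ∧
      e 0 2 = -x 1 := by
    simp [he, crossProduct, dotProduct, Fin.sum_univ_three]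
  obtain ⟨h1, h2, h3, h4, h5, h6⟩ := e01
  simp only [Fin.sum_univ_three, e00, h1, h2, h3, h4, h5, h6, hdg, hP]
  simp only [hH _ 1 0, hH _ 2 0, hH _ 2 1]
  simp
  ring

/-- The contraction of the covariant derivative with the inverse metric. -/
lemma div_identity (x b : Fin 3 → ℝ) (A g B : Fin 3 → Fin 3 → ℝ) (dg H : Fin 3 → Fin 3 → Fin 3 → ℝ)
    (P h T : Fin 3 → Fin 3 → ℝ)
    (hA : ∀ i j, A i j = A j i) (hAx : ∀ i, ∑ j, A i j * x j = 0)
    (hAg : ∀ i l, ∑ j, A i j * g j l = P i l)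
    (hP : ∀ i j, P i j = (if i = j then 1 else 0) - x i * x j)
    (hdg : ∀ i l j, dg i l j = H i l j - (P i l * x j + x l * P i j))
    (hB : ∀ l, ∑ i, x i * B i l = 0) (hT : ∀ i j, A i j = T i j - x i * x j)
    (hh : ∀ j, ∑ i, x i * h i j = 0) (hHs : ∀ i j l, H i j l = H i l j)
    (hH : ∀ l i, ∑ j, (H l i j * x j + h i j * P l j) = 0) :
    ∑ i, ∑ j, A i j * ((∑ l, g j l * B i l) + 1 / 2 * ∑ l, b l *
      (dg i l j + dg l i j - dg j i l)) =
    ∑ k, B k k + 1 / 2 * ∑ l, b l * ∑ i, ∑ j, T i j * H l i j := by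
  have h1 : ∑ i, ∑ j, A i j * ∑ l, g j l * B i l = ∑ k, B k k := by
    have : ∀ i, ∑ j, A i j * ∑ l, g j l * B i l = ∑ l, P i l * B i l := fun i => by
      simp only [← hAg, Finset.sum_mul, Finset.mul_sum]
      rw [Finset.sum_comm]
      exact Finset.sum_congr rfl fun _ _ => Finset.sum_congr rfl fun _ _ => by ring
    simp only [this]
    simp only [Fin.sum_univ_three, hP] at hB ⊢
    simp
    linear_combination -x 0 * hB 0 - x 1 * hB 1 - x 2 * hB 2
  -- The derivative of the round part dies against `A x = 0`; the normal part `x xᵀ` of `T`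
  -- contributes nothing, by the differentiated relation `h x = 0`.
  have h2 : ∀ l, ∑ i, ∑ j, A i j * dg l i j = ∑ i, ∑ j, T i j * H l i j := fun l => by
    have t1 : ∑ i, x i * ∑ j, (H l i j * x j + h i j * P l j) = 0 := by simp only [hH, mul_zero,
      Finset.sum_const_zero]
    have a0 := hAx 0
    have a1 := hAx 1
    have a2 := hAx 2
    have g0 := hh 0
    have g1 := hh 1
    have g2 := hh 2
    have s1 := hA 1 0
    have s2 := hA 2 0
    have s3 := hA 2 1
    have e : ∀ i j, T i j = A i j + x i * x j := fun i j => by rw [hT]; ring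
    simp only [Fin.sum_univ_three, hdg, e, s1, s2, s3] at *
    linear_combination -t1 + P l 0 * g0 + P l 1 * g1 + P l 2 * g2 - 2 * P l 0 * a0 - 2 * P l 1 * a1
      - 2 * P l 2 * a2
  -- An expression antisymmetric in `i, j` against the symmetric `A`.
  have h3 : ∀ l, ∑ i, ∑ j, A i j * (dg i l j - dg j i l) = 0 := fun l => by
    simp only [Fin.sum_univ_three, hdg, hA 1 0, hA 2 0, hA 2 1, hHs _ _ l]
    ring
  have h4 : ∀ i j, A i j * ((∑ l, g j l * B i l) + 1 / 2 * ∑ l, b l *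
      (dg i l j + dg l i j - dg j i l)) = A i j * (∑ l, g j l * B i l) + 1 / 2 * ∑ l, b l *
      (A i j * dg l i j + A i j * (dg i l j - dg j i l)) := fun i j => by
    simp only [Fin.sum_univ_three]
    ring
  simp only [h4, Finset.sum_add_distrib, h1]
  congr 1
  simp only [← Finset.mul_sum]
  congr 1
  have h5 : ∀ F : Fin 3 → Fin 3 → Fin 3 → ℝ, ∑ i, ∑ j, ∑ l, b l * F i j l =
      ∑ l, b l * ∑ i, ∑ j, F i j l := fun F => by
    simp only [Fin.sum_univ_three]
    ring
  rw [h5 fun i j l => A i j * dg l i j + A i j * (dg i l j - dg j i l)]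
  simp only [Finset.sum_add_distrib, h3, add_zero, h2]

/-! ### Further properties of geometrically convergent sequences -/

lemma Conv.add {j : ℕ} {p q : ℕ → SPoly} {F G : S2 → ℝ} (h : Conv j p F) (h' : Conv j q G) :
    Conv j (fun n => p n + q n) (fun x => F x + G x) := by
  obtain ⟨c, hc⟩ := h.bound
  obtain ⟨c', hc'⟩ := h'.bound
  refine ⟨⟨c + c', fun n => ?_⟩, fun x => (h.tendsto x).add (h'.tendsto x)⟩
  rw [add_sub_add_comm, add_mul]
  exact (sn_add_le _ _ _).trans (add_le_add (hc n) (hc' n))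

lemma Conv.mul_X {j : ℕ} {p : ℕ → SPoly} {F : S2 → ℝ} (h : Conv j p F) (k : Fin 3) :
    Conv j (fun n => p n * X k) (fun x => F x * (x : E3) k) := by
  obtain ⟨c, hc⟩ := h.bound
  obtain ⟨P, hP, hX⟩ := sn_X_mul_le (j + 4)
  refine ⟨⟨P * c, fun n => ?_⟩, fun x => ?_⟩
  · rw [← sub_mul, mul_comm, mul_assoc]
    exact (hX _ _).trans (by gcongr; exact hc n)
  · simpa using (h.tendsto x).mul_const ((x : E3) k)

lemma conv_const (j : ℕ) (f : SPoly) : Conv j (fun _ => f) f :=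
  ⟨⟨0, fun n => by simp⟩, fun _ => tendsto_const_nhds⟩

lemma pd_const (k : Fin 3) (c : ℝ) (x : S2) : pd k (fun _ => c) x = 0 := by
  have h := (conv_const 1 (algebraMap ℝ SPoly c)).tendsto_pd k x
  have e : (fun _ => c : S2 → ℝ) = (algebraMap ℝ SPoly c : SPoly) := by
    funext y; rw [algebraMap_fun]
  rw [e]
  simpa using tendsto_nhds_unique h tendsto_const_nhds

lemma Conv.sum_mul_pd {j : ℕ} {p : ℕ → SPoly} {F : S2 → ℝ} (h : Conv (j + 1) p F) (x : S2) :
    ∑ k, (x : E3) k * pd k F x = 0 := by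
  have h1 := tendsto_finsetSum Finset.univ fun k _ =>
    (h.tendsto_pd k x).const_mul ((x : E3) k)
  refine tendsto_nhds_unique h1 (tendsto_const_nhds.congr fun n => ?_)
  have := congrArg (fun f : SPoly => f x) (sum_X_D (p n))
  simpa using this.symm

/-- A bound in one order more than the Sobolev embedding needs makes the truncation error tend to
zero uniformly. -/
lemma tendsto_pr {q : ℕ → SPoly} {A : ℝ} (h : ∀ n, sn 5 (q n) ≤ A) {x : S2} {L : ℝ}
    (hq : Tendsto (fun n => q n x) atTop (𝓝 L)) :
    Tendsto (fun n => pr (2 ^ (n + 1)) (q n) x) atTop (𝓝 L) := by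
  obtain ⟨C, hC, hs⟩ := exists_abs_le_sn
  have h0 : Tendsto (fun n : ℕ => C * (5 * A) * (1 / 2 : ℝ) ^ (n + 1)) atTop (𝓝 0) := by
    simpa using ((tendsto_pow_atTop_nhds_zero_of_lt_one (by norm_num : (0 : ℝ) ≤ 1 / 2)
      (by norm_num)).comp (tendsto_add_atTop_nat 1)).const_mul (C * (5 * A))
  have h1 : Tendsto (fun n => q n x - pr (2 ^ (n + 1)) (q n) x) atTop (𝓝 0) := by
    refine squeeze_zero_norm (fun n => ?_) h0
    rw [← sub_fun, Real.norm_eq_abs]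
    refine (hs _ x).trans ?_
    have h2 := sn_sub_pr_le (2 ^ (n + 1)) 4 (q n)
    have h3 : (((4 : ℕ) : ℝ) + 1) * sn (4 + 1) (q n) ≤ 5 * A := by
      have := h n
      norm_num
      linarith
    have hN : (0 : ℝ) < ((2 ^ (n + 1) : ℕ) : ℝ) + 1 := by positivity
    have h4 : sn 4 (q n - pr (2 ^ (n + 1)) (q n)) ≤ (1 / 2) ^ (n + 1) * (5 * A) := by
      calc _ = 1 / (((2 ^ (n + 1) : ℕ) : ℝ) + 1) * ((((2 ^ (n + 1) : ℕ) : ℝ) + 1) *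
            sn 4 (q n - pr (2 ^ (n + 1)) (q n))) := by field_simp
        _ ≤ _ := mul_le_mul (one_div_two_pow_succ_le n) (h2.trans h3)
            (mul_nonneg hN.le (sn_nonneg _ _)) (by positivity)
    calc _ ≤ C * ((1 / 2) ^ (n + 1) * (5 * A)) := by gcongr
      _ = _ := by ring
  simpa using hq.sub h1

/-! ### Geometric quantities of the limit -/

/-- The deviation of `g` from the round metric is the limit of `h`, the vector field is the limit
of `β`, and `1 + V` is the inverse of the density. -/
structure IsLimit (g : S2 → Matrix (Fin 3) (Fin 3) ℝ) (b : S2 → E3) (V : S2 → ℝ)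
    (h : ℕ → Fin 3 → Fin 3 → SPoly) (β : ℕ → Fin 3 → SPoly) (v : ℕ → SPoly) : Prop where
  metric : IsMetric g
  h : ∀ i j, Conv 1 (fun n => h n i j) (fun x => (g x - SphereSeed.round x) i j)
  b : ∀ i, Conv 1 (fun n => β n i) (fun x => b x i)
  v : Conv 0 v V
  det : ∀ x, (g x + normal x).det * (1 + V x) ^ 2 = 1

lemma normal_apply (x : S2) (i j : Fin 3) : normal x i j = (x : E3) i * (x : E3) j := rfl

lemma round_apply (x : S2) (i j : Fin 3) :
    SphereSeed.round x i j = (if i = j then 1 else 0) - (x : E3) i * (x : E3) j := by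
  rw [SphereSeed.round, Matrix.sub_apply, Matrix.one_apply, normal_apply]

lemma sum_coe_sq (x : S2) : ∑ k, (x : E3) k * (x : E3) k = 1 := by
  have := congrArg (fun f : SPoly => f x) sum_X_sq
  simpa using this

lemma ite_fun (p : Prop) [Decidable p] (x : S2) :
    (if p then 1 else 0 : SPoly) x = if p then 1 else 0 := by
  split_ifs <;> simp

namespace IsLimit

variable {g : S2 → Matrix (Fin 3) (Fin 3) ℝ} {b : S2 → E3} {V : S2 → ℝ}
  {h : ℕ → Fin 3 → Fin 3 → SPoly} {β : ℕ → Fin 3 → SPoly} {v : ℕ → SPoly}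

lemma conv_g (H : IsLimit g b V h β v) (i j : Fin 3) :
    Conv 1 (fun n => gE (h n) i j) (fun x => g x i j) := by
  have h1 := (H.h i j).add_const_seq ((if i = j then 1 else 0) - X i * X j)
  have e1 : (fun n => gE (h n) i j) =
      fun n => h n i j + ((if i = j then 1 else 0) - X i * X j) := by
    funext n; rw [gE]; ring
  have e2 : (fun x => g x i j) = fun x => (g x - SphereSeed.round x) i j +
      ((if i = j then 1 else 0) - X i * X j : SPoly) x := by
    funext x
    rw [Matrix.sub_apply, round_apply, sub_fun, mul_fun, X_fun, X_fun, ite_fun]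
    ring
  rwa [e1, e2]

lemma tendsto_covE (H : IsLimit g b V h β v) (x : S2) (i j : Fin 3) :
    Tendsto (fun n => covE (h n) (β n) i j x) atTop (𝓝 (covD g b x i j)) := by
  have hg := fun i j => (H.conv_g i j).tendsto x
  have hdg := fun k i j => (H.conv_g i j).tendsto_pd k x
  have hb := fun i => (H.b i).tendsto x
  have hdb := fun k i => (H.b i).tendsto_pd k x
  simp only [covE, add_fun, sum_fun, mul_fun, smul_fun, sub_fun]
  exact (tendsto_finsetSum _ fun l _ => (hg j l).mul (hdb i l)).add
    ((tendsto_finsetSum _ fun l _ => (hb l).mul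
      (((hdg i l j).add (hdg l i j)).sub (hdg j i l))).const_mul _)

lemma h_symm (H : IsLimit g b V h β v) (x : S2) (i j : Fin 3) :
    (g x - SphereSeed.round x) i j = (g x - SphereSeed.round x) j i := by
  have := (H.metric.symm x).apply i j
  rw [Matrix.sub_apply, Matrix.sub_apply, round_apply, round_apply, this, mul_comm]
  simp only [eq_comm]

lemma sum_g_mul (H : IsLimit g b V h β v) (x : S2) (i : Fin 3) :
    ∑ j, g x i j * (x : E3) j = 0 := by
  simpa [Matrix.mulVec, dotProduct] using congrFun (H.metric.tangential x) i

lemma sum_h_mul (H : IsLimit g b V h β v) (x : S2) (i : Fin 3) :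
    ∑ j, (g x - SphereSeed.round x) i j * (x : E3) j = 0 := by
  have h1 := H.sum_g_mul x i
  have h2 := sum_coe_sq x
  simp only [Matrix.sub_apply, round_apply, Fin.sum_univ_three] at *
  fin_cases i <;> simp at * <;> linear_combination h1 + (x : E3) _ * h2

lemma det_ne_zero (H : IsLimit g b V h β v) (x : S2) : (g x + normal x).det ≠ 0 := fun h0 => by
  have := H.det x
  rw [h0, zero_mul] at this
  exact zero_ne_one this

/-- `g x` annihilates `x`, so `x` is an eigenvector of `g x + x xᵀ` with eigenvalue `1`. -/
lemma inv_mul_normal (H : IsLimit g b V h β v) (x : S2) :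
    (g x + normal x)⁻¹ * normal x = normal x := by
  have h1 : (g x + normal x) * normal x = normal x := by
    ext i j
    have h1 := H.sum_g_mul x i
    have h2 := sum_coe_sq x
    simp only [Matrix.mul_apply, Matrix.add_apply, normal_apply, Fin.sum_univ_three] at *
    linear_combination (x : E3) j * h1 + (x : E3) i * (x : E3) j * h2
  have hu : IsUnit (g x + normal x).det := (H.det_ne_zero x).isUnit
  calc _ = (g x + normal x)⁻¹ * ((g x + normal x) * normal x) := by rw [h1]
    _ = _ := Matrix.nonsing_inv_mul_cancel_left _ _ hu

lemma normal_mul_normal (x : S2) : normal x * normal x = normal x := by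
  ext i j
  have h2 := sum_coe_sq x
  simp only [Matrix.mul_apply, normal_apply, Fin.sum_univ_three] at *
  linear_combination (x : E3) i * (x : E3) j * h2

/-- Cramer's rule, with `(1 + V)²` as the inverse determinant; it makes the inverse metric
polynomial in `h` and `V`. -/
lemma inverse_apply (H : IsLimit g b V h β v) (x : S2) (i j : Fin 3) : inverse g x i j =
    adj3 (fun i j => (if i = j then 1 else 0) + (g x - SphereSeed.round x) i j) i j *
      ((1 + V x) * (1 + V x)) - (x : E3) i * (x : E3) j := by
  have e : ∀ i j, (if i = j then 1 else 0) + (g x - SphereSeed.round x) i j =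
      (g x + normal x) i j := fun i j => by
    rw [Matrix.sub_apply, Matrix.add_apply, round_apply, normal_apply]; ring
  have hd : (g x + normal x).det⁻¹ = (1 + V x) * (1 + V x) := by
    have := H.det x
    rw [inv_eq_iff_eq_inv, eq_comm, inv_eq_iff_eq_inv, ← one_div, eq_div_iff (H.det_ne_zero x)]
    linarith
  simp only [e]
  rw [inverse, Matrix.sub_apply, normal_apply, Matrix.inv_def, Matrix.smul_apply,
    Ring.inverse_eq_inv', hd, Matrix.adjugate_fin_three, smul_eq_mul, mul_comm]
  congr 2
  fin_cases i <;> fin_cases j <;> simp [adj3] <;> ring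

lemma tendsto_invE (H : IsLimit g b V h β v) (x : S2) (i j : Fin 3) :
    Tendsto (fun n => invE (h n) (v n) i j x) atTop (𝓝 (inverse g x i j)) := by
  have hg : ∀ i j, Tendsto (fun n => (if i = j then 1 else 0) + h n i j x) atTop
    (𝓝 ((if i = j then 1 else 0) + (g x - SphereSeed.round x) i j)) :=
    fun i j => ((H.h i j).tendsto x).const_add _
  have hv := ((H.v).tendsto x).const_add 1
  rw [H.inverse_apply]
  simp only [invE, adj3, sub_fun, mul_fun, add_fun, ite_fun, one_fun, X_fun]
  exact ((((hg _ _).mul (hg _ _)).sub ((hg _ _).mul (hg _ _))).mul (hv.mul hv)).sub_const _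

lemma pd_g (H : IsLimit g b V h β v) (x : S2) (i l j : Fin 3) : pd i (fun y => g y l j) x =
    pd i (fun y => (g y - SphereSeed.round y) l j) x -
      (((if i = l then 1 else 0) - (x : E3) i * (x : E3) l) * (x : E3) j +
        (x : E3) l * ((if i = j then 1 else 0) - (x : E3) i * (x : E3) j)) := by
  have h1 := (H.conv_g l j).tendsto_pd i x
  have h2 := ((H.h l j).tendsto_pd i x).sub_const
    (((if i = l then 1 else 0) - (x : E3) i * (x : E3) l) * (x : E3) j +
        (x : E3) l * ((if i = j then 1 else 0) - (x : E3) i * (x : E3) j))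
  refine tendsto_nhds_unique h1 (h2.congr fun n => ?_)
  simp only [D_gE, sub_fun, add_fun, mul_fun, ite_fun, X_fun]

lemma pd_h_symm (H : IsLimit g b V h β v) (x : S2) (i l j : Fin 3) :
    pd i (fun y => (g y - SphereSeed.round y) l j) x =
      pd i (fun y => (g y - SphereSeed.round y) j l) x := by
  simp only [fun y => H.h_symm y l j]

/-- The relation `h x = 0`, differentiated in the tangential direction `l`. -/
lemma sum_pd_h_mul (H : IsLimit g b V h β v) (x : S2) (l i : Fin 3) :
    ∑ j, (pd l (fun y => (g y - SphereSeed.round y) i j) x * (x : E3) j +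
      (g x - SphereSeed.round x) i j *
        ((if l = j then 1 else 0) - (x : E3) l * (x : E3) j)) = 0 := by
  have h0 := (((H.h i 0).mul_X 0).add ((H.h i 1).mul_X 1)).add ((H.h i 2).mul_X 2)
  have e : (fun y : S2 => (g y - SphereSeed.round y) i 0 * (y : E3) 0 +
      (g y - SphereSeed.round y) i 1 * (y : E3) 1 +
      (g y - SphereSeed.round y) i 2 * (y : E3) 2) = fun _ => 0 := by
    funext y
    have := H.sum_h_mul y i
    rwa [Fin.sum_univ_three] at this
  rw [e] at h0
  have h1 := h0.tendsto_pd l x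
  rw [pd_const] at h1
  refine tendsto_nhds_unique (tendsto_finsetSum _ fun j _ =>
    (((H.h i j).tendsto_pd l x).mul_const _).add (((H.h i j).tendsto x).mul_const _))
    (h1.congr fun n => ?_)
  simp only [Fin.sum_univ_three, map_add, D_mul, D_X, add_fun, sub_fun, mul_fun, ite_fun, X_fun]

/-- The divergence in terms of the round divergence. -/
lemma div_eq (H : IsLimit g b V h β v) (x : S2) : div g b x =
    ∑ k, pd k (fun y => b y k) x + 1 / 2 * ∑ l, b x l * ∑ i, ∑ j,
      (adj3 (fun i j => (if i = j then 1 else 0) + (g x - SphereSeed.round x) i j) i j *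
      ((1 + V x) * (1 + V x))) * pd l (fun y => (g y - SphereSeed.round y) i j) x := by
  have hN := H.inv_mul_normal x
  have hsG : (g x + normal x).IsSymm := (H.metric.symm x).add (by
    ext i j; rw [Matrix.transpose_apply, normal_apply, normal_apply, mul_comm])
  have hA : (inverse g x).IsSymm := by
    refine Matrix.IsSymm.sub ?_ (by
      ext i j; rw [Matrix.transpose_apply, normal_apply, normal_apply, mul_comm])
    rw [Matrix.IsSymm, Matrix.transpose_nonsing_inv, hsG.eq]
  refine div_identity (x : E3).ofLp (b x).ofLp (inverse g x) (g x)
    (fun i l => pd i (fun y => b y l) x) (fun i l j => pd i (fun y => g y l j) x)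
    (fun i l j => pd i (fun y => (g y - SphereSeed.round y) l j) x) (SphereSeed.round x)
    (g x - SphereSeed.round x) _ (fun i j => hA.apply j i) (fun i => ?_) (fun i l => ?_)
    (round_apply x) (fun i l j => ?_) (fun l => (H.b l).sum_mul_pd x) (H.inverse_apply x)
    (fun j => ?_) (H.pd_h_symm x) (fun l i => ?_)
  · have h1 : inverse g x * normal x = 0 := by
      rw [inverse, sub_mul, hN, normal_mul_normal, sub_self]
    have h2 := fun j => congrFun (congrFun h1 i) j
    have h3 := sum_coe_sq x
    simp only [Matrix.mul_apply, normal_apply, Matrix.zero_apply, Fin.sum_univ_three] at h2 h3 ⊢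
    linear_combination (x : E3) 0 * h2 0 + (x : E3) 1 * h2 1 + (x : E3) 2 * h2 2 -
      (inverse g x i 0 * (x : E3) 0 + inverse g x i 1 * (x : E3) 1 +
        inverse g x i 2 * (x : E3) 2) * h3
  · have h1 : inverse g x * g x = SphereSeed.round x := by
      have h2 : normal x * g x = 0 := by
        ext i j
        have := H.sum_g_mul x j
        have s := fun k => (H.metric.symm x).apply k j
        simp only [Matrix.mul_apply, normal_apply, Matrix.zero_apply, Fin.sum_univ_three, s] at *
        linear_combination (x : E3) i * this
      have h3 : (g x + normal x)⁻¹ * g x = 1 - normal x := by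
        calc _ = (g x + normal x)⁻¹ * (g x + normal x - normal x) := by rw [add_sub_cancel_right]
          _ = _ := by rw [mul_sub, hN, Matrix.nonsing_inv_mul _ (H.det_ne_zero x).isUnit]
      rw [inverse, sub_mul, h2, h3, sub_zero, SphereSeed.round]
    simpa [Matrix.mul_apply] using congrFun (congrFun h1 i) l
  · rw [H.pd_g, round_apply, round_apply]
  · have := H.sum_h_mul x j
    simp only [H.h_symm x _ j, mul_comm]
    simpa only [mul_comm] using this
  · simpa only [round_apply] using H.sum_pd_h_mul x l i

/-- Jacobi's formula writes `logE` with the transposed adjugate; as `h` is symmetric this is the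
trace term in `div_eq`. -/
lemma tendsto_logE (H : IsLimit g b V h β v) (x : S2) :
    Tendsto (fun n => logE (h n) (v n) (β n) x) atTop
      (𝓝 (div g b x - ∑ k, pd k (fun y => b y k) x)) := by
  have hg : ∀ i j, Tendsto (fun n => (if i = j then 1 else 0) + h n i j x) atTop
    (𝓝 ((if i = j then 1 else 0) + (g x - SphereSeed.round x) i j)) :=
    fun i j => ((H.h i j).tendsto x).const_add _
  have hv := ((H.v).tendsto x).const_add 1
  have hb := fun i => (H.b i).tendsto x
  have hdh := fun k i j => (H.h i j).tendsto_pd k x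
  have key := (tendsto_finsetSum Finset.univ fun l _ => (hb l).mul (tendsto_finsetSum Finset.univ
    fun i _ => tendsto_finsetSum Finset.univ fun j _ =>
    ((((hg (i + 1) (j + 1)).mul (hg (i + 2) (j + 2))).sub
      ((hg (i + 1) (j + 2)).mul (hg (i + 2) (j + 1)))).mul (hv.mul hv)).mul
      (hdh l i j))).const_mul (1 / 2)
  have e : ∀ (T : Fin 3 → Fin 3 → ℝ) (l : Fin 3),
      ∑ i, ∑ j, T i j * pd l (fun y => (g y - SphereSeed.round y) i j) x =
        ∑ i, ∑ j, T j i * pd l (fun y => (g y - SphereSeed.round y) i j) x := fun T l => by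
    rw [Finset.sum_comm]
    exact Finset.sum_congr rfl fun i _ => Finset.sum_congr rfl fun j _ => by rw [H.pd_h_symm]
  rw [H.div_eq, add_sub_cancel_left]
  simp only [e fun i j => adj3 (fun i j => (if i = j then 1 else 0) +
    (g x - SphereSeed.round x) i j) i j * ((1 + V x) * (1 + V x))]
  refine key.congr fun n => ?_
  rw [logE, adv_frame]
  simp only [D_uE, adj3, smul_fun, sub_fun, mul_fun, add_fun, ite_fun, one_fun, sum_fun]
  congr 1
  rw [Finset.mul_sum]
  refine Finset.sum_congr rfl fun l _ => ?_
  simp only [Finset.mul_sum]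
  refine Finset.sum_congr rfl fun i _ => Finset.sum_congr rfl fun j _ => ?_
  ring

lemma tendsto_divE (H : IsLimit g b V h β v) (x : S2) :
    Tendsto (fun n => divE (h n) (v n) (β n) x) atTop (𝓝 (div g b x)) := by
  have := (tendsto_finsetSum Finset.univ fun k _ => (H.b k).tendsto_pd k x).add (H.tendsto_logE x)
  simp only [divE, add_fun, sum_fun]
  rwa [add_sub_cancel] at this

lemma tendsto_hatE (H : IsLimit g b V h β v) (x : S2) (i j : Fin 3) :
    Tendsto (fun n => hatE (h n) (v n) (β n) i j x) atTop (𝓝 (hatD g b x i j)) := by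
  simp only [hatE, add_fun, sub_fun, mul_fun]
  exact ((H.tendsto_covE x i j).add (H.tendsto_covE x j i)).sub
    ((H.tendsto_divE x).mul ((H.conv_g i j).tendsto x))

lemma tendsto_hatSqE (H : IsLimit g b V h β v) (x : S2) :
    Tendsto (fun n => hatSqE (h n) (v n) (β n) x) atTop (𝓝 (hatDNormSq g b x)) := by
  simp only [hatSqE, sum_fun, mul_fun]
  exact tendsto_finsetSum _ fun i _ => tendsto_finsetSum _ fun j _ => tendsto_finsetSum _ fun k _ =>
    tendsto_finsetSum _ fun l _ => (((H.tendsto_invE x i k).mul (H.tendsto_invE x j l)).mul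
      (H.tendsto_hatE x i j)).mul (H.tendsto_hatE x k l)

lemma tendsto_quadE (H : IsLimit g b V h β v) {W : ℕ → SPoly} {a : ℕ → ℝ} {w a₀ : ℝ} (x : S2)
    (hW : Tendsto (fun n => W n x) atTop (𝓝 w)) (ha : Tendsto a atTop (𝓝 a₀)) :
    Tendsto (fun n => quadE (h n) (W n) (v n) (β n) (a n) x) atTop
      (𝓝 (1 / 2 * (div g b x * div g b x) + 4 * ((w + a₀) * div g b x) +
        1 / 4 * hatDNormSq g b x)) := by
  have hd := H.tendsto_divE x
  simp only [quadE, add_fun, smul_fun, mul_fun, algebraMap_fun]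
  exact (((hd.mul hd).const_mul _).add (((hW.add ha).mul hd).const_mul _)).add
    ((H.tendsto_hatSqE x).const_mul _)

lemma tendsto_adv (H : IsLimit g b V h β v) {f : ℕ → SPoly} {F : S2 → ℝ} (hf : Conv 1 f F)
    (x : S2) : Tendsto (fun n => adv (frame (β n)) (f n) x) atTop (𝓝 (lie b F x)) := by
  simp only [adv_frame, sum_fun, mul_fun]
  exact tendsto_finsetSum _ fun k _ => ((H.b k).tendsto x).mul (hf.tendsto_pd k x)

/-- The curl is the limit of the round curl of the lowered vector field. -/
lemma tendsto_curl (H : IsLimit g b V h β v) (hV : ∀ x, density g x * (1 + V x) = 1) (x : S2) :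
    Tendsto (fun n => (1 + V x) * (∑ j, Z j (β n j) + curlE (h n) (β n)) x) atTop
      (𝓝 (curl g b x)) := by
  have hd : (density g x)⁻¹ = 1 + V x := inv_eq_of_mul_eq_one_right (hV x)
  rw [curl, hd]
  refine Tendsto.const_mul _ ?_
  have key := curl_identity (x : E3).ofLp (b x).ofLp (fun i l => pd i (fun y => b y l) x)
    (g x - SphereSeed.round x)
    (fun i l j => pd i (fun y => (g y - SphereSeed.round y) l j) x) (H.pd_h_symm x)
    _ (SphereSeed.round x) (fun i l j => pd i (fun y => g y l j) x) (fun _ _ => rfl)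
    (round_apply x) fun i l j => by rw [H.pd_g, round_apply, round_apply]
  have hg : ∀ j l, SphereSeed.round x j l + (g x - SphereSeed.round x) j l = g x j l :=
    fun j l => by rw [Matrix.sub_apply]; ring
  simp only [hg] at key
  simp only [covD]
  rw [key]
  have hb := fun i => (H.b i).tendsto x
  have hdb := fun k i => (H.b i).tendsto_pd k x
  have hh := fun i j => (H.h i j).tendsto x
  have hdh := fun k i j => (H.h i j).tendsto_pd k x
  have t := tendsto_finsetSum Finset.univ fun i _ => tendsto_finsetSum Finset.univ fun j _ =>
    ((hdb i j).add (tendsto_finsetSum Finset.univ fun l _ =>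
      ((hdh i j l).mul (hb l)).add ((hh j l).mul (hdb i l)))).const_mul
      ((x : E3).ofLp ⬝ᵥ crossProduct (Pi.single i 1 : Fin 3 → ℝ) (Pi.single j 1))
  refine t.congr fun n => ?_
  have hZ : ∀ (j : Fin 3) (f : SPoly), Z j f x = ∑ i,
      ((x : E3).ofLp ⬝ᵥ crossProduct (Pi.single i 1 : Fin 3 → ℝ) (Pi.single j 1)) *
        D i f x := fun j f => by
    obtain ⟨h0, h1, h2⟩ := Z_eq f
    fin_cases j
    · simp [h0, crossProduct, Fin.sum_univ_three, dotProduct]; ring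
    · simp [h1, crossProduct, Fin.sum_univ_three, dotProduct]; ring
    · simp [h2, crossProduct, Fin.sum_univ_three, dotProduct]; ring
  rw [curlE, add_fun, sum_fun, sum_fun, ← Finset.sum_add_distrib, Finset.sum_comm]
  refine Finset.sum_congr rfl fun j _ => ?_
  rw [hZ, hZ, ← Finset.sum_add_distrib]
  refine Finset.sum_congr rfl fun i _ => ?_
  rw [← mul_add, ← add_fun, ← map_add]
  simp only [map_add, map_sum, D_mul, add_fun, sum_fun, mul_fun]

end IsLimit

/-! ### The limit of the iteration -/

/-- Geometrically decreasing scales. -/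
def geoScales : Scales ℕ :=
  ⟨fun n => (1 / 2) ^ n, fun _ => 1, fun _ => by positivity, fun _ => zero_le_one, fun _ => le_rfl⟩

lemma isO_geoScales {l m : ℕ} {p : ℕ → SPoly} {A : ℝ}
    (h : ∀ n, Bd l ((1 / 2) ^ n) A (p n) (p (n + 1))) :
    IsO geoScales l m p (fun n => p (n + 1)) :=
  ⟨A, (h 0).nonneg, fun n => by simpa [geoScales] using h n⟩

lemma IsO.exists_sn_le {l m : ℕ} {p q : ℕ → SPoly} (h : IsO geoScales l m p q) :
    ∃ A : ℝ, ∀ n, sn l (p n) ≤ A := by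
  obtain ⟨C, -, h⟩ := h
  exact ⟨C, fun n => by simpa [geoScales] using (h n).left⟩

lemma IsO.conv {j m : ℕ} {p : ℕ → SPoly} (h : IsO geoScales (j + 6) m p (fun n => p (n + 1)))
    {F : S2 → ℝ} (hF : ∀ x, Tendsto (fun n => p n x) atTop (𝓝 (F x))) : Conv j p F := by
  obtain ⟨C, -, h⟩ := h
  refine ⟨⟨C, fun n => ?_⟩, hF⟩
  have := (h n).diff
  simp only [geoScales, one_pow, mul_one] at this
  rw [show j + 6 - 2 = j + 4 by lia] at this
  linarith

lemma Bd.half_pow {l n : ℕ} {A : ℝ} {p q : SPoly} (h : Bd l ((1 / 2) ^ (n + 1)) A p q) :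
    Bd l ((1 / 2) ^ n) A p q :=
  h.mono le_rfl (mul_le_mul_of_nonneg_right
    (pow_le_pow_of_le_one (by norm_num) (by norm_num) n.le_succ) h.nonneg)

/-- A sequence of approximate solutions with uniform bounds. -/
structure Approx (k : ℕ) (A : ℝ) (d : ℕ → SData) (s : ℕ → SState) (f : ℕ → SPoly) : Prop where
  step : ∀ n, Step (2 ^ (n + 1)) (d n) (s n) (f n) (s (n + 1))
  d : ∀ n, DBd k ((1 / 2) ^ (n + 1)) A (d n) (d (n + 1))
  s : ∀ n, SBd k ((1 / 2) ^ n) A (s n) (s (n + 1))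
  f : ∀ n, Bd k ((1 / 2) ^ (n + 1)) A (f n) (f (n + 1))
  le_one : A ≤ 1

/-- The limits of a sequence of approximate solutions. -/
structure ApproxLim (d : ℕ → SData) (s : ℕ → SState) (f : ℕ → SPoly)
    (g : S2 → Matrix (Fin 3) (Fin 3) ℝ) (O W : S2 → ℝ) (b : S2 → E3) (V F : S2 → ℝ) (a : ℝ) :
    Prop where
  metric : IsMetric g
  h : ∀ i j, Conv 1 (fun n => (d n).h i j) (fun x => (g x - SphereSeed.round x) i j)
  O : Conv 0 (fun n => (d n).O) O
  W : Conv 0 (fun n => (d n).W) W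
  b : ∀ i, Conv 2 (fun n => (s n).b i) (fun x => b x i)
  v : Conv 0 (fun n => (s n).v) V
  f : Conv 1 f F
  a : Tendsto (fun n => (s n).a) atTop (𝓝 a)
  V_pos : ∀ x, 0 < 1 + V x

section

variable {k : ℕ} {A : ℝ} {d : ℕ → SData} {s : ℕ → SState} {f : ℕ → SPoly}
  {g : S2 → Matrix (Fin 3) (Fin 3) ℝ} {O W : S2 → ℝ} {b : S2 → E3} {V F : S2 → ℝ} {a : ℝ}

lemma Approx.isO_h (h : Approx k A d s f) (i j : Fin 3) :
    IsO geoScales (k + 1) 1 (fun n => (d n).h i j) (fun n => (d (n + 1)).h i j) :=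
  isO_geoScales fun n => ((h.d n).h i j).half_pow

lemma Approx.isO_O (h : Approx k A d s f) :
    IsO geoScales k 1 (fun n => (d n).O) (fun n => (d (n + 1)).O) :=
  isO_geoScales fun n => (h.d n).O.half_pow

lemma Approx.isO_W (h : Approx k A d s f) :
    IsO geoScales k 1 (fun n => (d n).W) (fun n => (d (n + 1)).W) :=
  isO_geoScales fun n => (h.d n).W.half_pow

lemma Approx.isO_b (h : Approx k A d s f) (i : Fin 3) :
    IsO geoScales (k + 1) 1 (fun n => (s n).b i) (fun n => (s (n + 1)).b i) :=
  isO_geoScales fun n => (h.s n).b i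

lemma Approx.isO_v (h : Approx k A d s f) :
    IsO geoScales k 1 (fun n => (s n).v) (fun n => (s (n + 1)).v) :=
  isO_geoScales fun n => (h.s n).v

lemma Approx.isO_f (h : Approx k A d s f) : IsO geoScales k 1 f (fun n => f (n + 1)) :=
  isO_geoScales fun n => (h.f n).half_pow

lemma Approx.isO_a (h : Approx k A d s f) :
    IsO geoScales k 1 (fun n => algebraMap ℝ SPoly (s n).a)
      (fun n => algebraMap ℝ SPoly (s (n + 1)).a) :=
  isO_algebraMap (fun n => (h.s n).a.trans h.le_one) (fun n => (h.s n).a'.trans h.le_one)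
    fun n => (h.s n).a_sub.trans (mul_le_mul_of_nonneg_left h.le_one (by positivity))

lemma Approx.exists_sn_source_le (hk : 11 ≤ k) (h : Approx k A d s f) :
    ∃ B : ℝ, ∀ n, sn 5 (adv (frame (s n).b) (f n) + srcE (d n) (s n)) ≤ B := by
  obtain ⟨k, rfl⟩ : ∃ l, k = l + 1 := ⟨k - 1, by lia⟩
  have h1 := (isO_adv (by lia) (isO_frame (by lia) fun i => (h.isO_b i).lower.lower) h.isO_f)
  have h2 := ((h.isO_W.smul (-8)).add
    ((isO_quadE (by lia) h.isO_h h.isO_W h.isO_v h.isO_b h.isO_a).weaken one_le_two)).lower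
  obtain ⟨B, hB⟩ := ((h1.weaken one_le_two).add h2).exists_sn_le
  exact ⟨B, fun n => (sn_mono (by lia) _).trans (hB n)⟩

lemma tendsto_uE {h : ℕ → Fin 3 → Fin 3 → SPoly} {x : S2}
    (hh : ∀ i j, Tendsto (fun n => h n i j x) atTop (𝓝 ((g x - SphereSeed.round x) i j))) :
    Tendsto (fun n => uE (h n) x) atTop (𝓝 ((g x + normal x).det - 1)) := by
  have e : ∀ i j, (g x + normal x) i j =
      (if i = j then 1 else 0) + (g x - SphereSeed.round x) i j := fun i j => by
    rw [Matrix.sub_apply, Matrix.add_apply, round_apply, normal_apply]; ring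
  have t := (((hh 0 0).add (hh 1 1)).add (hh 2 2)).add
    ((((((hh 0 0).mul (hh 1 1)).sub ((hh 0 1).mul (hh 1 0))).add
      (((hh 0 0).mul (hh 2 2)).sub ((hh 0 2).mul (hh 2 0)))).add
      (((hh 1 1).mul (hh 2 2)).sub ((hh 1 2).mul (hh 2 1)))).add
      ((((hh 0 0).mul (((hh 1 1).mul (hh 2 2)).sub ((hh 1 2).mul (hh 2 1)))).sub
        ((hh 0 1).mul (((hh 1 0).mul (hh 2 2)).sub ((hh 1 2).mul (hh 2 0))))).add
        ((hh 0 2).mul (((hh 1 0).mul (hh 2 1)).sub ((hh 1 1).mul (hh 2 0))))))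
  simp only [uE, add_fun, sub_fun, mul_fun]
  convert t using 2
  rw [Matrix.det_fin_three]
  simp only [e]
  simp
  ring

/-- The update `vRhs` is a rearrangement of `(1 + u)(1 + v)² = 1`, which its fixed point therefore
satisfies. -/
lemma ApproxLim.det (hs : ∀ n, Step (2 ^ (n + 1)) (d n) (s n) (f n) (s (n + 1)))
    (h : ApproxLim d s f g O W b V F a) (x : S2) : (g x + normal x).det * (1 + V x) ^ 2 = 1 := by
  have hu := tendsto_uE fun i j => (h.h i j).tendsto x
  have hv := h.v.tendsto x
  have h1 := (hu.add (((hu.mul hv).const_mul 2).add (hv.mul hv) |>.add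
    ((hu.mul hv).mul hv))).const_mul (-(1 / 2))
  have h2 := hv.comp (tendsto_add_atTop_nat 1)
  have := tendsto_nhds_unique h2 (h1.congr fun n => by
    rw [Function.comp_apply, (hs n).v_eq, vRhs]
    simp only [smul_fun, add_fun, mul_fun])
  linear_combination 2 * this

lemma ApproxLim.isLimit (hs : ∀ n, Step (2 ^ (n + 1)) (d n) (s n) (f n) (s (n + 1)))
    (h : ApproxLim d s f g O W b V F a) :
    IsLimit g b V (fun n => (d n).h) (fun n => (s n).b) (fun n => (s n).v) :=
  ⟨h.metric, h.h, fun i => (h.b i).mono one_le_two, h.v, h.det hs⟩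

/-- Positivity of `1 + V` selects the right square root of the inverse determinant. -/
lemma ApproxLim.density_mul (hs : ∀ n, Step (2 ^ (n + 1)) (d n) (s n) (f n) (s (n + 1)))
    (h : ApproxLim d s f g O W b V F a) (x : S2) : density g x * (1 + V x) = 1 := by
  have h1 := h.det hs x
  have h2 := h.V_pos x
  have h3 : (g x + normal x).det = (1 / (1 + V x)) ^ 2 := by
    field_simp
    linarith
  rw [density, h3, Real.sqrt_sq (by positivity)]
  field_simp

lemma ApproxLim.tangential (hs : ∀ n, Step (2 ^ (n + 1)) (d n) (s n) (f n) (s (n + 1)))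
    (h : ApproxLim d s f g O W b V F a) (x : S2) : inner ℝ (b x) (x : E3) = 0 := by
  have h1 := tendsto_finsetSum Finset.univ fun i _ =>
    (((h.b i).tendsto x).comp (tendsto_add_atTop_nat 1)).const_mul ((x : E3) i)
  rw [PiLp.inner_apply]
  simp only [RCLike.inner_apply, conj_trivial]
  refine tendsto_nhds_unique h1 (tendsto_const_nhds.congr fun n => ?_)
  obtain ⟨φ, ψ, -, -, -, -, hb⟩ := (hs n).b_eq
  have := congrArg (fun f : SPoly => f x) (sum_X_hodge φ ψ)
  simp only [Function.comp_apply, hb]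
  simpa using this.symm

/-- All terms converge pointwise, and `tendsto_pr` removes the projection from the truncated
equation. -/
lemma ApproxLim.transport (hk : 11 ≤ k) (hA : Approx k A d s f)
    (h : ApproxLim d s f g O W b V F a) (x : S2) :
    F x = lie b F x + (-8 * W x + (1 / 2 * (div g b x * div g b x) +
      4 * ((W x + a) * div g b x) + 1 / 4 * hatDNormSq g b x)) := by
  have H := h.isLimit hA.step
  obtain ⟨B, hB⟩ := hA.exists_sn_source_le hk
  have h1 := (H.tendsto_adv h.f x).add (((h.W.tendsto x).const_mul (-8)).add
    (H.tendsto_quadE x (h.W.tendsto x) h.a))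
  have h2 := tendsto_pr hB (h1.congr fun n => by
    rw [srcE, add_fun, add_fun, smul_fun])
  refine tendsto_nhds_unique (h.f.tendsto x) (h2.congr fun n => ?_)
  rw [← (hA.step n).f_eq]

/-- The round divergence of the new field is `f - logE` minus its mean, and this mean is `8` times
the new constant; the limit of `logE` completes it to `div_g b`. -/
lemma ApproxLim.div_eq (hs : ∀ n, Step (2 ^ (n + 1)) (d n) (s n) (f n) (s (n + 1)))
    (h : ApproxLim d s f g O W b V F a) (x : S2) : div g b x = F x - 8 * a := by
  have H := h.isLimit hs
  have h1 := tendsto_finsetSum Finset.univ fun i _ =>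
    (((h.b i).tendsto_pd i x).comp (tendsto_add_atTop_nat 1))
  have h2 := ((h.f.tendsto x).sub (H.tendsto_logE x)).sub
    ((h.a.comp (tendsto_add_atTop_nat 1)).const_mul 8)
  have := tendsto_nhds_unique h1 (h2.congr fun n => by
    obtain ⟨φ, ψ, -, -, hφ, -, hb⟩ := (hs n).b_eq
    have h3 := congrArg (fun f : SPoly => f x) ((sum_D_hodge φ ψ).trans hφ)
    simp only [Function.comp_apply, hb, (hs n).a_eq]
    simp only [meanFree, sub_fun, sum_fun, algebraMap_fun, divRhs] at h3
    rw [h3, mul_div_cancel₀ _ (by norm_num : (8 : ℝ) ≠ 0)]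
    rfl)
  linarith

lemma mean_curlE (h : Fin 3 → Fin 3 → SPoly) (b : Fin 3 → SPoly) : mean (curlE h b) = 0 := by
  simp only [mean, curlE, map_sum, sInt_Z, Finset.sum_const_zero, zero_div]

/-- The solvability defect of the curl equation: `curlE` is a sum of derivatives and has mean zero,
and the rest tends to the mean of `O` times the density. For truncated data the defect vanishes only
in the limit. -/
lemma ApproxLim.tendsto_mean (hk : 11 ≤ k) (hA : Approx k A d s f)
    (h : ApproxLim d s f g O W b V F a) (hO : integralVol g O = 0) :
    Tendsto (fun n => mean (curlRhs (d n) (s n))) atTop (𝓝 0) := by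
  obtain ⟨k, rfl⟩ : ∃ l, k = l + 6 := ⟨k - 6, by lia⟩
  have hu := isO_uE (by lia) fun i j => (hA.isO_h i j).lower
  have h1 := (((IsO.const 1).add (hu.weaken zero_le_one)).mul (by lia)
    ((IsO.const 1).add (hA.isO_v.weaken zero_le_one))).mul (by lia) hA.isO_O
  have hc : Conv k (fun n => (1 + uE (d n).h) * (1 + (s n).v) * (d n).O)
      (fun x => O x * density g x) := by
    refine h1.conv fun x => ?_
    have t := ((tendsto_uE fun i j => (h.h i j).tendsto x).const_add 1).mul
      ((h.v.tendsto x).const_add 1) |>.mul (h.O.tendsto x)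
    have e : (1 + ((g x + normal x).det - 1)) * (1 + V x) * O x = O x * density g x := by
      have h2 := h.det hA.step x
      have h3 := h.density_mul hA.step x
      have h4 := h.V_pos x
      -- Both `density · (1 + V)` and `det · (1 + V)²` equal `1`.
      have h5 : density g x = (g x + normal x).det * (1 + V x) := by
        refine mul_right_cancel₀ h4.ne' ?_
        linear_combination h3 - h2
      rw [h5]; ring
    rw [e] at t
    simpa only [mul_fun, add_fun, one_fun] using t
  have h2 := (hc.tendsto_integral continuous_one (q := fun _ => 1)).div_const totalArea
  simp only [mul_one] at h2
  rw [show ∫ x, O x * density g x ∂area = 0 from hO, zero_div] at h2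
  refine h2.congr fun n => ?_
  rw [curlRhs, mean_sub, mean_curlE, sub_zero, mean, sInt_apply]

/-- In the limit the subtracted mean disappears, so the round curl plus `curlE` equals the density
times `O`. -/
lemma ApproxLim.curl_eq (hk : 11 ≤ k) (hA : Approx k A d s f)
    (h : ApproxLim d s f g O W b V F a) (hO : integralVol g O = 0) (x : S2) :
    curl g b x = O x := by
  have H := h.isLimit hA.step
  have hm := h.tendsto_mean hk hA hO
  have hV := h.V_pos x
  have h1 := (H.tendsto_curl (h.density_mul hA.step) x).const_mul (1 + V x)⁻¹
  choose G hG using fun j => (h.b j).deriv j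
  have hc := tendsto_finsetSum Finset.univ fun j _ => (hG j).tendsto x
  have he : Tendsto (fun n => curlE (d n).h (s n).b x) atTop
      (𝓝 ((1 + V x)⁻¹ * curl g b x - ∑ j, G j x)) := by
    refine (h1.sub hc).congr fun n => ?_
    rw [inv_mul_cancel_left₀ hV.ne', add_fun, sum_fun, add_sub_cancel_left]
  have hr := (((((tendsto_uE fun i j => (h.h i j).tendsto x).const_add 1).mul
      ((h.v.tendsto x).const_add 1)).mul (h.O.tendsto x)).sub he).sub hm
  have := tendsto_nhds_unique (hc.comp (tendsto_add_atTop_nat 1)) (hr.congr fun n => by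
    obtain ⟨φ, ψ, -, -, -, hψ, hb⟩ := (hA.step n).b_eq
    have h3 := congrArg (fun f : SPoly => f x) ((sum_Z_hodge φ ψ).trans hψ)
    simp only [Function.comp_apply, hb]
    simp only [meanFree, sub_fun, sum_fun, algebraMap_fun] at h3
    rw [h3, curlRhs]
    simp only [mul_fun, add_fun, sub_fun, one_fun])
  have hd := h.det hA.step x
  field_simp at this
  linear_combination this + O x * hd

lemma pd_add_const {F : S2 → ℝ} {f : ℕ → SPoly} (h : Conv 1 f F) (c : ℝ) (k : Fin 3) (x : S2) :
    pd k (fun y => F y + c) x = pd k F x := by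
  have h1 := (h.add_const_seq (algebraMap ℝ SPoly c)).tendsto_pd k x
  simp only [algebraMap_fun] at h1
  refine tendsto_nhds_unique h1 ((h.tendsto_pd k x).congr fun n => ?_)
  simp

/-- `div b` differs from `F` by the constant `8 a`, so both have the same derivative along `b`, and
the transport equation becomes the constraint. -/
lemma ApproxLim.seedConstraint (hk : 11 ≤ k) (hA : Approx k A d s f)
    (h : ApproxLim d s f g O W b V F a) : SeedConstraint g b (fun x => W x + a) := fun x => by
  have h1 := h.transport hk hA x
  have h2 : lie b (div g b) x = lie b F x := by
    have e : div g b = fun y => F y + -(8 * a) := by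
      funext y; rw [h.div_eq hA.step]; ring
    simp only [lie, e, pd_add_const h.f]
  have h3 := h.div_eq hA.step x
  rw [h2]
  linear_combination -h1 - h3

end

/-! ### Truncated data and existence of the solution -/

lemma DBd.mono {k : ℕ} {τ A A' : ℝ} {d d' : SData} (h : DBd k τ A d d') (hτ : 0 ≤ τ) (hA : A ≤ A') :
    DBd k τ A' d d' :=
  have h' := mul_le_mul_of_nonneg_left hA hτ
  ⟨fun i j => (h.h i j).mono hA h', h.O.mono hA h', h.W.mono hA h'⟩

lemma SBd.mono {k : ℕ} {τ A A' : ℝ} {s s' : SState} (h : SBd k τ A s s') (hτ : 0 ≤ τ) (hA : A ≤ A') :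
    SBd k τ A' s s' :=
  have h' := mul_le_mul_of_nonneg_left hA hτ
  ⟨fun i => (h.b i).mono hA h', h.v.mono hA h', h.a.trans hA, h.a'.trans hA, h.a_sub.trans h'⟩

lemma continuous_normal : Continuous normal := by
  refine continuous_matrix fun i j => ?_
  simp only [normal_apply]
  fun_prop

lemma IsMetric.continuous_sub {g : S2 → Matrix (Fin 3) (Fin 3) ℝ} (hg : IsMetric g) (i j : Fin 3) :
    Continuous fun x => (g x - SphereSeed.round x) i j := by
  have h1 : Continuous SphereSeed.round := continuous_const.sub continuous_normal
  exact (hg.continuous.sub h1).matrix_elem i j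

lemma IsMetric.continuous_density {g : S2 → Matrix (Fin 3) (Fin 3) ℝ} (hg : IsMetric g) :
    Continuous (density g) :=
  (hg.continuous.add continuous_normal).matrix_det.sqrt

/-- Bounds for the projections of the data. -/
structure DataBound (k : ℕ) (η : ℝ) (g : S2 → Matrix (Fin 3) (Fin 3) ℝ) (O W : S2 → ℝ) : Prop where
  metric : IsMetric g
  continuous_O : Continuous O
  continuous_W : Continuous W
  h : ∀ i j N, sn (k + 1) (proj N ((memLp_of_continuous (metric.continuous_sub i j)).toLp _)) ≤ η
  O : ∀ N, sn k (proj N ((memLp_of_continuous continuous_O).toLp O)) ≤ η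
  W : ∀ N, sn k (proj N ((memLp_of_continuous continuous_W).toLp W)) ≤ η

/-- The truncated data. -/
def DataBound.data {k : ℕ} {η : ℝ} {g : S2 → Matrix (Fin 3) (Fin 3) ℝ} {O W : S2 → ℝ}
    (H : DataBound k η g O W) (n : ℕ) : SData where
  h i j := proj (2 ^ (n + 1)) ((memLp_of_continuous (H.metric.continuous_sub i j)).toLp _)
  O := proj (2 ^ (n + 1)) ((memLp_of_continuous H.continuous_O).toLp O)
  W := proj (2 ^ (n + 1)) ((memLp_of_continuous H.continuous_W).toLp W)

lemma DataBound.dBd {k : ℕ} (hk : 2 ≤ k) {η : ℝ} {g : S2 → Matrix (Fin 3) (Fin 3) ℝ} {O W : S2 → ℝ}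
    (H : DataBound k η g O W) (n : ℕ) :
    DBd k ((1 / 2) ^ (n + 1)) ((k + 2) * η) (H.data n) (H.data (n + 1)) := by
  have hη : 0 ≤ η := (sn_nonneg _ _).trans (H.O 0)
  have hle : ((k : ℝ) + 1) * η ≤ (k + 2) * η := by gcongr; norm_num
  have hle' := mul_le_mul_of_nonneg_left hle (by positivity : (0 : ℝ) ≤ (1 / 2) ^ (n + 1))
  refine ⟨fun i j => ?_, (bd_proj hk H.O n).mono hle hle', (bd_proj hk H.W n).mono hle hle'⟩
  have := bd_proj (by lia) (H.h i j) n
  push_cast at this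
  rwa [show (k : ℝ) + 1 + 1 = k + 2 by ring] at this

theorem exists_solution (k : ℕ) (hk : 11 ≤ k) : ∃ η₀ C : ℝ, 0 < η₀ ∧ 0 < C ∧
    ∀ η : ℝ, 0 ≤ η → η ≤ η₀ → ∀ (g : S2 → Matrix (Fin 3) (Fin 3) ℝ) (O W : S2 → ℝ),
      DataBound k η g O W → integralVol g O = 0 → ∃ (b : S2 → E3) (a : ℝ),
        (∀ i, IsCn 2 fun x => b x i) ∧ (∀ x : S2, inner ℝ (b x) (x : E3) = 0) ∧
        (∀ i, sobolevSq (k + 1) (fun x => b x i) ≤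
          ENNReal.ofReal (4 ^ (k + 1) * (4 ^ (k + 1) * (C * η)) ^ 2)) ∧
        SeedConstraint g b (fun x => W x + a) ∧ (∀ x, curl g b x = O x) ∧ |a| ≤ C * η ∧
        ∀ x, 0 < density g x := by
  obtain ⟨η₁, C₁, hη₁, hC₁, hit⟩ := exists_iteration k (by lia)
  obtain ⟨Cs, hCs, hs⟩ := exists_abs_le_sn
  set C : ℝ := (C₁ + 1) * (k + 2) with hC
  have hCpos : 0 < C := by positivity
  -- In turn: smallness for the iteration, where truncation costs the factor `k + 2`; the
  -- normalisation `A ≤ 1`; and `|V| ≤ 1/2`, hence `1 + V > 0`.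
  refine ⟨min (η₁ / (k + 2)) (min (1 / C) (1 / (2 * Cs * C))), C, by positivity, hCpos,
    fun η hη hηle g O W H hO => ?_⟩
  have hη1 : (k + 2) * η ≤ η₁ := by
    have := hηle.trans (min_le_left _ _)
    rw [le_div_iff₀ (by positivity)] at this
    linarith
  have hA1 : C * η ≤ 1 := by
    have := hηle.trans ((min_le_right _ _).trans (min_le_left _ _))
    rw [le_div_iff₀ (by positivity)] at this
    linarith
  have hA2 : Cs * (C * η) ≤ 1 / 2 := by
    have := hηle.trans ((min_le_right _ _).trans (min_le_right _ _))
    rw [le_div_iff₀ (by positivity)] at this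
    linarith
  have hdle : (k + 2) * η ≤ C * η := by
    rw [hC]
    have : 0 ≤ C₁ * ((k + 2) * η) := by positivity
    linarith
  have hsle : C₁ * ((k + 2) * η) ≤ C * η := by
    rw [hC]
    have : 0 ≤ (k + 2) * η := by positivity
    linarith
  obtain ⟨s, f, hstep, hsb, hfb⟩ := hit ((k + 2) * η) (by positivity) hη1 H.data
    (H.dBd (by lia))
  have hA : Approx k (C * η) H.data s f :=
    ⟨hstep, fun n => (H.dBd (by lia) n).mono (by positivity) hdle,
      fun n => (hsb n).mono (by positivity) hsle,
      fun n => (hfb n).mono hsle (mul_le_mul_of_nonneg_left hsle (by positivity)), hA1⟩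
  -- Six orders are spent on convergence, two on differences and four on the Sobolev embedding; `b`,
  -- bounded in order `k + 1`, keeps `j + 2`.
  obtain ⟨j, rfl⟩ : ∃ j, k = j + 1 + 6 := ⟨k - 7, by lia⟩
  have hb : ∀ i, ∃ B, Conv (j + 2) (fun n => (s n).b i) B := fun i =>
    Bd.exists_conv (τ := 1) fun n => by
      rw [mul_one]; exact (hA.s n).b i
  choose B hB using hb
  obtain ⟨V, hV⟩ := Bd.exists_conv (j := j + 1) (τ := 1) (p := fun n => (s n).v) fun n => by
    rw [mul_one]; exact (hA.s n).v
  obtain ⟨F, hF⟩ := Bd.exists_conv (j := j + 1) (τ := 1 / 2) (p := f) fun n => by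
    rw [← pow_succ]; exact hA.f n
  obtain ⟨a, ha⟩ : ∃ a, Tendsto (fun n => (s n).a) atTop (𝓝 a) :=
    cauchySeq_tendsto_of_complete (cauchySeq_of_le_geometric (1 / 2) (C * η) (by norm_num)
      fun n => by
        rw [Real.dist_eq, mul_comm]
        exact (hA.s n).a_sub)
  have hV0 : ∀ x, 0 < 1 + V x := fun x => by
    have h1 : |V x| ≤ 1 / 2 := le_of_tendsto' (hV.tendsto x).abs fun n =>
      (hs _ x).trans (le_trans (by
        gcongr
        exact (sn_mono (by lia) _).trans (hA.s n).v.left) hA2)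
    linarith [(abs_le.mp h1).1]
  have hL : ApproxLim H.data s f g O W (fun x => WithLp.toLp 2 fun i => B i x) V F a :=
    ⟨H.metric, fun i l => (conv_proj (j := j + 2) (H.metric.continuous_sub i l)
      (H.h i l)).mono (by lia), (conv_proj (j := j + 1) H.continuous_O H.O).mono (by lia),
      (conv_proj (j := j + 1) H.continuous_W H.W).mono (by lia),
      fun i => (hB i).mono (by lia), hV.mono (by lia), hF.mono (by lia), ha, hV0⟩
  refine ⟨_, a, fun i => (hL.b i).isCn, hL.tangential hstep, fun i =>
    (hL.b i).sobolevSq_le fun n => ((hA.s n).b i).left, hL.seedConstraint hk hA,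
    hL.curl_eq hk hA hO, le_of_tendsto' ha.abs fun n => (hA.s n).a, fun x => ?_⟩
  exact pos_of_mul_pos_left (by rw [hL.density_mul hstep x]; exact one_pos) (hV0 x).le

/-! ### From the Sobolev hypotheses to bounds on projections -/

lemma lt_of_rpow_half_le {S : ℝ≥0∞} {r A : ℝ} (hr : 0 ≤ r) (hA : r < A)
    (h : S ^ (1 / 2 : ℝ) ≤ ENNReal.ofReal r) : S < ENNReal.ofReal (A ^ 2) := by
  have h1 : S = (S ^ (1 / 2 : ℝ)) ^ 2 := by
    rw [← ENNReal.rpow_natCast, ← ENNReal.rpow_mul]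
    norm_num
  rw [h1]
  refine (pow_le_pow_left₀ zero_le h 2).trans_lt ?_
  rw [← ENNReal.ofReal_pow hr, ENNReal.ofReal_lt_ofReal_iff (pow_pos (hr.trans_lt hA) 2)]
  exact pow_lt_pow_left₀ hA hr two_ne_zero

lemma rpow_half_le {S : ℝ≥0∞} {A : ℝ} (hA : 0 ≤ A) (h : S ≤ ENNReal.ofReal (A ^ 2)) :
    S ^ (1 / 2 : ℝ) ≤ ENNReal.ofReal A := by
  refine (ENNReal.rpow_le_rpow h (by norm_num)).trans_eq ?_
  rw [ENNReal.ofReal_pow hA, ← ENNReal.rpow_natCast, ← ENNReal.rpow_mul]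
  norm_num

/-- Rotation fields are divergence free, so a constant has weak derivative zero. -/
lemma IsWeakRot.sub_const {i : Fin 3} {f h : S2 → ℝ} (H : IsWeakRot i f h) (c : ℝ) :
    IsWeakRot i (fun x => f x - c) h := by
  refine ⟨H.1.sub (memLp_const c), H.2.1, fun φ hφ => ?_⟩
  have hφ1 : ContDiff ℝ 1 φ := hφ.of_le (by exact_mod_cast le_top)
  have hc : Continuous fun x : S2 => fderiv ℝ φ (x : E3) (rot i x) :=
    ((hφ1.continuous_fderiv one_ne_zero).clm_apply (continuous_rot i)).comp continuous_subtype_val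
  have hi : Integrable (fun x : S2 => f x * fderiv ℝ φ (x : E3) (rot i x)) area :=
    H.1.integrable_mul (memLp_of_continuous hc)
  simp only [sub_mul]
  rw [integral_sub hi ((integrable_of_continuous hc).const_mul c), integral_const_mul,
    integral_rot_eq_zero i φ hφ1, mul_zero, sub_zero]
  exact H.2.2 φ hφ

lemma gradSobolevSq_sub_const_le (k : ℕ) (f : S2 → ℝ) (c : ℝ) :
    gradSobolevSq k (fun x => f x - c) ≤ gradSobolevSq k f :=
  Finset.sum_le_sum fun _ _ => le_iInf₂ fun h hh => iInf₂_le h (hh.sub_const c)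

/-- For mean zero the Poincaré inequality controls the `L²` norm by the gradient; `6` is `3` for
this norm plus `1` for each of three derivatives. -/
lemma sn_proj_le_of_grad {k : ℕ} {f : S2 → ℝ} (hf : Continuous f) (h0 : ∫ x, f x ∂area = 0) {A : ℝ}
    (hA : 0 ≤ A) (h : gradSobolevSq k f < ENNReal.ofReal (A ^ 2)) (N : ℕ) :
    sn k (proj N ((memLp_of_continuous hf).toLp f)) ≤ 6 * (4 ^ k * A) := by
  set p := proj N ((memLp_of_continuous hf).toLp f) with hp
  have hZ : ∀ i, sn k (Z i p) ≤ 4 ^ k * A := fun i => sn_Z_proj_le _ hA h N i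
  have hp0 : sInt p = 0 := by
    have h1 : (1 : SPoly) ∈ Pdeg N := by
      simpa using algebraMap_mem_Pdeg 1 N
    have := inner_proj N ((memLp_of_continuous hf).toLp f) h1
    rw [mul_one, toL2_eq, inner_toLp] at this
    simpa [h0] using this
  have hn : ‖toL2 p‖ ≤ 3 * (4 ^ k * A) := by
    have h1 := poincare_zero hp0
    simp only [← norm_toL2_sq, Fin.sum_univ_three] at h1
    have h2 : ∀ i, ‖toL2 (Z i p)‖ ^ 2 ≤ (4 ^ k * A) ^ 2 := fun i =>
      pow_le_pow_left₀ (norm_nonneg _) ((norm_le_sn k _).trans (hZ i)) 2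
    have hB : 0 ≤ 4 ^ k * A := by positivity
    refine le_of_sq_le_sq ?_ (by positivity)
    nlinarith [h2 0, h2 1, h2 2]
  refine (sn_le_succ k p).trans ?_
  rw [sn_succ, Fin.sum_univ_three]
  linarith [hZ 0, hZ 1, hZ 2]

/-- Integrating `f - m` against the density of `g` gives `-m` times the total mass. -/
lemma abs_le_of_integralVol_eq_zero {g : S2 → Matrix (Fin 3) (Fin 3) ℝ} (hg : IsMetric g)
    (hpos : ∀ x, 0 < density g x) {f : S2 → ℝ} (hf : Continuous f) {m B : ℝ}
    (hB : ∀ x, |f x - m| ≤ B) (h : integralVol g f = 0) : |m| ≤ B := by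
  have hc := hg.continuous_density
  have hI : 0 < ∫ x, density g x ∂area := by
    have x₀ : S2 := ⟨EuclideanSpace.single 0 1, by simp⟩
    exact hc.integral_pos_of_hasCompactSupport_nonneg_nonzero (HasCompactSupport.of_compactSpace _)
      (fun x => (hpos x).le) (hpos x₀).ne'
  have h1 : ∫ x, (f x - m) * density g x ∂area = -(m * ∫ x, density g x ∂area) := by
    have h2 : ∫ x, f x * density g x ∂area = 0 := h
    have hi : Integrable (fun x => f x * density g x) area :=
      integrable_of_continuous (hf.mul hc)
    simp only [sub_mul]
    rw [integral_sub hi ((integrable_of_continuous hc).const_mul m), h2, integral_const_mul, zero_sub]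
  have h2 : |∫ x, (f x - m) * density g x ∂area| ≤ B * ∫ x, density g x ∂area := by
    rw [← integral_const_mul, ← Real.norm_eq_abs]
    refine norm_integral_le_of_norm_le ((integrable_of_continuous hc).const_mul B)
      (ae_of_all _ fun x => ?_)
    rw [norm_mul, Real.norm_eq_abs, Real.norm_eq_abs, abs_of_pos (hpos x)]
    exact mul_le_mul_of_nonneg_right (hB x) (hpos x).le
  rw [h1, abs_neg, abs_mul, abs_of_pos hI] at h2
  exact le_of_mul_le_mul_right h2 hI

lemma abs_le_of_sn_proj_le {k : ℕ} (hk : 6 ≤ k) : ∃ C : ℝ, 0 < C ∧ ∀ (f : S2 → ℝ)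
    (hf : Continuous f) (A : ℝ), (∀ N, sn k (proj N ((memLp_of_continuous hf).toLp f)) ≤ A) →
      ∀ x, |f x| ≤ C * A := by
  obtain ⟨C, hC, hs⟩ := exists_abs_le_sn
  obtain ⟨j, rfl⟩ : ∃ j, k = j + 6 := ⟨k - 6, by lia⟩
  refine ⟨C, hC, fun f hf A h x => ?_⟩
  exact le_of_tendsto' ((conv_proj hf h).tendsto x).abs fun n =>
    (hs _ x).trans (by gcongr; exact (sn_mono (by lia) _).trans (h _))

end

end SphereSeed

/-! ### Normalisation of `W` and choice of the constants -/

open SphereSeed in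
theorem proposition5p5 :
    ∃ M₀ : ℕ, ∀ M : ℕ, M₀ ≤ M → ∀ K : ℝ, 0 < K →
      ∃ ε₀ : ℝ, 0 < ε₀ ∧ ∃ C : ℝ, 0 < C ∧
        ∀ ε : ℝ, 0 < ε → ε ≤ ε₀ →
          ∀ (g : S2 → Matrix (Fin 3) (Fin 3) ℝ) (O W : S2 → ℝ),
            IsMetric g →
            tensorNorm M (fun x => g x - SphereSeed.round x) ≤ ENNReal.ofReal (K * ε) →
            Continuous O → Continuous W →
            integralVol g O = 0 → integralVol g W = 0 →
            dataNorm (M - 1) O W ≤ ENNReal.ofReal (K * ε) →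
            ∃ (b : S2 → E3) (a : ℝ),
              (∀ i : Fin 3, IsCn 2 (fun x => b x i)) ∧
              (∀ x : S2, inner ℝ (b x) (x : E3) = 0) ∧
              vectorNorm M b ≤ ENNReal.ofReal (C * ε) ∧
              SeedConstraint g b (fun x => W x + a) ∧
              (∀ x : S2, curl g b x = O x) ∧
              |a| ≤ C * ε := by
  -- `M = k + 1` with `k ≥ 11`: products need order `10`, and the term `L_b f` loses one derivative
  -- of `f`, which has order `k`.
  refine ⟨12, fun M hM K hK => ?_⟩
  obtain ⟨k, rfl⟩ : ∃ k, M = k + 1 := ⟨M - 1, by lia⟩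
  rw [Nat.add_sub_cancel]
  obtain ⟨η₀, C, hη₀, hC, hsol⟩ := exists_solution k (by lia)
  obtain ⟨Cs, hCs, hsup⟩ := abs_le_of_sn_proj_le (k := k) (by lia)
  -- `6` is the cost of recovering `W` from its gradient, `4 ^ (k + 1)` that of passing to
  -- projections, and the doubling of `K` makes the Sobolev bounds strict.
  set R : ℝ := 6 * (4 ^ (k + 1) * (2 * K)) with hR
  have hRpos : 0 < R := by positivity
  refine ⟨η₀ / R, by positivity, (2 * 4 ^ (k + 1) * 4 ^ (k + 1) * C + C + Cs) * R, by positivity,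
    fun ε hε hεle g O W hg hgM hO hW hOg hWg hd => ?_⟩
  have hηle : R * ε ≤ η₀ := by
    rw [le_div_iff₀ hRpos] at hεle
    linarith
  have hη : 0 ≤ R * ε := by positivity
  have hKε : 0 ≤ K * ε := by positivity
  have hA : 0 ≤ 2 * K * ε := by positivity
  have hlt : K * ε < 2 * K * ε := by nlinarith [mul_pos hK hε]
  have hh := lt_of_rpow_half_le hKε hlt hgM
  have hOW := lt_of_rpow_half_le hKε hlt hd
  have hle : ∀ l, l ≤ k + 1 → 4 ^ l * (2 * K * ε) ≤ R * ε := fun l hl => by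
    have h1 : (4 : ℝ) ^ l * (2 * K * ε) ≤ 4 ^ (k + 1) * (2 * K * ε) := by
      gcongr
      norm_num
    have h2 : 0 ≤ (4 : ℝ) ^ (k + 1) * (2 * K * ε) := by positivity
    have h3 : R * ε = 6 * (4 ^ (k + 1) * (2 * K * ε)) := by rw [hR]; ring
    linarith
  -- The round mean is removed so that the gradient bound controls `W - m`; it returns in the
  -- constant `a - m`.
  set m : ℝ := (∫ x, W x ∂area) / area.real Set.univ with hm
  have hWm : Continuous fun x => W x - m := hW.sub continuous_const
  have hWm0 : ∫ x, (W x - m) ∂area = 0 := by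
    rw [integral_sub (integrable_of_continuous hW) (integrable_const m), integral_const,
      smul_eq_mul, hm, mul_div_cancel₀ _ (measureReal_univ_pos (μ := area)).ne', sub_self]
  have hdata : DataBound k (R * ε) g O fun x => W x - m := by
    refine ⟨hg, hO, hWm, fun i j N => (sn_proj_le _ hA (lt_of_le_of_lt ?_ hh) N).trans
      (hle _ le_rfl), fun N => (sn_proj_le _ hA (lt_of_le_of_lt le_self_add hOW) N).trans
      (hle _ (Nat.le_succ k)), fun N => (sn_proj_le_of_grad hWm hWm0 hA (lt_of_le_of_lt
        ((gradSobolevSq_sub_const_le k W m).trans le_add_self) hOW) N).trans ?_⟩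
    · refine le_trans ?_ (Finset.single_le_sum (f := fun i => ∑ j : Fin 3, sobolevSq (k + 1)
        fun x => (g x - SphereSeed.round x) i j) (fun _ _ => zero_le) (Finset.mem_univ i))
      exact Finset.single_le_sum (f := fun j => sobolevSq (k + 1)
        fun x => (g x - SphereSeed.round x) i j) (fun _ _ => zero_le) (Finset.mem_univ j)
    · have h1 : (4 : ℝ) ^ k * (2 * K * ε) ≤ 4 ^ (k + 1) * (2 * K * ε) := by
        gcongr
        · norm_num
        · exact Nat.le_succ k
      have h3 : R * ε = 6 * (4 ^ (k + 1) * (2 * K * ε)) := by rw [hR]; ring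
      linarith
  obtain ⟨b, a, hb, hbx, hbM, hseed, hcurl, ha, hpos⟩ := hsol _ hη hηle g O _ hdata hOg
  have hma := abs_le_of_integralVol_eq_zero hg hpos hW (hsup _ hWm _ hdata.W) hWg
  set Y : ℝ := 4 ^ (k + 1) with hY
  have hY1 : 1 ≤ Y := one_le_pow₀ (by norm_num)
  refine ⟨b, a - m, hb, hbx, ?_, ?_, hcurl, ?_⟩
  · have h1 : vectorNorm (k + 1) b ≤ ENNReal.ofReal (2 * Y * Y * (C * (R * ε))) := by
      refine rpow_half_le (by positivity) ((Finset.sum_le_sum fun i _ => hbM i).trans ?_)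
      rw [Finset.sum_const, Finset.card_univ, Fintype.card_fin, nsmul_eq_mul,
        show ((3 : ℕ) : ℝ≥0∞) = ENNReal.ofReal 3 by simp, ← ENNReal.ofReal_mul (by norm_num)]
      refine ENNReal.ofReal_le_ofReal ?_
      -- With `X = C R ε`, the three components sum to at most `3 Y (Y X)²`, and `3 ≤ 4 Y`.
      have h2 : 0 ≤ Y * (Y * (C * (R * ε))) ^ 2 := by positivity
      have h3 : (2 * Y * Y * (C * (R * ε))) ^ 2 = 4 * Y * (Y * (Y * (C * (R * ε))) ^ 2) := by ring
      rw [h3]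
      nlinarith
    refine h1.trans (ENNReal.ofReal_le_ofReal ?_)
    have : 0 ≤ (C + Cs) * (R * ε) := by positivity
    linarith
  · have e : (fun x => W x + (a - m)) = fun x => W x - m + a := by funext x; ring
    rw [e]
    exact hseed
  · have h1 := abs_sub a m
    have h2 : 0 ≤ 2 * Y * Y * C * (R * ε) := by positivity
    linarith
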